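/- **The graph.** Let $L=1/\sqrt3$, $\mathbf v_1=(\frac{\sqrt3}{2},-\frac12)$, $\mathbf v_2=(\frac{\sqrt3}{2},\frac12)$, $\mathbf e_y=\mathbf v_2-\mathbf v_1$, $A_{m,n}=(\frac L2,\frac12)+m\mathbf v_1+n\mathbf v_2$, $B_{m,n}=(-\frac L2,\frac12)+m\mathbf v_1+n\mathbf v_2$ for $m,n\in\mathbb Z$. Let $\mathcal G$ be the hexagonal graph with these vertices, in which every $A_{m,n}$ is joined by segments of length $L$ to $B_{m,n}$, $B_{m+1,n}$, $B_{m,n+1}$; edges are parametrised by arc length from the $A$-point to the $B$-point. For $t\in[0,2L]$ put $\alpha(t)=-L+\frac t2$ if $t\le L$, $\alpha(t)=-\frac L2+(t-L)$ if $t\ge L$, and let $\mathcal G_t=\mathcal G\cap\{x>\alpha(t)\}$ be the graph cut at the abscissa $\alpha(t)$ (edges may be truncated), and $\partial\mathcal G_t=\overline{\mathcal G_t}\cap\{x=\alpha(t)\}$. For $\mu>0$ let the weight $w_\mu(e)$ of an edge (or of its truncation) be $1$ if $e\subset\mathcal G_L$ and $\mu$ otherwise; thus in $\mathcal G_0$ the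 zigzag edges along the boundary have weight $\mu$ and all others have weight $1$. **The operators.** Let $\beta\in\mathbb R$. In the space $L^2$ over one period (in the direction $\mathbf e_y$) of $\mathcal G_t$, with the weight $w_\mu$, the operators $\mathcal D^t_\mu(\beta)$ and $\mathcal N^t_\mu(\beta)$ act as $u\mapsto-u''$ on every edge. Their domains consist of the functions $u$, continuous on $\overline{\mathcal G_t}$ and $\beta$-quasi-periodic, i.e. $u(\mathbf x+\mathbf e_y)=e^{2i\pi\beta}u(\mathbf x)$, which are $H^2$ on every edge with $\|u\|_{H^2}^2$ summable over the edges of one period, which satisfy the Kirchhoff condition $\sum_{e\ni M}w_\mu(e)\,(u|_e)'(M)=0$ at every vertex $M$ of $\mathcal G_t$ (with $x(M)>\alpha(t)$), and which satisfy on $\partial\mathcal G_t$ the Dirichlet condition $u=0$ for $\mathcal D^t_\mu(\beta)$, and the Neumann condition $u'=0$ for $\mathcal N^t_\mu(\beta)$. At a boundary point which is a vertex of $\mathcal G$ (this happens for $t\in\{0,L,2L\}$) the Neumann condition means the Kirchhoff condition over the edges of $\mathcal G_t$ that meet this vertex. The essential spectrum $\sigma_{\mathrm{ess}}(T)$ of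 such an operator $T$ is the set of $\lambda$ for which $T-\lambda$, as a bounded operator from the domain of $T$ with its graph norm, is not Fredholm. A *gap* of $T$ is a nonempty bounded open interval which does not meet $\sigma_{\mathrm{ess}}(T)$ and whose endpoints belong to $\sigma_{\mathrm{ess}}(T)$, i.e. a bounded connected component of $\mathbb R\setminus\sigma_{\mathrm{ess}}(T)$. (Isolated eigenvalues of finite multiplicity may lie in a gap.) **Proposition.** For $n\in\mathbb N=\{0,1,2,\dots\}$ put $\lambda_n^*=\left(\frac{\pi}{2L}+\frac{n\pi}{L}\right)^2$. For all $\beta\in[0,1/2)\setminus\{1/3\}$ and all $n\in\mathbb N$ there is an interval $I^n(\beta)$ containing $\lambda_n^*$ such that, for all $t\in[0,2L]$ and all $\mu>0$, $I^n(\beta)$ is a gap of $\mathcal D^t_\mu(\beta)$ and a gap of $\mathcal N^t_\mu(\beta)$. In particular, the gap $I^n(\beta)$ does not depend on $t$ and $\mu$. -/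

import Mathlib

open MeasureTheory Set

noncomputable section

namespace Honeycomb

/-! ### Geometry of the hexagonal graph -/

/-- Length of the edges. -/
def edgeLen : ℝ := 1 / √3

def vec₁ : ℝ × ℝ := (√3 / 2, -1 / 2)

def vec₂ : ℝ × ℝ := (√3 / 2, 1 / 2)

/-- Vertices: `A m n` stands for `A + m v₁ + n v₂`, and `B m n` for `B + m v₁ + n v₂`. -/
inductive Vertex
  | A (m n : ℤ)
  | B (m n : ℤ)

def Vertex.pos : Vertex → ℝ × ℝ
  | .A m n => (edgeLen / 2, 1 / 2) + (m : ℝ) • vec₁ + (n : ℝ) • vec₂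
  | .B m n => (-edgeLen / 2, 1 / 2) + (m : ℝ) • vec₁ + (n : ℝ) • vec₂

/-- The edge `(j, m, n)` is `e_j + m v₁ + n v₂`. -/
abbrev Edge : Type := Fin 3 × ℤ × ℤ

/-- All edges are oriented from an `A`-point to a `B`-point. -/
def Edge.source (e : Edge) : Vertex := .A e.2.1 e.2.2

def Edge.target (e : Edge) : Vertex :=
  match e with
  | (0, m, n) => .B m n
  | (1, m, n) => .B (m + 1) n
  | (2, m, n) => .B m (n + 1)

/-- Parametrisation of an edge by `s ∈ [0, L]`. -/
def Edge.point (e : Edge) (s : ℝ) : ℝ × ℝ :=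
  (1 - s / edgeLen) • e.source.pos + (s / edgeLen) • e.target.pos

/-- The three edges that meet at a vertex. -/
def Vertex.edges : Vertex → Finset Edge
  | .A m n => {(0, m, n), (1, m, n), (2, m, n)}
  | .B m n => {(0, m, n), (1, m - 1, n), (2, m, n - 1)}

/-- The value of the edge parameter at a vertex, on every edge that meets this vertex. -/
def Vertex.param : Vertex → ℝ
  | .A _ _ => 0
  | .B _ _ => edgeLen

/-- Translation of an edge by `e_y = v₂ - v₁`. -/
def Edge.up (e : Edge) : Edge := (e.1, e.2.1 - 1, e.2.2 + 1)

theorem Edge.point_up (e : Edge) (s : ℝ) : e.up.point s = e.point s + (vec₂ - vec₁) := by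
  obtain ⟨j, m, n⟩ := e
  ext <;> fin_cases j <;>
    simp [Edge.up, Edge.point, Edge.source, Edge.target, Vertex.pos, vec₁, vec₂] <;> ring

theorem Edge.point_param {M : Vertex} {e : Edge} (h : e ∈ M.edges) :
    e.point M.param = M.pos := by
  have h0 : edgeLen ≠ 0 := by simp [edgeLen]
  cases M <;> simp only [Vertex.edges, Finset.mem_insert, Finset.mem_singleton] at h <;>
    rcases h with rfl | rfl | rfl <;>
    simp [Vertex.param, Edge.point, Edge.source, Edge.target, h0]

/-! ### The truncated graphs -/

/-- Abscissa of the cut. -/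
def cut (t : ℝ) : ℝ :=
  if t ≤ edgeLen then -edgeLen + t / 2 else -edgeLen / 2 + (t - edgeLen)

/-- Parameters of the part of the open edge `e` that lies in the truncated graph
`G_t = G ∩ {x > cut t}`: the whole edge, a truncated edge, or nothing. -/
def part (t : ℝ) (e : Edge) : Set ℝ := {s | s ∈ Ioo 0 edgeLen ∧ cut t < (e.point s).1}

open Classical in
/-- Edges of `G_t`, whole or truncated, that are adjacent to the vertex `M`. -/
def adjacent (t : ℝ) (M : Vertex) : Finset Edge := M.edges.filter fun e => (part t e).Nonempty

open Classical in
/-- The weight of an edge: `1` on the edges that are included in `G_L`, and `μ` on the others.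
Inside `G_0`, the latter are the zigzag edges along the boundary. -/
def weight (μ : ℝ) (e : Edge) : ℝ := if part edgeLen e = Ioo 0 edgeLen then 1 else μ

/-- One representative `e_j + k v₂` of each class of edges modulo translations by `e_y`. These
edges make up one period of the graph. Norms of quasi-periodic functions over one period do not
depend on the choice of the representatives. -/
def rep (p : Fin 3 × ℤ) : Edge := (p.1, 0, p.2)

/-- The measure `w_μ(e) ds` on the part of an edge of the period that lies in `G_t`. -/
def edgeMeasure (t μ : ℝ) (p : Fin 3 × ℤ) : Measure ℝ :=
  ENNReal.ofReal (weight μ (rep p)) • volume.restrict (part t (rep p))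

/-- The Hilbert space `L²` over one period of `G_t`, with the weight `w_μ`. -/
abbrev GraphL2 (t μ : ℝ) : Type :=
  lp (fun p : Fin 3 × ℤ => Lp ℂ 2 (edgeMeasure t μ p)) 2

/-! ### Domains of the operators -/

/-- `u` is a `β`-quasi-periodic function of class `H²` over one period of `G_t`, and `u'`, `u''`
are its derivatives along the edges. In one dimension `H²` functions are those whose derivative
`u'` is the primitive of a square integrable function `u''`; closed edges are used, so `u` and
`u'` are the continuous representatives and have values at the vertices and at the cut. -/
structure IsH2 (t β : ℝ) (u u' u'' : Edge → ℝ → ℂ) : Prop where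
  memLp : ∀ e, MemLp (u'' e) 2 (volume.restrict (part t e))
  integral_deriv : ∀ e, ∀ a ∈ closure (part t e), ∀ b ∈ closure (part t e),
    u e b - u e a = ∫ s in a..b, u' e s
  integral_deriv2 : ∀ e, ∀ a ∈ closure (part t e), ∀ b ∈ closure (part t e),
    u' e b - u' e a = ∫ s in a..b, u'' e s
  summable : Summable fun p : Fin 3 × ℤ =>
    ∫ s in part t (rep p), (‖u (rep p) s‖ ^ 2 + ‖u' (rep p) s‖ ^ 2 + ‖u'' (rep p) s‖ ^ 2)
  continuous_vertex : ∀ M : Vertex, cut t ≤ M.pos.1 →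
    ∀ e ∈ adjacent t M, ∀ e' ∈ adjacent t M, u e M.param = u e' M.param
  quasiperiodic : ∀ e, ∀ s ∈ closure (part t e),
    u e.up s = Complex.exp (2 * Real.pi * Complex.I * β) * u e s

/-- Weighted Kirchhoff condition at the vertex `M`. -/
def Kirchhoff (t μ : ℝ) (u' : Edge → ℝ → ℂ) (M : Vertex) : Prop :=
  ∑ e ∈ adjacent t M, (weight μ e : ℂ) * u' e M.param = 0

/-- The two boundary conditions on the cut. -/
inductive BoundaryType
  | dirichlet
  | neumann

/-- Boundary condition on `∂G_t`, the points of the closure of `G_t` of abscissa `cut t`. Where a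
boundary point is a vertex of `G` (that is, for `t ∈ {0, L, 2L}`), the Neumann condition is
the Kirchhoff condition with respect to the edges of `G_t` that meet it (two edges if
`t ∈ {0, 2L}`, and a single one if `t = L`, in which case it reads `u' = 0`). -/
def BoundaryCondition (t μ : ℝ) (u u' : Edge → ℝ → ℂ) : BoundaryType → Prop
  | .dirichlet => ∀ e, ∀ s ∈ closure (part t e), (e.point s).1 = cut t → u e s = 0
  | .neumann =>
      (∀ e, ∀ s ∈ closure (part t e), s ∈ Ioo 0 edgeLen → (e.point s).1 = cut t → u' e s = 0) ∧
      ∀ M : Vertex, M.pos.1 = cut t → Kirchhoff t μ u' M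

/-- `(f, g)` belongs to the graph of the operator: `f` is the restriction to one period of a
function `u` of the domain, and `g = -u''`. -/
structure IsPair (bc : BoundaryType) (t μ β : ℝ) (f g : GraphL2 t μ)
    (u u' u'' : Edge → ℝ → ℂ) : Prop where
  isH2 : IsH2 t β u u' u''
  kirchhoff : ∀ M : Vertex, cut t < M.pos.1 → Kirchhoff t μ u' M
  boundary : BoundaryCondition t μ u u' bc
  fst : ∀ p, f p =ᵐ[edgeMeasure t μ p] u (rep p)
  snd : ∀ p, g p =ᵐ[edgeMeasure t μ p] fun s => -u'' (rep p) s


/-! ### Elementary facts that turn these pairs into the graph of an operator -/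

theorem convex_part (t : ℝ) (e : Edge) : Convex ℝ (part t e) := by
  apply Set.OrdConnected.convex
  refine ⟨fun x hx y hy z hz => ⟨⟨hx.1.1.trans_le hz.1, hz.2.trans_lt hy.1.2⟩, ?_⟩⟩
  have h1 := hx.2
  have h2 := hy.2
  simp only [Edge.point, Prod.fst_add, Prod.smul_fst, smul_eq_mul] at h1 h2 ⊢
  set p := e.source.pos.1
  set q := e.target.pos.1
  have key : ∀ s : ℝ, (1 - s / edgeLen) * p + s / edgeLen * q = p + s * ((q - p) / edgeLen) := by
    intro s; ring
  rw [key] at h1 h2 ⊢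
  rcases le_total 0 ((q - p) / edgeLen) with h | h
  · nlinarith [mul_le_mul_of_nonneg_right hz.1 h]
  · nlinarith [mul_le_mul_of_nonpos_right hz.2 h]

theorem isOpen_part (t : ℝ) (e : Edge) : IsOpen (part t e) := by
  have hc : Continuous fun s => (e.point s).1 := by
    simp only [Edge.point, Prod.fst_add, Prod.smul_fst, smul_eq_mul]
    fun_prop
  exact isOpen_Ioo.inter (isOpen_lt continuous_const hc)

theorem volume_part_ne_top (t : ℝ) (e : Edge) : volume (part t e) ≠ ⊤ :=
  ((measure_mono fun _ hs => hs.1).trans_lt (measure_Ioo_lt_top (a := 0) (b := edgeLen))).ne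

theorem uIoc_subset_part {t : ℝ} {e : Edge} {a b : ℝ} (ha : a ∈ closure (part t e))
    (hb : b ∈ closure (part t e)) : uIoc a b ≤ᵐ[volume] part t e := by
  have h1 : uIcc a b ⊆ closure (part t e) :=
    (convex_part t e).closure.ordConnected.uIcc_subset ha hb
  have h2 : uIoo a b ⊆ part t e := by
    rcases (part t e).eq_empty_or_nonempty with h | h
    · simp [h] at ha
    have h3 := (convex_part t e).interior_closure_eq_interior_of_nonempty_interior
      (by rwa [(isOpen_part t e).interior_eq])
    rw [(isOpen_part t e).interior_eq] at h3
    rw [← h3]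
    exact interior_maximal (uIoo_subset_uIcc_self.trans h1) isOpen_Ioo
  have h4 : uIoc a b ≤ᵐ[volume] uIoo a b := Ioo_ae_eq_Ioc.symm.le
  exact h4.trans (ae_of_all _ h2)

variable {t β : ℝ} {u u' u'' : Edge → ℝ → ℂ}

theorem IsH2.intervalIntegrable2 (h : IsH2 t β u u' u'') {e : Edge} {a b : ℝ}
    (ha : a ∈ closure (part t e)) (hb : b ∈ closure (part t e)) :
    IntervalIntegrable (u'' e) volume a b := by
  have : IsFiniteMeasure (volume.restrict (part t e)) := ⟨by
    simpa using (volume_part_ne_top t e).lt_top⟩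
  have h1 : IntegrableOn (u'' e) (part t e) := (h.memLp e).integrable (by norm_num)
  rw [intervalIntegrable_iff]
  exact h1.mono_set_ae (uIoc_subset_part ha hb)

theorem continuousOn_of_primitive {e : Edge} {f g : ℝ → ℂ}
    (hg : IntegrableOn g (part t e))
    (h : ∀ a ∈ closure (part t e), ∀ b ∈ closure (part t e), f b - f a = ∫ s in a..b, g s) :
    ContinuousOn f (closure (part t e)) := by
  intro a ha
  have h1 : Integrable ((part t e).indicator g) :=
    (integrable_indicator_iff (isOpen_part t e).measurableSet).2 hg
  have h2 : Continuous fun b => f a + ∫ s in a..b, (part t e).indicator g s :=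
    continuous_const.add (intervalIntegral.continuous_primitive
      (fun x y => h1.intervalIntegrable) a)
  refine (h2.continuousWithinAt (s := closure (part t e)) (x := a)).congr (fun b hb => ?_) (by simp)
  rw [eq_comm, ← eq_sub_iff_add_eq', h a ha b hb]
  apply intervalIntegral.integral_congr_ae
  filter_upwards [uIoc_subset_part ha hb] with s hs hs'
  exact indicator_of_mem (show s ∈ part t e from hs hs') g

theorem IsH2.integrableOn2 (h : IsH2 t β u u' u'') (e : Edge) :
    IntegrableOn (u'' e) (part t e) := by
  have : IsFiniteMeasure (volume.restrict (part t e)) := ⟨by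
    simpa using (volume_part_ne_top t e).lt_top⟩
  exact (h.memLp e).integrable (by norm_num)

theorem isCompact_closure_part (t : ℝ) (e : Edge) : IsCompact (closure (part t e)) :=
  (Metric.isBounded_Ioo 0 edgeLen).subset (fun _ hs => hs.1) |>.isCompact_closure

theorem IsH2.continuousOn1 (h : IsH2 t β u u' u'') (e : Edge) :
    ContinuousOn (u' e) (closure (part t e)) :=
  continuousOn_of_primitive (h.integrableOn2 e) (h.integral_deriv2 e)

theorem IsH2.continuousOn0 (h : IsH2 t β u u' u'') (e : Edge) :
    ContinuousOn (u e) (closure (part t e)) :=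
  continuousOn_of_primitive
    (((h.continuousOn1 e).integrableOn_compact (isCompact_closure_part t e)).mono_set
      subset_closure) (h.integral_deriv e)

theorem IsH2.intervalIntegrable1 (h : IsH2 t β u u' u'') {e : Edge} {a b : ℝ}
    (ha : a ∈ closure (part t e)) (hb : b ∈ closure (part t e)) :
    IntervalIntegrable (u' e) volume a b :=
  ((h.continuousOn1 e).mono
    ((convex_part t e).closure.ordConnected.uIcc_subset ha hb)).intervalIntegrable

theorem integrableOn_sq {e : Edge} {f : ℝ → ℂ} (h : ContinuousOn f (closure (part t e))) :
    IntegrableOn (fun s => ‖f s‖ ^ 2) (part t e) :=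
  ((h.norm.pow 2).integrableOn_compact (isCompact_closure_part t e)).mono_set subset_closure

theorem IsH2.integrableOn_sum (h : IsH2 t β u u' u'') (e : Edge) :
    IntegrableOn (fun s => ‖u e s‖ ^ 2 + ‖u' e s‖ ^ 2 + ‖u'' e s‖ ^ 2) (part t e) :=
  ((integrableOn_sq (h.continuousOn0 e)).add (integrableOn_sq (h.continuousOn1 e))).add
    ((h.memLp e).integrable_norm_pow (by norm_num))

theorem sq_norm_add_le (x y : ℂ) : ‖x + y‖ ^ 2 ≤ 2 * ‖x‖ ^ 2 + 2 * ‖y‖ ^ 2 := by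
  nlinarith [norm_add_le x y, norm_nonneg (x + y), sq_nonneg (‖x‖ - ‖y‖), norm_nonneg x,
    norm_nonneg y]

theorem IsH2.add {v v' v'' : Edge → ℝ → ℂ} (h : IsH2 t β u u' u'') (k : IsH2 t β v v' v'') :
    IsH2 t β (u + v) (u' + v') (u'' + v'') where
  memLp e := (h.memLp e).add (k.memLp e)
  integral_deriv e a ha b hb := by
    simp only [Pi.add_apply]
    rw [intervalIntegral.integral_add (h.intervalIntegrable1 ha hb) (k.intervalIntegrable1 ha hb),
      ← h.integral_deriv e a ha b hb, ← k.integral_deriv e a ha b hb]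
    ring
  integral_deriv2 e a ha b hb := by
    simp only [Pi.add_apply]
    rw [intervalIntegral.integral_add (h.intervalIntegrable2 ha hb) (k.intervalIntegrable2 ha hb),
      ← h.integral_deriv2 e a ha b hb, ← k.integral_deriv2 e a ha b hb]
    ring
  summable := by
    refine Summable.of_nonneg_of_le (fun p => integral_nonneg fun s => by positivity) (fun p => ?_)
      ((h.summable.mul_left 2).add (k.summable.mul_left 2))
    rw [← integral_const_mul, ← integral_const_mul, ← integral_add
      ((h.integrableOn_sum _).const_mul 2) ((k.integrableOn_sum _).const_mul 2)]
    refine integral_mono_of_nonneg (ae_of_all _ fun s => by positivity)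
      (((h.integrableOn_sum _).const_mul 2).add ((k.integrableOn_sum _).const_mul 2))
      (ae_of_all _ fun s => ?_)
    simp only [Pi.add_apply]
    linarith [sq_norm_add_le (u (rep p) s) (v (rep p) s),
      sq_norm_add_le (u' (rep p) s) (v' (rep p) s), sq_norm_add_le (u'' (rep p) s) (v'' (rep p) s)]
  continuous_vertex M hM e he e' he' := by
    simp only [Pi.add_apply]
    rw [h.continuous_vertex M hM e he e' he', k.continuous_vertex M hM e he e' he']
  quasiperiodic e s hs := by
    simp only [Pi.add_apply]
    rw [h.quasiperiodic e s hs, k.quasiperiodic e s hs, mul_add]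

theorem IsH2.smul (c : ℂ) (h : IsH2 t β u u' u'') : IsH2 t β (c • u) (c • u') (c • u'') where
  memLp e := (h.memLp e).const_smul c
  integral_deriv e a ha b hb := by
    simp only [Pi.smul_apply]
    rw [intervalIntegral.integral_smul, ← h.integral_deriv e a ha b hb, smul_sub]
  integral_deriv2 e a ha b hb := by
    simp only [Pi.smul_apply]
    rw [intervalIntegral.integral_smul, ← h.integral_deriv2 e a ha b hb, smul_sub]
  summable := by
    refine (h.summable.mul_left (‖c‖ ^ 2)).congr fun p => ?_
    rw [← integral_const_mul]
    congr 1 with s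
    simp only [Pi.smul_apply, smul_eq_mul, norm_mul]
    ring
  continuous_vertex M hM e he e' he' := by
    simp only [Pi.smul_apply]
    rw [h.continuous_vertex M hM e he e' he']
  quasiperiodic e s hs := by
    simp only [Pi.smul_apply, smul_eq_mul]
    rw [h.quasiperiodic e s hs]
    ring

theorem isH2_zero (t β : ℝ) : IsH2 t β 0 0 0 where
  memLp e := MemLp.zero
  integral_deriv e a ha b hb := by simp
  integral_deriv2 e a ha b hb := by simp
  summable := by simp
  continuous_vertex M hM e he e' he' := rfl
  quasiperiodic e s hs := by simp

variable {μ : ℝ} {bc : BoundaryType}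

theorem Kirchhoff.add {v' : Edge → ℝ → ℂ} {M : Vertex} (h : Kirchhoff t μ u' M)
    (k : Kirchhoff t μ v' M) : Kirchhoff t μ (u' + v') M := by
  unfold Kirchhoff at *
  simp only [Pi.add_apply, mul_add, Finset.sum_add_distrib, h, k, add_zero]

theorem Kirchhoff.smul (c : ℂ) {M : Vertex} (h : Kirchhoff t μ u' M) :
    Kirchhoff t μ (c • u') M := by
  unfold Kirchhoff at *
  simp only [Pi.smul_apply, smul_eq_mul, mul_left_comm _ c, ← Finset.mul_sum, h, mul_zero]

theorem kirchhoff_zero (t μ : ℝ) (M : Vertex) : Kirchhoff t μ 0 M := by simp [Kirchhoff]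

theorem BoundaryCondition.add {v v' : Edge → ℝ → ℂ} (h : BoundaryCondition t μ u u' bc)
    (k : BoundaryCondition t μ v v' bc) : BoundaryCondition t μ (u + v) (u' + v') bc := by
  cases bc with
  | dirichlet => exact fun e s hs hx => by simp [h e s hs hx, k e s hs hx]
  | neumann =>
    exact ⟨fun e s hs h0 hx => by simp [h.1 e s hs h0 hx, k.1 e s hs h0 hx],
      fun M hM => (h.2 M hM).add (k.2 M hM)⟩

theorem BoundaryCondition.smul (c : ℂ) (h : BoundaryCondition t μ u u' bc) :
    BoundaryCondition t μ (c • u) (c • u') bc := by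
  cases bc with
  | dirichlet => exact fun e s hs hx => by simp [h e s hs hx]
  | neumann =>
    exact ⟨fun e s hs h0 hx => by simp [h.1 e s hs h0 hx], fun M hM => (h.2 M hM).smul c⟩

theorem boundaryCondition_zero (t μ : ℝ) (bc : BoundaryType) : BoundaryCondition t μ 0 0 bc := by
  cases bc with
  | dirichlet => exact fun e s hs hx => rfl
  | neumann => exact ⟨fun e s hs h0 hx => rfl, fun M hM => kirchhoff_zero t μ M⟩

/-- The graph of `D_μ^t(β)` or `N_μ^t(β)`. -/
def limitGraph (bc : BoundaryType) (t μ β : ℝ) : Submodule ℂ (GraphL2 t μ × GraphL2 t μ) where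
  carrier := {x | ∃ u u' u'', IsPair bc t μ β x.1 x.2 u u' u''}
  zero_mem' := ⟨0, 0, 0, isH2_zero t β, fun M _ => kirchhoff_zero t μ M,
    boundaryCondition_zero t μ bc, fun p => Lp.coeFn_zero _ _ _, fun p => by
      filter_upwards [Lp.coeFn_zero ℂ 2 (edgeMeasure t μ p)] with s hs
      exact hs.trans (by simp)⟩
  add_mem' := by
    rintro x y ⟨u, u', u'', h⟩ ⟨v, v', v'', k⟩
    refine ⟨u + v, u' + v', u'' + v'', h.isH2.add k.isH2,
      fun M hM => (h.kirchhoff M hM).add (k.kirchhoff M hM), h.boundary.add k.boundary,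
      fun p => ?_, fun p => ?_⟩
    · filter_upwards [Lp.coeFn_add (x.1 p) (y.1 p), h.fst p, k.fst p] with s h1 h2 h3
      exact h1.trans (by simp [h2, h3])
    · filter_upwards [Lp.coeFn_add (x.2 p) (y.2 p), h.snd p, k.snd p] with s h1 h2 h3
      exact h1.trans (by simp only [Pi.add_apply, h2, h3]; ring)
  smul_mem' := by
    rintro c x ⟨u, u', u'', h⟩
    refine ⟨c • u, c • u', c • u'', h.isH2.smul c, fun M hM => (h.kirchhoff M hM).smul c,
      h.boundary.smul c, fun p => ?_, fun p => ?_⟩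
    · filter_upwards [Lp.coeFn_smul c (x.1 p), h.fst p] with s h1 h2
      exact h1.trans (by simp [h2])
    · filter_upwards [Lp.coeFn_smul c (x.2 p), h.snd p] with s h1 h2
      exact h1.trans (by simp [h2])

/-- A function that vanishes almost everywhere on an edge has a vanishing derivative there. -/
theorem ae_eq_zero_of_primitive {e : Edge} {f g : ℝ → ℂ} (hg : IntegrableOn g (part t e))
    (h : ∀ a ∈ closure (part t e), ∀ b ∈ closure (part t e), f b - f a = ∫ s in a..b, g s)
    (hf : f =ᵐ[volume.restrict (part t e)] 0) : g =ᵐ[volume.restrict (part t e)] 0 := by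
  have hc : ContinuousOn f (part t e) := (continuousOn_of_primitive hg h).mono subset_closure
  have h0 : EqOn f 0 (part t e) := Measure.eqOn_open_of_ae_eq hf (isOpen_part t e) hc
    continuousOn_const
  rcases (part t e).eq_empty_or_nonempty with hE | ⟨a, ha⟩
  · rw [hE, Measure.restrict_empty, ae_zero]; exact Filter.eventually_bot
  have h1 : Integrable ((part t e).indicator g) :=
    (integrable_indicator_iff (isOpen_part t e).measurableSet).2 hg
  rw [Filter.EventuallyEq, ae_restrict_iff' (isOpen_part t e).measurableSet]
  filter_upwards [LocallyIntegrable.ae_hasDerivAt_integral h1.locallyIntegrable] with b hb hbm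
  have h2 := hb a
  have h3 : (fun x => ∫ s in a..x, (part t e).indicator g s) =ᶠ[nhds b] fun _ => 0 := by
    filter_upwards [(isOpen_part t e).mem_nhds hbm] with x hx
    have h4 := h a (subset_closure ha) x (subset_closure hx)
    rw [h0 ha, h0 hx] at h4
    simp only [Pi.zero_apply, sub_self] at h4
    rw [h4]
    apply intervalIntegral.integral_congr_ae
    filter_upwards [uIoc_subset_part (subset_closure ha) (subset_closure hx)] with s hs hs'
    exact indicator_of_mem (show s ∈ part t e from hs hs') g
  have h5 := (h2.congr_of_eventuallyEq h3.symm).unique (hasDerivAt_const b (0 : ℂ))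
  rwa [indicator_of_mem hbm] at h5

theorem limitGraph_functional (bc : BoundaryType) (t μ β : ℝ) :
    ∀ x ∈ limitGraph bc t μ β, x.1 = 0 → x.2 = 0 := by
  rintro x ⟨u, u', u'', h⟩ hx
  refine lp.ext (funext fun p => ?_)
  refine Lp.ext ?_
  refine (h.snd p).trans (Filter.EventuallyEq.trans ?_ (Lp.coeFn_zero ℂ 2 _).symm)
  by_cases hw : ENNReal.ofReal (weight μ (rep p)) = 0
  · rw [edgeMeasure, hw, zero_smul, ae_zero]; exact Filter.eventually_bot
  have hu : u (rep p) =ᵐ[volume.restrict (part t (rep p))] 0 := by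
    have h1 := (h.fst p).symm
    rw [hx] at h1
    have h2 := h1.trans (Lp.coeFn_zero ℂ 2 _)
    rw [edgeMeasure] at h2
    have h3 : volume.restrict (part t (rep p)) ≪
        ENNReal.ofReal (weight μ (rep p)) • volume.restrict (part t (rep p)) :=
      Measure.absolutelyContinuous_smul hw
    exact h3.ae_le h2
  have hu' := ae_eq_zero_of_primitive
    (((h.isH2.continuousOn1 (rep p)).integrableOn_compact (isCompact_closure_part t _)).mono_set
      subset_closure) (h.isH2.integral_deriv (rep p)) hu
  have hu'' := ae_eq_zero_of_primitive (h.isH2.integrableOn2 (rep p))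
    (h.isH2.integral_deriv2 (rep p)) hu'
  rw [edgeMeasure]
  refine Measure.ae_smul_measure ?_ _
  filter_upwards [hu''] with s hs
  simp [hs]

/-- The operator `D_μ^t(β)` (for `bc = dirichlet`) or `N_μ^t(β)` (for `bc = neumann`), as an
unbounded operator of `L²` over one period. -/
def limitOperator (bc : BoundaryType) (t μ β : ℝ) : GraphL2 t μ →ₗ.[ℂ] GraphL2 t μ :=
  (limitGraph bc t μ β).toLinearPMap

theorem limitOperator_graph (bc : BoundaryType) (t μ β : ℝ) :
    (limitOperator bc t μ β).graph = limitGraph bc t μ β :=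
  Submodule.toLinearPMap_graph_eq _ fun x hx => limitGraph_functional bc t μ β x hx

/-! ### Essential spectrum and gaps -/

/-- `T - z`, as a continuous operator on the domain of `T` with the graph norm (the domain being
identified with the graph). -/
def shifted {H : Type*} [NormedAddCommGroup H] [NormedSpace ℂ H] (T : H →ₗ.[ℂ] H) (z : ℂ) :
    T.graph →L[ℂ] H :=
  (ContinuousLinearMap.snd ℂ H H - z • ContinuousLinearMap.fst ℂ H H) ∘L T.graph.subtypeL

/-- The real points of the essential spectrum, the set of `z` such that `T - z` is not Fredholm. -/
def essSpectrum {H : Type*} [NormedAddCommGroup H] [NormedSpace ℂ H] (T : H →ₗ.[ℂ] H) : Set ℝ :=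
  {x | ¬ (shifted T (x : ℂ)).IsFredholm}

/-- `I` is a gap of the set `σ`: a bounded open interval that is a connected component of the
complement of `σ`, that is, which does not meet `σ` and whose endpoints belong to `σ`. -/
def IsGap (σ I : Set ℝ) : Prop :=
  ∃ a b : ℝ, a < b ∧ I = Ioo a b ∧ Disjoint I σ ∧ a ∈ σ ∧ b ∈ σ

/-- `λ_n^* = (π / (2L) + n π / L)²`. -/
def lambdaStar (n : ℕ) : ℝ := (Real.pi / (2 * edgeLen) + n * Real.pi / edgeLen) ^ 2

end Honeycomb

end

open MeasureTheory Set

noncomputable section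

namespace Honeycomb


/-! ### Criteria for Fredholm operators -/

section Fredholm

variable {H : Type*} [NormedAddCommGroup H] [NormedSpace ℂ H]

/-! Let `θ` be the Floquet multiplier and `z = 1 + θ⁻¹`. Where `sin (ω L) ≠ 0`, a solution of `-u''
= ω² u` on a whole edge is determined by its two endpoint values. With `a k`, `b k` the values at
the vertices `A 0 k`, `B 0 k`, the Kirchhoff conditions of the whole graph with unit weights become
`3 cos (ω L) a k = b k + z b (k+1)` and `3 cos (ω L) b k = a k + conj z a (k-1)`. The right-hand
sides are the sum of an involution and of `‖z‖` times an involution. Hence the discrete problem is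
invertible in `ℓ²` if `|3 cos (ω L)| < |1 - ‖z‖|` (`isUnit_sub_hop`), and it has a bounded plane
wave in case of equality (`exists_isBlochWave`). Since `‖z‖ = 2 cos (π β)`, the threshold is
positive for `β ≠ 1/3`, and the cosine vanishes at the square root of `lambdaStar n`: this gives an
interval around `lambdaStar n` that is defined without `t`, `μ` or the boundary condition.

It remains to see that the cut does not matter. It affects only the layers `-1` and `0` of the
graph, thus finitely many edges of one period.

Inside the interval, a right-hand side on `G_t` is extended by zero and the problem is solved on the
whole graph. If the Cauchy data of the solution vanish at the finitely many vertices and cut points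
of the layers `-1` and `0`, its restriction belongs to the domain whatever the boundary condition
and the weight. So there is a right inverse on a closed subspace of finite codimension
(`isFredholm_of_abs_cos_lt`). The kernel is finite dimensional by unique continuation from layer to
layer, which uses `1 + θ ≠ 0` (`finiteDimensional_ker_shifted`). These two facts give the Fredholm
property (`isFredholm_of_parametrix`), without any appeal to self-adjointness.

At the endpoints, the plane wave is truncated to the layers from `N` to `2 N`: its norm grows while
the defect of the equation stays bounded, and its support leaves every edge. This is a singular
sequence, which excludes the Fredholm property (`IsBlochWave.not_isFredholm`). -/

theorem shifted_apply (T : H →ₗ.[ℂ] H) (z : ℂ) (x : T.graph) :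
    shifted T z x = x.1.2 - z • x.1.1 := rfl

open scoped LinearMap.FiniteRangeSetoid in
/-- An operator with a finite dimensional kernel and a parametrix defined on a closed subspace of
finite codimension is Fredholm. -/
theorem isFredholm_of_parametrix {W : Type*} [NormedAddCommGroup W] [NormedSpace ℂ W]
    [FiniteDimensional ℂ W] (T : H →ₗ.[ℂ] H) (z : ℂ) (S : H →L[ℂ] H) (Φ : H →L[ℂ] W)
    (hS : ∀ h, Φ h = 0 → (S h, h + z • S h) ∈ T.graph)
    [FiniteDimensional ℂ (shifted T z).ker] : (shifted T z).IsFredholm := by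
  obtain ⟨q, hq⟩ := Φ.ker_closedComplemented_of_finiteDimensional_range
  set F := shifted T z
  -- The candidate for the quasi-inverse is `S` applied after the projection `q` onto `ker Φ`; its
  -- values lie in the graph by `hS`, and `F ∘ v = q` is the identity on `ker Φ`, which has finite
  -- codimension.
  let K : H →L[ℂ] H × H :=
    (S.prod (ContinuousLinearMap.id ℂ H + z • S)) ∘L (Submodule.subtypeL _ ∘L q)
  have hK : ∀ h, K h ∈ T.graph := fun h => hS _ (q h).2
  let v : H →L[ℂ] T.graph := K.codRestrict T.graph hK
  have hv : ∀ h, F (v h) = q h := fun h => by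
    change (q h : H) + z • S (q h) - z • S (q h) = q h
    simp
  have h1 : (F : T.graph →ₗ[ℂ] H) ∘ₗ (v : H →ₗ[ℂ] T.graph) ≈ LinearMap.id := by
    refine LinearMap.FiniteRangeSetoid.equiv_of_eqOn_coFG (A := Φ.ker)
      (Submodule.CoFG.ker Φ.toLinearMap) ?_
    intro h hh
    have := hq ⟨h, hh⟩
    simp [hv, this]
  have h2 : (v : H →ₗ[ℂ] T.graph) ∘ₗ (F : T.graph →ₗ[ℂ] H) ≈ LinearMap.id := by
    rw [LinearMap.FiniteRangeSetoid.equiv_iff_hasFiniteRange, LinearMap.hasFiniteRange_iff_range]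
    set D := (v : H →ₗ[ℂ] T.graph) ∘ₗ (F : T.graph →ₗ[ℂ] H) - LinearMap.id
    rw [LinearMap.FiniteRangeSetoid.equiv_iff_hasFiniteRange, LinearMap.hasFiniteRange_iff_range]
      at h1
    -- Since `F (v F - 1) = (F v - 1) F`, the operator `F` maps the range of `v F - 1` into the
    -- finite dimensional range of `F v - 1`. The rest of that range lies in the kernel of `F`,
    -- which is finite dimensional.
    refine Submodule.fg_of_fg_map_of_fg_inf_ker (F : T.graph →ₗ[ℂ] H) ?_ ?_
    · rw [← LinearMap.range_comp]
      refine Submodule.FG.of_le h1 ?_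
      rintro _ ⟨x, rfl⟩
      exact ⟨F x, by simp [D]⟩
    · exact Submodule.FG.of_le (Module.Finite.iff_fg.1 (inferInstanceAs
        (FiniteDimensional ℂ (shifted T z).ker))) inf_le_right
  exact ContinuousLinearMap.IsFredholm.of_isQuasiInverse (v := v) ⟨h2, h1⟩

open scoped LinearMap.FiniteRangeSetoid in
/-- An operator with a singular sequence that eventually leaves every component is not Fredholm. -/
theorem not_isFredholm_of_singular_sequence {ι : Type*} {G : ι → Type*}
    [∀ i, NormedAddCommGroup (G i)] [∀ i, NormedSpace ℂ (G i)] (ev : ∀ i, H →L[ℂ] G i)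
    (hev : ∀ x, (∀ i, ev i x = 0) → x = 0)
    (T : H →ₗ.[ℂ] H) (z : ℂ) (x : ℕ → T.graph) (h1 : ∀ n, ‖(x n).1.1‖ = 1)
    (h2 : Filter.Tendsto (fun n => shifted T z (x n)) Filter.atTop (nhds 0))
    (h3 : ∀ i, ∀ᶠ n in Filter.atTop, ev i (x n).1.1 = 0) : ¬ (shifted T z).IsFredholm := by
  intro hF
  obtain ⟨v, hv, -⟩ := hF.exists_isQuasiInverse
  set F := shifted T z
  have hfin : FiniteDimensional ℂ ((v : H →ₗ[ℂ] T.graph) ∘ₗ (F : T.graph →ₗ[ℂ] H)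
      - LinearMap.id).range := by
    have := LinearMap.FiniteRangeSetoid.equiv_iff_hasFiniteRange.1 hv.equiv
    rw [LinearMap.hasFiniteRange_iff_range] at this
    exact Module.Finite.iff_fg.2 this
  set D := (v : H →ₗ[ℂ] T.graph) ∘ₗ (F : T.graph →ₗ[ℂ] H) - LinearMap.id with hD
  have := FiniteDimensional.proper ℂ D.range
  let d : ℕ → D.range := fun n => ⟨D (x n), x n, rfl⟩
  -- The first term tends to `0` and the second one is bounded in a finite dimensional space, so a
  -- subsequence of `x` converges in the graph norm.
  have hd : ∀ n, (x n) = v (F (x n)) - D (x n) := fun n => by simp [hD]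
  have hb : Bornology.IsBounded (range x) := by
    obtain ⟨C, hC⟩ := (Metric.isBounded_range_of_tendsto _ h2).exists_norm_le
    refine isBounded_iff_forall_norm_le.2 ⟨max 1 (C + ‖z‖), ?_⟩
    rintro _ ⟨n, rfl⟩
    have h4 : (x n).1.2 = F (x n) + z • (x n).1.1 := by simp [F, shifted_apply]
    change max ‖(x n).1.1‖ ‖(x n).1.2‖ ≤ _
    refine max_le_max (h1 n).le ?_
    rw [h4]
    refine (norm_add_le _ _).trans (add_le_add (hC _ ⟨n, rfl⟩) ?_)
    rw [norm_smul, h1, mul_one]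
  have hvF : Filter.Tendsto (fun n => v (F (x n))) Filter.atTop (nhds 0) := by
    have := (v.continuous.tendsto 0).comp h2
    rwa [map_zero] at this
  have hdb : ∃ R, ∀ n, ‖d n‖ ≤ R := by
    obtain ⟨C, hC⟩ := hb.exists_norm_le
    obtain ⟨C', hC'⟩ := (Metric.isBounded_range_of_tendsto _ hvF).exists_norm_le
    refine ⟨C' + C, fun n => ?_⟩
    change ‖D (x n)‖ ≤ _
    have : D (x n) = v (F (x n)) - x n := by simp [hD]
    rw [this]
    exact (norm_sub_le _ _).trans (add_le_add (hC' _ ⟨n, rfl⟩) (hC _ ⟨n, rfl⟩))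
  obtain ⟨R, hR⟩ := hdb
  obtain ⟨y, -, φ, hφ, hy⟩ := tendsto_subseq_of_bounded
    (Metric.isBounded_closedBall (x := 0) (r := R))
    (x := d) (fun n => mem_closedBall_zero_iff.2 (hR n))
  have hy' : Filter.Tendsto (fun n => x (φ n)) Filter.atTop (nhds (-(y : T.graph))) := by
    have h5 : Filter.Tendsto (fun n => v (F (x (φ n))) - (d (φ n) : T.graph)) Filter.atTop
        (nhds (0 - y)) :=
      (hvF.comp hφ.tendsto_atTop).sub ((continuous_subtype_val.tendsto y).comp hy)
    rw [zero_sub] at h5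
    exact h5.congr fun n => (hd _).symm
  have hf : Filter.Tendsto (fun n => (x (φ n)).1.1) Filter.atTop (nhds (-(y : T.graph)).1.1) :=
    ((continuous_fst.comp continuous_subtype_val).tendsto _).comp hy'
  have h6 : ‖(-(y : T.graph)).1.1‖ = 1 :=
    tendsto_nhds_unique hf.norm (by simp [h1])
  -- The limit has norm one, but each of its components is the limit of a sequence that is
  -- eventually zero.
  have h7 : (-(y : T.graph)).1.1 = 0 := hev _ fun i =>
    tendsto_nhds_unique (((ev i).continuous.tendsto _).comp hf)
      (tendsto_const_nhds.congr' ((hφ.tendsto_atTop.eventually (h3 i)).mono fun n hn => hn.symm))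
  rw [h7, norm_zero] at h6
  exact zero_ne_one h6

end Fredholm

/-! ### Operators between `ℓ²` spaces -/

section LittleL2

variable {α ι : Type*} {E : α → Type*} [∀ i, NormedAddCommGroup (E i)]

theorem sum_comp_le_norm_sq {g : ι → α} (hg : Function.Injective g) (f : lp E 2)
    (s : Finset ι) : ∑ i ∈ s, ‖f (g i)‖ ^ 2 ≤ ‖f‖ ^ 2 := by
  classical
  have h := lp.sum_rpow_le_norm_rpow (p := 2) (by norm_num) f (s.image g)
  rw [Finset.sum_image fun a _ b _ h => hg h] at h
  simpa using h

/-- If the fibres of `g` have at most one element of each colour, the square sum of `f ∘ g` is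
bounded by the number of colours times the square sum of `f`. -/
theorem sum_comp_le_card_mul_norm_sq {J : Type*} [Fintype J] {g : ι → α} (c : ι → J)
    (hg : Function.Injective fun i => (c i, g i)) (f : lp E 2)
    (s : Finset ι) : ∑ i ∈ s, ‖f (g i)‖ ^ 2 ≤ Fintype.card J * ‖f‖ ^ 2 := by
  classical
  calc ∑ i ∈ s, ‖f (g i)‖ ^ 2
      = ∑ q ∈ s.image fun i => (c i, g i), ‖f q.2‖ ^ 2 :=
        (Finset.sum_image (f := fun q : J × α => ‖f q.2‖ ^ 2) fun a _ b _ h => hg h).symm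
    _ ≤ ∑ q ∈ (Finset.univ : Finset J) ×ˢ s.image g, ‖f q.2‖ ^ 2 := by
        refine Finset.sum_le_sum_of_subset_of_nonneg (fun q hq => ?_) fun i _ _ => by positivity
        obtain ⟨i, hi, rfl⟩ := Finset.mem_image.1 hq
        simp only [Finset.mem_product, Finset.mem_univ, true_and]
        exact Finset.mem_image_of_mem _ hi
    _ = ∑ j : J, ∑ k ∈ s.image g, ‖f k‖ ^ 2 := Finset.sum_product _ _ _
    _ ≤ ∑ j : J, ‖f‖ ^ 2 :=
        Finset.sum_le_sum fun j _ => sum_comp_le_norm_sq Function.injective_id f _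
    _ = Fintype.card J * ‖f‖ ^ 2 := by simp

variable {X : Type*} [NormedAddCommGroup X] [NormedSpace ℂ X] [∀ i, NormedSpace ℂ (E i)]

/-- A bounded operator with values in an `ℓ²` space, from its components. -/
def toLittleL2 (T : X →ₗ[ℂ] (∀ i, E i)) (C : ℝ) (hC : 0 ≤ C)
    (h : ∀ x, ∀ s : Finset α, ∑ i ∈ s, ‖T x i‖ ^ 2 ≤ (C * ‖x‖) ^ 2) : X →L[ℂ] lp E 2 :=
  LinearMap.mkContinuous
    { toFun := fun x => ⟨T x, memℓp_gen' (C := (C * ‖x‖) ^ 2) (by simpa using h x)⟩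
      map_add' := fun x y => by
        refine lp.ext ?_
        rw [lp.coeFn_add]
        exact T.map_add x y
      map_smul' := fun c x => by
        refine lp.ext ?_
        rw [RingHom.id_apply, lp.coeFn_smul]
        exact T.map_smul c x } C fun x => by
    refine lp.norm_le_of_forall_sum_le (by norm_num) (by positivity) fun s => ?_
    simpa using h x s

end LittleL2


/-! ### The truncated edges -/

theorem edgeLen_pos : 0 < edgeLen := by simp [edgeLen]

theorem sqrt_three_eq : √3 = 3 * edgeLen := by
  have h : √3 * √3 = 3 := Real.mul_self_sqrt (by norm_num)
  have h0 : √3 ≠ 0 := by simp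
  rw [edgeLen]
  field_simp
  linarith

/-- Edges and vertices with the same index form a vertical layer of the graph. -/
def Edge.index (e : Edge) : ℤ := e.2.1 + e.2.2

/-- Horizontal edges are run through from right to left, zigzag edges from left to right at half
speed. In each layer the order of abscissas is thus: vertex `B`, horizontal edge, vertex `A`, zigzag
edges, vertex `B` of the next layer. -/
theorem Edge.point_fst_of_eq {e : Edge} (h : e.1 = 0) (s : ℝ) :
    (e.point s).1 = edgeLen / 2 + 3 * edgeLen / 2 * e.index - s := by
  obtain ⟨j, m, n⟩ := e
  obtain rfl : j = 0 := h
  have h1 := edgeLen_pos.ne'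
  simp only [Edge.point, Edge.source, Edge.target, Vertex.pos, vec₁, vec₂, sqrt_three_eq,
    Edge.index, Prod.fst_add, Prod.smul_fst, smul_eq_mul]
  push_cast
  field_simp
  ring

theorem Edge.point_fst_of_ne {e : Edge} (h : e.1 ≠ 0) (s : ℝ) :
    (e.point s).1 = edgeLen / 2 + 3 * edgeLen / 2 * e.index + s / 2 := by
  obtain ⟨j, m, n⟩ := e
  have h1 := edgeLen_pos.ne'
  fin_cases j
  · exact absurd rfl h
  all_goals
    simp only [Edge.point, Edge.source, Edge.target, Vertex.pos, vec₁, vec₂, sqrt_three_eq,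
      Edge.index, Prod.fst_add, Prod.smul_fst, smul_eq_mul]
    push_cast
    field_simp
    ring

theorem cut_le {t : ℝ} (h : t ≤ 2 * edgeLen) : cut t ≤ edgeLen / 2 := by
  have := edgeLen_pos
  unfold cut
  split_ifs <;> linarith

theorem le_cut {t : ℝ} (h : 0 ≤ t) : -edgeLen ≤ cut t := by
  have := edgeLen_pos
  unfold cut
  split_ifs <;> linarith

theorem closure_part_subset (t : ℝ) (e : Edge) : closure (part t e) ⊆ Icc 0 edgeLen :=
  closure_minimal (fun _ hs => Ioo_subset_Icc_self hs.1) isClosed_Icc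

/-- These edges lie to the right of `x = L / 2`, the rightmost position of the cut. -/
theorem part_eq_Ioo {t : ℝ} (ht : t ≤ 2 * edgeLen) {e : Edge} (h0 : 0 ≤ e.index)
    (h : e.1 = 0 → 1 ≤ e.index) : part t e = Ioo 0 edgeLen := by
  refine subset_antisymm (fun s hs => hs.1) fun s hs => ⟨hs, ?_⟩
  have hL := edgeLen_pos
  have hc := cut_le ht
  by_cases he : e.1 = 0
  · have h1 : (1 : ℝ) ≤ e.index := by exact_mod_cast h he
    rw [Edge.point_fst_of_eq he]
    nlinarith [hs.1, hs.2]
  · have h1 : (0 : ℝ) ≤ e.index := by exact_mod_cast h0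
    rw [Edge.point_fst_of_ne he]
    nlinarith [hs.1, hs.2]

/-- These edges lie to the left of `x = -L`, the leftmost position of the cut. -/
theorem part_eq_empty {t : ℝ} (ht : 0 ≤ t) {e : Edge} (h0 : e.index ≤ -1)
    (h : e.1 ≠ 0 → e.index ≤ -2) : part t e = ∅ := by
  refine eq_empty_iff_forall_notMem.2 fun s hs => ?_
  have hL := edgeLen_pos
  have hc := le_cut ht
  have h2 := hs.2
  by_cases he : e.1 = 0
  · have h1 : (e.index : ℝ) ≤ -1 := by exact_mod_cast h0
    rw [Edge.point_fst_of_eq he] at h2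
    nlinarith [hs.1.1, hs.1.2]
  · have h1 : (e.index : ℝ) ≤ -2 := by exact_mod_cast h he
    rw [Edge.point_fst_of_ne he] at h2
    nlinarith [hs.1.1, hs.1.2]

/-- For `t = L` the cut passes through the vertices `B` of index `0`, at `x = -L / 2`, and all the
edges of nonnegative index lie to the right of them. Thus `μ` is seen by the layer `-1` at most. -/
theorem weight_eq_one (μ : ℝ) {e : Edge} (h : 0 ≤ e.index) : weight μ e = 1 := by
  refine if_pos (subset_antisymm (fun s hs => hs.1) fun s hs => ⟨hs, ?_⟩)
  have hL := edgeLen_pos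
  have hc : cut edgeLen = -edgeLen / 2 := by
    rw [cut, if_pos le_rfl]
    ring
  have h1 : (0 : ℝ) ≤ e.index := by exact_mod_cast h
  rw [hc]
  by_cases he : e.1 = 0
  · rw [Edge.point_fst_of_eq he]
    nlinarith [hs.1, hs.2]
  · rw [Edge.point_fst_of_ne he]
    nlinarith [hs.1, hs.2]

theorem weight_pos {μ : ℝ} (hμ : 0 < μ) (e : Edge) : 0 < weight μ e := by
  unfold weight
  split_ifs <;> simp [hμ]

def Vertex.index : Vertex → ℤ
  | .A m n => m + n
  | .B m n => m + n

theorem adjacent_eq_edges {t : ℝ} (ht : t ≤ 2 * edgeLen) {M : Vertex} (h : 1 ≤ M.index) :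
    adjacent t M = M.edges := by
  classical
  refine Finset.filter_true_of_mem fun e he => ?_
  rw [part_eq_Ioo ht]
  · exact nonempty_Ioo.2 edgeLen_pos
  all_goals
    cases M <;> simp only [Vertex.edges, Finset.mem_insert, Finset.mem_singleton] at he <;>
    rcases he with rfl | rfl | rfl <;> simp [Edge.index, Vertex.index] at * <;> omega

theorem index_nonneg_of_mem_edges {M : Vertex} (h : 1 ≤ M.index) {e : Edge} (he : e ∈ M.edges) :
    0 ≤ e.index := by
  cases M <;> simp only [Vertex.edges, Finset.mem_insert, Finset.mem_singleton] at he <;>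
    rcases he with rfl | rfl | rfl <;> simp [Edge.index, Vertex.index] at * <;> omega

/-- The layers of index at most `-2` are cut off. Hence the conditions at the vertices of
nonpositive index, where the cut and the weight intervene, concern two layers only. -/
theorem index_of_mem_adjacent {t : ℝ} (ht : 0 ≤ t) {M : Vertex} (h : M.index ≤ 0) {e : Edge}
    (he : e ∈ adjacent t M) : e.index = -1 ∨ e.index = 0 := by
  classical
  obtain ⟨he1, he2⟩ := Finset.mem_filter.1 he
  by_contra! hne
  have h3 : e.index ≤ -2 := by
    cases M <;> simp only [Vertex.edges, Finset.mem_insert, Finset.mem_singleton] at he1 <;>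
      rcases he1 with rfl | rfl | rfl <;> simp [Edge.index, Vertex.index] at * <;> omega
  rw [part_eq_empty ht (by omega) fun _ => h3] at he2
  exact not_nonempty_empty he2

/-! ### Quasi-periodic functions given by their restrictions to one period -/

/-- The Floquet multiplier. -/
def multiplier (β : ℝ) : ℂ := Complex.exp (2 * Real.pi * Complex.I * β)

theorem multiplier_ne_zero (β : ℝ) : multiplier β ≠ 0 := Complex.exp_ne_zero _

theorem norm_multiplier (β : ℝ) : ‖multiplier β‖ = 1 := by
  have : (2 * Real.pi * Complex.I * β : ℂ) = ((2 * Real.pi * β : ℝ) : ℂ) * Complex.I := by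
    push_cast; ring
  rw [multiplier, this, Complex.norm_exp_ofReal_mul_I]

/-- The quasi-periodic extension of a function on one period. -/
def extend (β : ℝ) (U : Fin 3 × ℤ → ℝ → ℂ) (e : Edge) (s : ℝ) : ℂ :=
  multiplier β ^ (-e.2.1) * U (e.1, e.index) s

theorem extend_rep (β : ℝ) (U : Fin 3 × ℤ → ℝ → ℂ) (p : Fin 3 × ℤ) :
    extend β U (rep p) = U p := by
  funext s
  simp [extend, rep, Edge.index]

/-- The parameter of the point of abscissa `cut t` on the edges `(j, m, n)` that can be truncated:
`m + n = 0` for `j = 0`, `m + n = -1` for `j ≠ 0`. -/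
def cutParam (t : ℝ) (j : Fin 3) : ℝ :=
  if j = 0 then edgeLen / 2 - cut t else 2 * (cut t + edgeLen)

/-- Endpoints and truncation points of the edges. -/
def nodeParam (t : ℝ) (j : Fin 3) : Fin 3 → ℝ
  | 0 => 0
  | 1 => edgeLen
  | 2 => cutParam t j

/-- `U` defines a function of the domain of the operators whose Cauchy data vanish at all the
vertices and boundary points of the layers `-1` and `0`. -/
structure IsProfile (t β : ℝ) (U U' U'' : Fin 3 × ℤ → ℝ → ℂ) : Prop where
  memLp : ∀ p, MemLp (U'' p) 2 (volume.restrict (Ioo 0 edgeLen))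
  continuousOn : ∀ p, ContinuousOn (U p) (Icc 0 edgeLen)
  continuousOn' : ∀ p, ContinuousOn (U' p) (Icc 0 edgeLen)
  integral_deriv : ∀ p, ∀ a ∈ Icc 0 edgeLen, ∀ b ∈ Icc 0 edgeLen,
    U p b - U p a = ∫ s in a..b, U' p s
  integral_deriv2 : ∀ p, ∀ a ∈ Icc 0 edgeLen, ∀ b ∈ Icc 0 edgeLen,
    U' p b - U' p a = ∫ s in a..b, U'' p s
  summable : Summable fun p => ∫ s in Ioo 0 edgeLen, (‖U p s‖ ^ 2 + ‖U' p s‖ ^ 2 + ‖U'' p s‖ ^ 2)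
  continuous_A : ∀ k, 1 ≤ k → U (1, k) 0 = U (0, k) 0 ∧ U (2, k) 0 = U (0, k) 0
  continuous_B : ∀ k, 1 ≤ k → multiplier β * U (1, k - 1) edgeLen = U (0, k) edgeLen ∧
    U (2, k - 1) edgeLen = U (0, k) edgeLen
  kirchhoff_A : ∀ k, 1 ≤ k → U' (0, k) 0 + U' (1, k) 0 + U' (2, k) 0 = 0
  kirchhoff_B : ∀ k, 1 ≤ k → U' (0, k) edgeLen + multiplier β * U' (1, k - 1) edgeLen
    + U' (2, k - 1) edgeLen = 0
  vanish : ∀ j i k, k = -1 ∨ k = 0 →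
    U (j, k) (nodeParam t j i) = 0 ∧ U' (j, k) (nodeParam t j i) = 0

/-! ### From profiles to elements of the domain -/

namespace IsProfile

variable {t β μ : ℝ} {U U' U'' : Fin 3 × ℤ → ℝ → ℂ}

theorem integrableOn (h : IsProfile t β U U' U'') (p : Fin 3 × ℤ) :
    IntegrableOn (fun s => ‖U p s‖ ^ 2 + ‖U' p s‖ ^ 2 + ‖U'' p s‖ ^ 2) (Ioo 0 edgeLen) :=
  (((((h.continuousOn p).norm.pow 2).integrableOn_compact isCompact_Icc).add
    (((h.continuousOn' p).norm.pow 2).integrableOn_compact isCompact_Icc)).mono_set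
      Ioo_subset_Icc_self).add ((h.memLp p).integrable_norm_pow (by norm_num))

theorem vanish_of_mem_adjacent (h : IsProfile t β U U' U'') (ht : 0 ≤ t) {M : Vertex}
    (hM : M.index ≤ 0) {e : Edge} (he : e ∈ adjacent t M) :
    extend β U e M.param = 0 ∧ extend β U' e M.param = 0 := by
  have h1 := index_of_mem_adjacent ht hM he
  have h2 : ∃ i, M.param = nodeParam t e.1 i := by
    cases M
    exacts [⟨0, rfl⟩, ⟨1, rfl⟩]
  obtain ⟨i, hi⟩ := h2
  have h3 := h.vanish e.1 i _ h1
  simp [extend, hi, h3]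

/-- At vertices of nonpositive index every term vanishes, whatever its weight; at the others all
weights are `1` and no edge is cut. This is why one profile serves for all `μ` and for both boundary
conditions. -/
theorem kirchhoff (h : IsProfile t β U U' U'') (ht : t ∈ Icc 0 (2 * edgeLen)) (M : Vertex) :
    Kirchhoff t μ (extend β U') M := by
  rcases le_or_gt M.index 0 with hM | hM
  · exact Finset.sum_eq_zero fun e he => by simp [(h.vanish_of_mem_adjacent ht.1 hM he).2]
  unfold Kirchhoff
  rw [adjacent_eq_edges ht.2 hM]
  rw [Finset.sum_congr rfl (g := fun e => extend β U' e M.param) fun e he => by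
    rw [weight_eq_one μ (index_nonneg_of_mem_edges hM he)]; simp]
  have h0 := multiplier_ne_zero β
  cases M with
  | A m n =>
    have h1 := h.kirchhoff_A (m + n) hM
    simp only [Vertex.edges, Vertex.param, extend, Edge.index]
    rw [Finset.sum_insert (by simp), Finset.sum_insert (by simp), Finset.sum_singleton]
    simp only
    linear_combination multiplier β ^ (-m) * h1
  | B m n =>
    have h1 := h.kirchhoff_B (m + n) hM
    simp only [Vertex.edges, Vertex.param, extend, Edge.index]
    rw [Finset.sum_insert (by simp), Finset.sum_insert (by simp), Finset.sum_singleton]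
    simp only
    rw [show m - 1 + n = m + n - 1 by ring, show m + (n - 1) = m + n - 1 by ring,
      show -(m - 1) = -m + 1 by ring, zpow_add₀ h0, zpow_one]
    linear_combination multiplier β ^ (-m) * h1

theorem continuous_vertex (h : IsProfile t β U U' U'') (ht : t ∈ Icc 0 (2 * edgeLen)) (M : Vertex) :
    ∃ c, ∀ e ∈ adjacent t M, extend β U e M.param = c := by
  rcases le_or_gt M.index 0 with hM | hM
  · exact ⟨0, fun e he => (h.vanish_of_mem_adjacent ht.1 hM he).1⟩
  rw [adjacent_eq_edges ht.2 hM]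
  have h0 := multiplier_ne_zero β
  cases M with
  | A m n =>
    have h1 := h.continuous_A (m + n) hM
    refine ⟨multiplier β ^ (-m) * U (0, m + n) 0, fun e he => ?_⟩
    simp only [Vertex.edges, Finset.mem_insert, Finset.mem_singleton] at he
    rcases he with rfl | rfl | rfl <;> simp [extend, Vertex.param, Edge.index, h1.1, h1.2]
  | B m n =>
    have h1 := h.continuous_B (m + n) hM
    refine ⟨multiplier β ^ (-m) * U (0, m + n) edgeLen, fun e he => ?_⟩
    simp only [Vertex.edges, Finset.mem_insert, Finset.mem_singleton] at he
    rcases he with rfl | rfl | rfl <;> simp only [extend, Vertex.param, Edge.index]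
    · rw [show m - 1 + n = m + n - 1 by ring, show -(m - 1) = -m + 1 by ring, zpow_add₀ h0,
        zpow_one, ← h1.1]
      ring
    · rw [show m + (n - 1) = m + n - 1 by ring, h1.2]

/-- The cut can meet the closed edges of `G_t` only on the horizontal edges of layer `0`, on the
zigzag edges of layer `-1`, or at the starting points of the zigzag edges of layer `0`. All these
points are nodes. -/
theorem vanish_cut (h : IsProfile t β U U' U'') (ht : t ∈ Icc 0 (2 * edgeLen)) {e : Edge} {s : ℝ}
    (hs : s ∈ closure (part t e)) (hx : (e.point s).1 = cut t) :
    extend β U e s = 0 ∧ extend β U' e s = 0 := by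
  have hL := edgeLen_pos
  have h1 := closure_part_subset t e hs
  suffices h2 : ∃ i, (e.index = -1 ∨ e.index = 0) ∧ s = nodeParam t e.1 i by
    obtain ⟨i, hi, rfl⟩ := h2
    have h3 := h.vanish e.1 i _ hi
    simp [extend, h3]
  have hc := cut_le ht.2
  have hne : (part t e).Nonempty := closure_nonempty_iff.1 ⟨s, hs⟩
  by_cases he : e.1 = 0
  · rw [Edge.point_fst_of_eq he] at hx
    have h4 : e.index = 0 := by
      apply le_antisymm
      · by_contra! h5
        have h6 : (1 : ℝ) ≤ e.index := by exact_mod_cast h5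
        nlinarith [h1.2]
      · by_contra! h5
        rw [part_eq_empty ht.1 (by omega) fun h => absurd he h] at hne
        exact not_nonempty_empty hne
    refine ⟨2, .inr h4, ?_⟩
    rw [h4] at hx
    simp only [nodeParam, cutParam, he, if_true]
    push_cast at hx
    linarith
  · rw [Edge.point_fst_of_ne he] at hx
    have h5 : -1 ≤ e.index := by
      by_contra! h5
      rw [part_eq_empty ht.1 (by omega) fun h => by omega] at hne
      exact not_nonempty_empty hne
    have h6 : e.index ≤ 0 := by
      by_contra! h5
      have h6 : (1 : ℝ) ≤ e.index := by exact_mod_cast h5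
      nlinarith [h1.1]
    obtain h7 | h7 : e.index = -1 ∨ e.index = 0 := by omega
    · refine ⟨2, .inl h7, ?_⟩
      rw [h7] at hx
      simp only [nodeParam, cutParam, he, if_false]
      push_cast at hx
      linarith
    -- Zigzag edges of layer `0` start at `x = L / 2`, which the cut does not exceed: the only
    -- possible contact is the endpoint `s = 0`.
    · refine ⟨0, .inr h7, ?_⟩
      rw [h7] at hx
      simp only [nodeParam]
      push_cast at hx
      linarith [h1.1]

theorem boundaryCondition (h : IsProfile t β U U' U'') (ht : t ∈ Icc 0 (2 * edgeLen))
    (bc : BoundaryType) : BoundaryCondition t μ (extend β U) (extend β U') bc := by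
  cases bc with
  | dirichlet => exact fun e s hs hx => (h.vanish_cut ht hs hx).1
  | neumann => exact ⟨fun e s hs _ hx => (h.vanish_cut ht hs hx).2, fun M _ => h.kirchhoff ht M⟩

theorem isH2 (h : IsProfile t β U U' U'') (ht : t ∈ Icc 0 (2 * edgeLen)) :
    IsH2 t β (extend β U) (extend β U') (extend β U'') where
  memLp e := ((h.memLp _).mono_measure (Measure.restrict_mono (fun _ hs => hs.1) le_rfl)).const_mul _
  integral_deriv e a ha b hb := by
    simp only [extend]
    rw [intervalIntegral.integral_const_mul, ← mul_sub,
      h.integral_deriv _ a (closure_part_subset t e ha) b (closure_part_subset t e hb)]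
  integral_deriv2 e a ha b hb := by
    simp only [extend]
    rw [intervalIntegral.integral_const_mul, ← mul_sub,
      h.integral_deriv2 _ a (closure_part_subset t e ha) b (closure_part_subset t e hb)]
  summable := by
    refine Summable.of_nonneg_of_le (fun p => integral_nonneg fun s => by positivity) (fun p => ?_)
      h.summable
    simp only [extend_rep]
    exact setIntegral_mono_set (h.integrableOn p) (ae_of_all _ fun s => by positivity)
      (ae_of_all _ fun s hs => hs.1)
  continuous_vertex M _ e he e' he' := by
    obtain ⟨c, hc⟩ := h.continuous_vertex ht M
    rw [hc e he, hc e' he']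
  quasiperiodic e s _ := by
    have h0 := multiplier_ne_zero β
    simp only [extend, Edge.up, Edge.index]
    rw [show e.2.1 - 1 + (e.2.2 + 1) = e.2.1 + e.2.2 by ring, show -(e.2.1 - 1) = 1 + -e.2.1 by ring,
      zpow_add₀ h0, zpow_one, mul_assoc]
    rfl

theorem mem_limitGraph (h : IsProfile t β U U' U'') (ht : t ∈ Icc 0 (2 * edgeLen))
    (bc : BoundaryType) {f g : GraphL2 t μ} (hf : ∀ p, f p =ᵐ[edgeMeasure t μ p] U p)
    (hg : ∀ p, g p =ᵐ[edgeMeasure t μ p] fun s => -U'' p s) :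
    (f, g) ∈ (limitOperator bc t μ β).graph := by
  rw [limitOperator_graph]
  refine ⟨extend β U, extend β U', extend β U'', h.isH2 ht, fun M _ => h.kirchhoff ht M,
    h.boundaryCondition ht bc, fun p => ?_, fun p => ?_⟩
  · rw [extend_rep]
    exact hf p
  · rw [extend_rep]
    exact hg p

end IsProfile


/-! ### The discrete operator on the vertices of one period of the whole graph -/

/-- Square summable sequences on the vertices of one period: `Sum.inl k` and `Sum.inr k` stand for
`A 0 k` and `B 0 k`. -/
abbrev VertexL2 : Type := lp (fun _ : ℤ ⊕ ℤ => ℂ) 2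

/-- The operator `(T x) v = a v * x (e v)`. -/
def weightedComp (e : ℤ ⊕ ℤ → ℤ ⊕ ℤ) (he : Function.Injective e) (a : ℤ ⊕ ℤ → ℂ) (K : ℝ)
    (hK : 0 ≤ K) (ha : ∀ v, ‖a v‖ ≤ K) : VertexL2 →L[ℂ] VertexL2 :=
  toLittleL2
    { toFun := fun x v => a v * x (e v)
      map_add' := fun x y => by
        funext v
        simp [mul_add]
      map_smul' := fun c x => by
        funext v
        simp [mul_left_comm] } K hK fun x s => by
    calc ∑ v ∈ s, ‖a v * x (e v)‖ ^ 2 ≤ ∑ v ∈ s, K ^ 2 * ‖x (e v)‖ ^ 2 := by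
          refine Finset.sum_le_sum fun v _ => ?_
          rw [norm_mul, mul_pow]
          gcongr
          exact ha v
      _ = K ^ 2 * ∑ v ∈ s, ‖x (e v)‖ ^ 2 := by rw [Finset.mul_sum]
      _ ≤ (K * ‖x‖) ^ 2 := by
          rw [mul_pow]
          gcongr
          exact sum_comp_le_norm_sq he x s

theorem norm_weightedComp_le (e : ℤ ⊕ ℤ → ℤ ⊕ ℤ) (he : Function.Injective e) (a : ℤ ⊕ ℤ → ℂ)
    (K : ℝ) (hK : 0 ≤ K) (ha : ∀ v, ‖a v‖ ≤ K) : ‖weightedComp e he a K hK ha‖ ≤ K := by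
  unfold weightedComp toLittleL2
  exact LinearMap.mkContinuous_norm_le _ hK _

/-- Exchange of the endpoints of the horizontal edges. -/
def hop₁ : VertexL2 →L[ℂ] VertexL2 :=
  weightedComp Sum.swap (Equiv.sumComm ℤ ℤ).injective (fun _ => 1) 1 zero_le_one (by simp)

/-- Exchange of the endpoints of the pairs of zigzag edges. -/
def zigzagSwap : ℤ ⊕ ℤ → ℤ ⊕ ℤ
  | .inl k => .inr (k + 1)
  | .inr k => .inl (k - 1)

theorem zigzagSwap_zigzagSwap (v : ℤ ⊕ ℤ) : zigzagSwap (zigzagSwap v) = v := by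
  cases v <;> simp [zigzagSwap]

def zigzagCoeff (z : ℂ) : ℤ ⊕ ℤ → ℂ
  | .inl _ => z
  | .inr _ => starRingEnd ℂ z

theorem norm_zigzagCoeff (z : ℂ) (v : ℤ ⊕ ℤ) : ‖zigzagCoeff z v‖ = ‖z‖ := by
  cases v <;> simp [zigzagCoeff]

def hop₂ (z : ℂ) : VertexL2 →L[ℂ] VertexL2 :=
  weightedComp zigzagSwap (Function.LeftInverse.injective zigzagSwap_zigzagSwap) (zigzagCoeff z) ‖z‖
    (norm_nonneg _) fun v => (norm_zigzagCoeff z v).le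

theorem norm_hop₁_le : ‖hop₁‖ ≤ 1 := norm_weightedComp_le _ _ _ _ _ _

theorem norm_hop₂_le (z : ℂ) : ‖hop₂ z‖ ≤ ‖z‖ := norm_weightedComp_le _ _ _ _ _ _

theorem hop₁_mul_hop₁ : hop₁ * hop₁ = 1 := by
  refine ContinuousLinearMap.ext fun x => lp.ext (funext fun v => ?_)
  change (1 : ℂ) * (1 * x v.swap.swap) = x v
  simp

/-- The coefficients at two exchanged vertices are conjugate, so that their product is `‖z‖ ^ 2`.
Hence `hop₂ z` is invertible for `z ≠ 0`, with an explicit inverse of norm at most `‖z‖⁻¹`. -/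
theorem hop₂_mul_hop₂ (z : ℂ) : hop₂ z * hop₂ z = ((‖z‖ ^ 2 : ℝ) : ℂ) • 1 := by
  refine ContinuousLinearMap.ext fun x => lp.ext (funext fun v => ?_)
  change zigzagCoeff z v * (zigzagCoeff z (zigzagSwap v) * x (zigzagSwap (zigzagSwap v)))
    = ((‖z‖ ^ 2 : ℝ) : ℂ) * x v
  rw [zigzagSwap_zigzagSwap, ← mul_assoc]
  congr 1
  cases v <;> simp [zigzagCoeff, zigzagSwap, Complex.mul_conj', Complex.conj_mul']

/-- Neumann series for `u + t = u (1 + v t)`, where `v` is the inverse of `u`. -/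
theorem isUnit_add_of_right_inverse {u v t : VertexL2 →L[ℂ] VertexL2} (h1 : u * v = 1)
    (h2 : v * u = 1) (h : ‖v‖ * ‖t‖ < 1) : IsUnit (u + t) := by
  have h3 : IsUnit (1 - -(v * t)) := isUnit_one_sub_of_norm_lt_one (by
    rw [norm_neg]
    exact (norm_mul_le _ _).trans_lt h)
  have h4 : u + t = u * (1 - -(v * t)) := by
    rw [sub_neg_eq_add, mul_add, mul_one, ← mul_assoc, h1, one_mul]
  rw [h4]
  exact (Units.mk u v h1 h2).isUnit.mul h3

/-- The discrete operator is invertible in the gap. -/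
theorem isUnit_sub_hop {C : ℝ} {z : ℂ} (h : |C| < |1 - ‖z‖|) :
    IsUnit (((C : ℂ) • 1 : VertexL2 →L[ℂ] VertexL2) - hop₁ - hop₂ z) := by
  have hC : ‖((C : ℂ) • 1 : VertexL2 →L[ℂ] VertexL2)‖ ≤ |C| := by
    refine (norm_smul_le (C : ℂ) (1 : VertexL2 →L[ℂ] VertexL2)).trans ?_
    rw [Complex.norm_real, Real.norm_eq_abs]
    exact mul_le_of_le_one_right (abs_nonneg _) ContinuousLinearMap.norm_id_le
  rcases lt_or_ge ‖z‖ 1 with hz | hz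
  -- If `‖z‖ < 1`, the horizontal hopping dominates: it is its own inverse, and the rest has norm at
  -- most `|C| + ‖z‖ < 1`.
  · rw [abs_of_pos (a := 1 - ‖z‖) (by linarith)] at h
    have h1 := isUnit_add_of_right_inverse (u := -hop₁) (v := -hop₁) (t := (C : ℂ) • 1 - hop₂ z)
      (by simp [hop₁_mul_hop₁]) (by simp [hop₁_mul_hop₁]) (by
        rw [norm_neg]
        have h2 := (norm_sub_le ((C : ℂ) • 1) (hop₂ z)).trans (add_le_add hC (norm_hop₂_le z))
        nlinarith [norm_hop₁_le, norm_nonneg hop₁, norm_nonneg ((C : ℂ) • 1 - hop₂ z)])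
    convert h1 using 1
    abel
  -- Otherwise the zigzag hopping dominates: its inverse has norm at most `‖z‖⁻¹`, and the rest has
  -- norm at most `|C| + 1 < ‖z‖`.
  · rw [abs_of_nonpos (a := 1 - ‖z‖) (by linarith)] at h
    have hz0 : 0 < ‖z‖ := by linarith
    have hz1 : ((‖z‖ ^ 2 : ℝ) : ℂ) ≠ 0 := by
      exact_mod_cast (by positivity : ‖z‖ ^ 2 ≠ 0)
    have h1 := isUnit_add_of_right_inverse (u := -hop₂ z)
      (v := -((((‖z‖ ^ 2 : ℝ) : ℂ)⁻¹) • hop₂ z)) (t := (C : ℂ) • 1 - hop₁)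
      (by rw [neg_mul_neg, mul_smul_comm, hop₂_mul_hop₂, inv_smul_smul₀ hz1])
      (by rw [neg_mul_neg, smul_mul_assoc, hop₂_mul_hop₂, inv_smul_smul₀ hz1]) (by
        rw [norm_neg, norm_smul, norm_inv, Complex.norm_real, norm_pow, norm_norm]
        have h2 := (norm_sub_le ((C : ℂ) • 1) hop₁).trans (add_le_add hC norm_hop₁_le)
        have h3 : (‖z‖ ^ 2)⁻¹ * ‖hop₂ z‖ ≤ ‖z‖⁻¹ := by
          calc (‖z‖ ^ 2)⁻¹ * ‖hop₂ z‖ ≤ (‖z‖ ^ 2)⁻¹ * ‖z‖ := by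
                gcongr
                exact norm_hop₂_le z
            _ = ‖z‖⁻¹ := by field_simp
        calc _ ≤ ‖z‖⁻¹ * (|C| + 1) := by gcongr
          _ < 1 := by
            rw [inv_mul_lt_iff₀ hz0]
            linarith)
    convert h1 using 1
    abel

/-- Solution of the discrete equations in the gap. -/
theorem exists_vertex_resolvent {C : ℝ} {z : ℂ} (h : |C| < |1 - ‖z‖|) :
    ∃ R : VertexL2 →L[ℂ] VertexL2, ∀ F, ∀ k : ℤ,
      C * R F (.inl k) - R F (.inr k) - z * R F (.inr (k + 1)) = F (.inl k) ∧
      C * R F (.inr k) - R F (.inl k) - starRingEnd ℂ z * R F (.inl (k - 1)) = F (.inr k) := by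
  obtain ⟨u, hu⟩ := isUnit_sub_hop h
  refine ⟨(u⁻¹ : _), fun F k => ?_⟩
  have h1 : (((C : ℂ) • 1 : VertexL2 →L[ℂ] VertexL2) - hop₁ - hop₂ z)
      ((u⁻¹ : (VertexL2 →L[ℂ] VertexL2)ˣ).1 F) = F := by
    rw [← hu]
    exact congrArg (fun T : VertexL2 →L[ℂ] VertexL2 => T F) u.mul_inv
  set x := (u⁻¹ : (VertexL2 →L[ℂ] VertexL2)ˣ).1 F
  have h2 : ∀ v, C * x v - 1 * x v.swap - zigzagCoeff z v * x (zigzagSwap v) = F v := fun v => by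
    conv_rhs => rw [← h1]
    rfl
  exact ⟨by simpa [zigzagCoeff, zigzagSwap] using h2 (.inl k),
    by simpa [zigzagCoeff, zigzagSwap] using h2 (.inr k)⟩


/-! ### The inhomogeneous equation on an edge -/

/-- The real and imaginary parts are absolutely continuous as primitives of real integrable
functions; they are recombined with the constants `1` and `I`. -/
theorem absolutelyContinuousOnInterval_primitive {ψ : ℝ → ℂ} (hψ : Integrable ψ) (a b : ℝ) :
    AbsolutelyContinuousOnInterval (fun x => ∫ v in a..x, ψ v) a b := by
  have h1 : AbsolutelyContinuousOnInterval (fun x => ∫ v in a..x, (ψ v).re) a b :=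
    hψ.re.intervalIntegrable.absolutelyContinuousOnInterval_intervalIntegral (by simp)
  have h2 : AbsolutelyContinuousOnInterval (fun x => ∫ v in a..x, (ψ v).im) a b :=
    hψ.im.intervalIntegrable.absolutelyContinuousOnInterval_intervalIntegral (by simp)
  have hc : ∀ c : ℂ, AbsolutelyContinuousOnInterval (fun _ : ℝ => c) a b := fun c =>
    contDiffOn_const.absolutelyContinuousOnInterval
  refine (congrArg (fun f : ℝ → ℂ => AbsolutelyContinuousOnInterval f a b)
    (funext fun x => ?_)).mp ((h1.smul (hc 1)).add (h2.smul (hc Complex.I)))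
  simp only [Pi.add_apply, Pi.smul_apply', Complex.real_smul, mul_one]
  rw [← intervalIntegral.integral_ofReal, ← intervalIntegral.integral_ofReal,
    ← intervalIntegral.integral_mul_const, ← intervalIntegral.integral_add]
  · simp
  · exact (hψ.re.ofReal (𝕜 := ℂ)).intervalIntegrable
  · exact (hψ.im.ofReal (𝕜 := ℂ)).intervalIntegrable.mul_const _

/-- Integration by parts when one factor is only the primitive of an integrable function. The
difference between the product and the primitive of its formal derivative is absolutely continuous
with derivative zero almost everywhere, hence constant. -/
theorem integral_deriv_mul_primitive_self {g g' ψ : ℝ → ℂ} (hg : ∀ x, HasDerivAt g (g' x) x)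
    (hg' : Continuous g') (hψ : Integrable ψ) (a b : ℝ) :
    ∫ s in a..b, (g' s * (∫ r in a..s, ψ r) + g s * ψ s) = g b * ∫ r in a..b, ψ r := by
  have hgc : Continuous g := continuous_iff_continuousAt.2 fun x => (hg x).continuousAt
  have hP : Continuous fun s => ∫ r in a..s, ψ r :=
    intervalIntegral.continuous_primitive (fun _ _ => hψ.intervalIntegrable) a
  have hI : IntervalIntegrable (fun s => g' s * (∫ r in a..s, ψ r) + g s * ψ s) volume a b :=
    (hg'.mul hP).intervalIntegrable a b |>.add
      (hψ.intervalIntegrable.continuousOn_mul hgc.continuousOn)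
  set q := fun s => g' s * (∫ r in a..s, ψ r) + g s * ψ s
  have hQ : Integrable ((uIoc a b).indicator q) :=
    (integrable_indicator_iff measurableSet_uIoc).2 hI.def'
  have hgac : AbsolutelyContinuousOnInterval g a b := by
    refine ContDiffOn.absolutelyContinuousOnInterval (ContDiff.contDiffOn ?_)
    rw [contDiff_one_iff_deriv]
    refine ⟨fun x => (hg x).differentiableAt, ?_⟩
    rwa [show deriv g = g' from funext fun x => (hg x).deriv]
  have hac := (hgac.smul (absolutelyContinuousOnInterval_primitive hψ a b)).sub
    (absolutelyContinuousOnInterval_primitive hQ a b)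
  obtain ⟨C, hC⟩ := hac.const_of_ae_hasDerivAt_zero (by
    -- Removing the endpoints puts almost every point of the closed interval in `uIoc a b`, where
    -- the indicator can be dropped.
    have hne : ∀ᵐ x : ℝ, x ≠ a ∧ x ≠ b := by
      have : ∀ c : ℝ, ∀ᵐ x : ℝ, x ≠ c := fun c => by simp [ae_iff]
      exact (this a).and (this b)
    filter_upwards [LocallyIntegrable.ae_hasDerivAt_integral hψ.locallyIntegrable,
      LocallyIntegrable.ae_hasDerivAt_integral hQ.locallyIntegrable, hne] with x h1 h2 h3 h4
    have h5 : x ∈ uIoc a b := by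
      rw [mem_uIoc]
      rcases mem_uIcc.1 h4 with h | h
      · exact .inl ⟨lt_of_le_of_ne h.1 h3.1.symm, h.2⟩
      · exact .inr ⟨lt_of_le_of_ne h.1 h3.2.symm, h.2⟩
    have h6 := ((hg x).mul (h1 a)).sub (h2 a)
    rw [indicator_of_mem h5] at h6
    exact h6.congr_deriv (sub_self _))
  have h1 := hC a left_mem_uIcc
  have h2 := hC b right_mem_uIcc
  have h3 : ∫ v in a..b, (uIoc a b).indicator q v = ∫ v in a..b, q v :=
    intervalIntegral.integral_congr_ae (ae_of_all _ fun x hx => indicator_of_mem hx q)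
  simp only [Pi.sub_apply, smul_eq_mul, Pi.mul_apply,
    intervalIntegral.integral_same, mul_zero, sub_zero] at h1 h2
  rw [h3, ← h1] at h2
  exact (sub_eq_zero.1 h2).symm

theorem integral_deriv_mul_primitive {g g' ψ : ℝ → ℂ} (hg : ∀ x, HasDerivAt g (g' x) x)
    (hg' : Continuous g') (hψ : Integrable ψ) (c a b : ℝ) :
    ∫ s in a..b, (g' s * (∫ r in c..s, ψ r) + g s * ψ s)
      = g b * (∫ r in c..b, ψ r) - g a * ∫ r in c..a, ψ r := by
  have hgc : Continuous g := continuous_iff_continuousAt.2 fun x => (hg x).continuousAt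
  have hP : Continuous fun s => ∫ r in a..s, ψ r :=
    intervalIntegral.continuous_primitive (fun _ _ => hψ.intervalIntegrable) a
  have h1 : ∀ s, ∫ r in c..s, ψ r = (∫ r in c..a, ψ r) + ∫ r in a..s, ψ r := fun s =>
    (intervalIntegral.integral_add_adjacent_intervals hψ.intervalIntegrable
      hψ.intervalIntegrable).symm
  have h2 : ∫ s in a..b, (g' s * (∫ r in c..s, ψ r) + g s * ψ s)
      = ∫ s in a..b, (g' s * (∫ r in c..a, ψ r) + (g' s * (∫ r in a..s, ψ r) + g s * ψ s)) :=
    intervalIntegral.integral_congr fun s _ => by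
      simp only [h1 s]
      ring
  have h3 : IntervalIntegrable (fun s => g' s * (∫ r in a..s, ψ r) + g s * ψ s) volume a b :=
    (hg'.mul hP).intervalIntegrable a b |>.add
      (hψ.intervalIntegrable.continuousOn_mul hgc.continuousOn)
  rw [h2, intervalIntegral.integral_add ((hg'.intervalIntegrable a b).mul_const _) h3,
    integral_deriv_mul_primitive_self hg hg' hψ, intervalIntegral.integral_mul_const,
    intervalIntegral.integral_eq_sub_of_hasDerivAt (fun x _ => hg x) (hg'.intervalIntegrable a b),
    h1 b]
  ring

/-- `cos (ω s)` as a complex number. -/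
def cosC (ω s : ℝ) : ℂ := Real.cos (ω * s)

/-- `sin (ω s)` as a complex number. -/
def sinC (ω s : ℝ) : ℂ := Real.sin (ω * s)

theorem hasDerivAt_sinC (ω s : ℝ) : HasDerivAt (sinC ω) (ω * cosC ω s) s := by
  have := (((hasDerivAt_id s).const_mul ω).sin).ofReal_comp
  refine this.congr_deriv ?_
  simp only [id, cosC]
  push_cast
  ring

theorem hasDerivAt_cosC (ω s : ℝ) : HasDerivAt (cosC ω) (-ω * sinC ω s) s := by
  have := (((hasDerivAt_id s).const_mul ω).cos).ofReal_comp
  refine this.congr_deriv ?_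
  simp only [id, sinC]
  push_cast
  ring

theorem continuous_sinC (ω : ℝ) : Continuous (sinC ω) :=
  continuous_iff_continuousAt.2 fun s => (hasDerivAt_sinC ω s).continuousAt

theorem continuous_cosC (ω : ℝ) : Continuous (cosC ω) :=
  continuous_iff_continuousAt.2 fun s => (hasDerivAt_cosC ω s).continuousAt

theorem norm_sinC_le (ω s : ℝ) : ‖sinC ω s‖ ≤ 1 := by
  rw [sinC, Complex.norm_real]
  exact Real.abs_sin_le_one _

theorem norm_cosC_le (ω s : ℝ) : ‖cosC ω s‖ ≤ 1 := by
  rw [cosC, Complex.norm_real]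
  exact Real.abs_cos_le_one _

theorem sinC_sq_add_cosC_sq (ω s : ℝ) : sinC ω s ^ 2 + cosC ω s ^ 2 = 1 := by
  rw [sinC, cosC]
  exact_mod_cast Real.sin_sq_add_cos_sq _

theorem sinC_zero (ω : ℝ) : sinC ω 0 = 0 := by simp [sinC]

theorem cosC_zero (ω : ℝ) : cosC ω 0 = 1 := by simp [cosC]

def cosMoment (ω : ℝ) (h : ℝ → ℂ) (s : ℝ) : ℂ := ∫ r in 0..s, cosC ω r * h r

def sinMoment (ω : ℝ) (h : ℝ → ℂ) (s : ℝ) : ℂ := ∫ r in 0..s, sinC ω r * h r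

/-- The solution of `-u'' - ω² u = h` with `u 0 = a` and `u' 0 = ω b`. -/
def edgeSol (ω : ℝ) (h : ℝ → ℂ) (a b : ℂ) (s : ℝ) : ℂ :=
  -(ω : ℂ)⁻¹ * (sinC ω s * cosMoment ω h s - cosC ω s * sinMoment ω h s)
    + (a * cosC ω s + b * sinC ω s)

/-- The derivative of `edgeSol`. -/
def edgeSolDeriv (ω : ℝ) (h : ℝ → ℂ) (a b : ℂ) (s : ℝ) : ℂ :=
  -(cosC ω s * cosMoment ω h s + sinC ω s * sinMoment ω h s)
    + (-(ω * a) * sinC ω s + ω * b * cosC ω s)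

/-! ### Variation of constants on an edge -/

section EdgeSol

variable {ω : ℝ} {h : ℝ → ℂ}

theorem integrable_cosC_mul (hh : Integrable h) : Integrable fun r => cosC ω r * h r :=
  hh.bdd_mul (continuous_cosC ω).aestronglyMeasurable (ae_of_all _ (norm_cosC_le ω))

theorem integrable_sinC_mul (hh : Integrable h) : Integrable fun r => sinC ω r * h r :=
  hh.bdd_mul (continuous_sinC ω).aestronglyMeasurable (ae_of_all _ (norm_sinC_le ω))

theorem continuous_cosMoment (hh : Integrable h) : Continuous (cosMoment ω h) :=
  intervalIntegral.continuous_primitive (fun _ _ => (integrable_cosC_mul hh).intervalIntegrable) 0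

theorem continuous_sinMoment (hh : Integrable h) : Continuous (sinMoment ω h) :=
  intervalIntegral.continuous_primitive (fun _ _ => (integrable_sinC_mul hh).intervalIntegrable) 0

theorem continuous_edgeSol (hh : Integrable h) (a b : ℂ) : Continuous (edgeSol ω h a b) := by
  have h1 := continuous_cosMoment (ω := ω) hh
  have h2 := continuous_sinMoment (ω := ω) hh
  have h3 := continuous_cosC ω
  have h4 := continuous_sinC ω
  unfold edgeSol
  fun_prop

theorem continuous_edgeSolDeriv (hh : Integrable h) (a b : ℂ) :
    Continuous (edgeSolDeriv ω h a b) := by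
  have h1 := continuous_cosMoment (ω := ω) hh
  have h2 := continuous_sinMoment (ω := ω) hh
  have h3 := continuous_cosC ω
  have h4 := continuous_sinC ω
  unfold edgeSolDeriv
  fun_prop

theorem integral_edgeSolDeriv (hω : ω ≠ 0) (hh : Integrable h) (a b : ℂ) (x y : ℝ) :
    edgeSol ω h a b y - edgeSol ω h a b x = ∫ s in x..y, edgeSolDeriv ω h a b s := by
  have hω' : (ω : ℂ) ≠ 0 := by exact_mod_cast hω
  have c1 := continuous_cosMoment (ω := ω) hh
  have c2 := continuous_sinMoment (ω := ω) hh
  have c3 := continuous_cosC ω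
  have c4 := continuous_sinC ω
  have i1 := (integrable_cosC_mul (ω := ω) hh).intervalIntegrable (a := x) (b := y)
  have i2 := (integrable_sinC_mul (ω := ω) hh).intervalIntegrable (a := x) (b := y)
  have e1 := integral_deriv_mul_primitive (hasDerivAt_sinC ω) (continuous_const.mul c3)
    (integrable_cosC_mul (ω := ω) hh) 0 x y
  have e2 := integral_deriv_mul_primitive (hasDerivAt_cosC ω) (continuous_const.mul c4)
    (integrable_sinC_mul (ω := ω) hh) 0 x y
  have e3 := intervalIntegral.integral_eq_sub_of_hasDerivAt (a := x) (b := y)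
    (fun s _ => ((hasDerivAt_cosC ω s).const_mul a).add ((hasDerivAt_sinC ω s).const_mul b))
    (by apply Continuous.intervalIntegrable; fun_prop)
  -- The two added terms `sin * (cos * h)` and `cos * (sin * h)` cancel each other, as in the method
  -- of variation of constants; they give each bracket the form required by integration by parts.
  have e4 : ∀ s, edgeSolDeriv ω h a b s = -(ω : ℂ)⁻¹ *
      ((ω * cosC ω s * cosMoment ω h s + sinC ω s * (cosC ω s * h s))
        - (-ω * sinC ω s * sinMoment ω h s + cosC ω s * (sinC ω s * h s)))
      + (a * (-ω * sinC ω s) + b * (ω * cosC ω s)) := fun s => by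
    unfold edgeSolDeriv
    field_simp
    ring
  have j1 : IntervalIntegrable (fun s => ω * cosC ω s * cosMoment ω h s
      + sinC ω s * (cosC ω s * h s)) volume x y :=
    (Continuous.intervalIntegrable (by fun_prop) _ _).add (i1.continuousOn_mul c4.continuousOn)
  have j2 : IntervalIntegrable (fun s => -ω * sinC ω s * sinMoment ω h s
      + cosC ω s * (sinC ω s * h s)) volume x y :=
    (Continuous.intervalIntegrable (by fun_prop) _ _).add (i2.continuousOn_mul c3.continuousOn)
  simp only [e4]
  rw [intervalIntegral.integral_add ((j1.sub j2).const_mul _)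
      (Continuous.intervalIntegrable (by fun_prop) _ _),
    intervalIntegral.integral_const_mul, intervalIntegral.integral_sub j1 j2, e3]
  simp only [cosMoment, sinMoment]
  rw [e1, e2]
  simp only [edgeSol, cosMoment, sinMoment, Pi.add_apply]
  ring

theorem integral_edgeSolDeriv2 (hω : ω ≠ 0) (hh : Integrable h) (a b : ℂ) (x y : ℝ) :
    edgeSolDeriv ω h a b y - edgeSolDeriv ω h a b x
      = ∫ s in x..y, (-(ω : ℂ) ^ 2 * edgeSol ω h a b s - h s) := by
  have hω' : (ω : ℂ) ≠ 0 := by exact_mod_cast hω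
  have c1 := continuous_cosMoment (ω := ω) hh
  have c2 := continuous_sinMoment (ω := ω) hh
  have c3 := continuous_cosC ω
  have c4 := continuous_sinC ω
  have i1 := (integrable_cosC_mul (ω := ω) hh).intervalIntegrable (a := x) (b := y)
  have i2 := (integrable_sinC_mul (ω := ω) hh).intervalIntegrable (a := x) (b := y)
  have e1 := integral_deriv_mul_primitive (hasDerivAt_cosC ω) (continuous_const.mul c4)
    (integrable_cosC_mul (ω := ω) hh) 0 x y
  have e2 := integral_deriv_mul_primitive (hasDerivAt_sinC ω) (continuous_const.mul c3)
    (integrable_sinC_mul (ω := ω) hh) 0 x y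
  have e3 := intervalIntegral.integral_eq_sub_of_hasDerivAt (a := x) (b := y)
    (fun s _ => ((hasDerivAt_sinC ω s).const_mul (-(ω * a))).add
      ((hasDerivAt_cosC ω s).const_mul (ω * b)))
    (by apply Continuous.intervalIntegrable; fun_prop)
  -- This time the terms that contain `h` add up to `(cos² + sin²) h = h`, which is the right-hand
  -- side of the equation.
  have e4 : ∀ s, -(ω : ℂ) ^ 2 * edgeSol ω h a b s - h s =
      -1 * ((-ω * sinC ω s * cosMoment ω h s + cosC ω s * (cosC ω s * h s))
        + (ω * cosC ω s * sinMoment ω h s + sinC ω s * (sinC ω s * h s)))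
      + (-(ω * a) * (ω * cosC ω s) + ω * b * (-ω * sinC ω s)) := fun s => by
    unfold edgeSol
    field_simp
    linear_combination h s * sinC_sq_add_cosC_sq ω s
  have j1 : IntervalIntegrable (fun s => -ω * sinC ω s * cosMoment ω h s
      + cosC ω s * (cosC ω s * h s)) volume x y :=
    (Continuous.intervalIntegrable (by fun_prop) _ _).add (i1.continuousOn_mul c3.continuousOn)
  have j2 : IntervalIntegrable (fun s => ω * cosC ω s * sinMoment ω h s
      + sinC ω s * (sinC ω s * h s)) volume x y :=
    (Continuous.intervalIntegrable (by fun_prop) _ _).add (i2.continuousOn_mul c4.continuousOn)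
  simp only [e4]
  rw [intervalIntegral.integral_add ((j1.add j2).const_mul _)
      (Continuous.intervalIntegrable (by fun_prop) _ _),
    intervalIntegral.integral_const_mul, intervalIntegral.integral_add j1 j2, e3]
  simp only [cosMoment, sinMoment]
  rw [e1, e2]
  simp only [edgeSolDeriv, cosMoment, sinMoment, Pi.add_apply]
  ring

theorem norm_cosMoment_le (hh : Integrable h) (s : ℝ) : ‖cosMoment ω h s‖ ≤ ∫ r, ‖h r‖ := by
  rw [cosMoment, intervalIntegral.norm_intervalIntegral_eq]
  refine (norm_integral_le_integral_norm _).trans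
    ((setIntegral_le_integral (integrable_cosC_mul hh).norm (ae_of_all _ fun r => norm_nonneg _)).trans
      (integral_mono (integrable_cosC_mul hh).norm hh.norm fun r => ?_))
  rw [norm_mul]
  exact mul_le_of_le_one_left (norm_nonneg _) (norm_cosC_le _ _)

theorem norm_sinMoment_le (hh : Integrable h) (s : ℝ) : ‖sinMoment ω h s‖ ≤ ∫ r, ‖h r‖ := by
  rw [sinMoment, intervalIntegral.norm_intervalIntegral_eq]
  refine (norm_integral_le_integral_norm _).trans
    ((setIntegral_le_integral (integrable_sinC_mul hh).norm (ae_of_all _ fun r => norm_nonneg _)).trans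
      (integral_mono (integrable_sinC_mul hh).norm hh.norm fun r => ?_))
  rw [norm_mul]
  exact mul_le_of_le_one_left (norm_nonneg _) (norm_sinC_le _ _)

theorem norm_mul_sinC_le (x : ℂ) (ω s : ℝ) : ‖x * sinC ω s‖ ≤ ‖x‖ := by
  rw [norm_mul]
  exact mul_le_of_le_one_right (norm_nonneg _) (norm_sinC_le _ _)

theorem norm_mul_cosC_le (x : ℂ) (ω s : ℝ) : ‖x * cosC ω s‖ ≤ ‖x‖ := by
  rw [norm_mul]
  exact mul_le_of_le_one_right (norm_nonneg _) (norm_cosC_le _ _)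

theorem norm_edgeSol_le (hω : 0 < ω) (hh : Integrable h) (a b : ℂ) (s : ℝ) :
    ‖edgeSol ω h a b s‖ ≤ 2 * ω⁻¹ * (∫ r, ‖h r‖) + ‖a‖ + ‖b‖ := by
  unfold edgeSol
  refine (norm_add_le _ _).trans ?_
  rw [add_assoc]
  refine add_le_add ?_ ((norm_add_le _ _).trans
    (add_le_add (norm_mul_cosC_le _ _ _) (norm_mul_sinC_le _ _ _)))
  rw [norm_mul, norm_neg, norm_inv, Complex.norm_real, Real.norm_of_nonneg hω.le,
    mul_comm 2, mul_assoc]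
  refine mul_le_mul_of_nonneg_left ?_ (by positivity)
  rw [mul_comm (sinC ω s), mul_comm (cosC ω s)]
  have h1 := (norm_mul_sinC_le (cosMoment ω h s) ω s).trans (norm_cosMoment_le hh s)
  have h2 := (norm_mul_cosC_le (sinMoment ω h s) ω s).trans (norm_sinMoment_le hh s)
  linarith [norm_sub_le (cosMoment ω h s * sinC ω s) (sinMoment ω h s * cosC ω s)]

theorem norm_edgeSolDeriv_le (hω : 0 < ω) (hh : Integrable h) (a b : ℂ) (s : ℝ) :
    ‖edgeSolDeriv ω h a b s‖ ≤ 2 * (∫ r, ‖h r‖) + ω * ‖a‖ + ω * ‖b‖ := by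
  unfold edgeSolDeriv
  refine (norm_add_le _ _).trans ?_
  rw [add_assoc]
  refine add_le_add ?_ ((norm_add_le _ _).trans
    (add_le_add ((norm_mul_sinC_le _ _ _).trans ?_) ((norm_mul_cosC_le _ _ _).trans ?_)))
  · rw [norm_neg, mul_comm (sinC ω s), mul_comm (cosC ω s)]
    have h1 := (norm_mul_cosC_le (cosMoment ω h s) ω s).trans (norm_cosMoment_le hh s)
    have h2 := (norm_mul_sinC_le (sinMoment ω h s) ω s).trans (norm_sinMoment_le hh s)
    linarith [norm_add_le (cosMoment ω h s * cosC ω s) (sinMoment ω h s * sinC ω s)]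
  all_goals simp [abs_of_pos hω]

theorem edgeSol_zero (a b : ℂ) : edgeSol ω h a b 0 = a := by
  simp [edgeSol, sinC_zero, cosC_zero, sinMoment]

theorem edgeSolDeriv_zero (a b : ℂ) : edgeSolDeriv ω h a b 0 = ω * b := by
  simp [edgeSolDeriv, sinC_zero, cosC_zero, cosMoment]

end EdgeSol


/-! ### Extension by zero of the elements of the `L²` space -/

section Source

variable {t μ : ℝ}

theorem min_le_weight (μ : ℝ) (e : Edge) : min 1 μ ≤ weight μ e := by
  unfold weight
  split_ifs
  exacts [min_le_left _ _, min_le_right _ _]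

theorem weight_le_max (μ : ℝ) (e : Edge) : weight μ e ≤ max 1 μ := by
  unfold weight
  split_ifs
  exacts [le_max_left _ _, le_max_right _ _]

instance isFiniteMeasure_edgeMeasure (t μ : ℝ) (p : Fin 3 × ℤ) :
    IsFiniteMeasure (edgeMeasure t μ p) := ⟨by
  simp only [edgeMeasure, Measure.smul_apply, smul_eq_mul, Measure.restrict_apply_univ]
  exact ENNReal.mul_lt_top ENNReal.ofReal_lt_top (volume_part_ne_top t _).lt_top⟩

theorem volume_real_part_le (t : ℝ) (e : Edge) : volume.real (part t e) ≤ edgeLen := by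
  have h : volume.real (part t e) ≤ volume.real (Ioo 0 edgeLen) :=
    measureReal_mono (fun _ hs => hs.1) measure_Ioo_lt_top.ne
  simpa [edgeLen_pos.le] using h

theorem edgeMeasure_real_univ (hμ : 0 < μ) (p : Fin 3 × ℤ) :
    (edgeMeasure t μ p).real univ = weight μ (rep p) * volume.real (part t (rep p)) := by
  simp [edgeMeasure, Measure.real, (weight_pos hμ _).le]

/-- As the weight is positive, equalities almost everywhere in the weighted space hold for the
Lebesgue measure on the edge as well. -/
theorem restrict_part_absolutelyContinuous (hμ : 0 < μ) (p : Fin 3 × ℤ) :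
    volume.restrict (part t (rep p)) ≪ edgeMeasure t μ p :=
  Measure.absolutelyContinuous_smul (by simpa using weight_pos hμ (rep p))

/-- The extension by zero of the component of `f` on an edge. -/
def source (f : GraphL2 t μ) (p : Fin 3 × ℤ) : ℝ → ℂ := (part t (rep p)).indicator (f p)

theorem source_add (hμ : 0 < μ) (f g : GraphL2 t μ) (p : Fin 3 × ℤ) :
    source (f + g) p =ᵐ[volume] source f p + source g p := by
  have h1 := (restrict_part_absolutelyContinuous hμ p).ae_eq (Lp.coeFn_add (f p) (g p))
  rw [Filter.EventuallyEq, ae_restrict_iff' (isOpen_part t _).measurableSet] at h1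
  filter_upwards [h1] with s hs
  by_cases h : s ∈ part t (rep p)
  · simpa [source, h] using hs h
  · simp [source, h]

theorem source_smul (hμ : 0 < μ) (c : ℂ) (f : GraphL2 t μ) (p : Fin 3 × ℤ) :
    source (c • f) p =ᵐ[volume] c • source f p := by
  have h1 := (restrict_part_absolutelyContinuous hμ p).ae_eq (Lp.coeFn_smul c (f p))
  rw [Filter.EventuallyEq, ae_restrict_iff' (isOpen_part t _).measurableSet] at h1
  filter_upwards [h1] with s hs
  by_cases h : s ∈ part t (rep p)
  · simpa [source, h] using hs h
  · simp [source, h]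

theorem memLp_restrict (hμ : 0 < μ) {p : Fin 3 × ℤ} {u : ℝ → ℂ}
    (hu : MemLp u 2 (edgeMeasure t μ p)) : MemLp u 2 (volume.restrict (part t (rep p))) := by
  have hw : ENNReal.ofReal (weight μ (rep p)) ≠ 0 := by simpa using weight_pos hμ (rep p)
  have h := hu.smul_measure (c := (ENNReal.ofReal (weight μ (rep p)))⁻¹) (by simpa using hw)
  rwa [edgeMeasure, smul_smul, ENNReal.inv_mul_cancel hw ENNReal.ofReal_ne_top, one_smul] at h

theorem memLp_source (hμ : 0 < μ) (f : GraphL2 t μ) (p : Fin 3 × ℤ) :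
    MemLp (source f p) 2 volume :=
  (memLp_indicator_iff_restrict (isOpen_part t _).measurableSet).2
    (memLp_restrict hμ (Lp.memLp (f p)))

theorem norm_sq_eq_integral {X : Type*} [MeasurableSpace X] {ν : Measure X} (f : Lp ℂ 2 ν) :
    ‖f‖ ^ 2 = ∫ s, ‖f s‖ ^ 2 ∂ν := by
  have h := L2.inner_def (𝕜 := ℂ) f f
  rw [inner_self_eq_norm_sq_to_K] at h
  simp only [inner_self_eq_norm_sq_to_K] at h
  have h2 : (∫ s, ((‖f s‖ : ℂ)) ^ 2 ∂ν) = ((∫ s, ‖f s‖ ^ 2 ∂ν : ℝ) : ℂ) := by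
    rw [← integral_complex_ofReal]
    simp
  have h3 : ((‖f‖ : ℝ) : ℂ) ^ 2 = ((∫ s, ‖f s‖ ^ 2 ∂ν : ℝ) : ℂ) := h.trans h2
  exact_mod_cast h3

theorem integral_edgeMeasure (hμ : 0 < μ) (p : Fin 3 × ℤ) (g : ℝ → ℝ) :
    ∫ s, g s ∂edgeMeasure t μ p = weight μ (rep p) * ∫ s in part t (rep p), g s := by
  rw [edgeMeasure, integral_smul_measure, ENNReal.toReal_ofReal (weight_pos hμ _).le, smul_eq_mul]

theorem norm_sq_component (hμ : 0 < μ) (f : GraphL2 t μ) (p : Fin 3 × ℤ) :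
    ‖f p‖ ^ 2 = weight μ (rep p) * ∫ s in part t (rep p), ‖f p s‖ ^ 2 := by
  rw [norm_sq_eq_integral, integral_edgeMeasure hμ]

theorem integral_norm_source_sq (f : GraphL2 t μ) (p : Fin 3 × ℤ) :
    ∫ s, ‖source f p s‖ ^ 2 = ∫ s in part t (rep p), ‖f p s‖ ^ 2 := by
  rw [← integral_indicator (isOpen_part t _).measurableSet]
  congr 1
  funext s
  by_cases h : s ∈ part t (rep p) <;> simp [source, h]

theorem integrable_source (hμ : 0 < μ) (f : GraphL2 t μ) (p : Fin 3 × ℤ) :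
    Integrable (source f p) := by
  have : IsFiniteMeasure (volume.restrict (part t (rep p))) := ⟨by
    simpa using (volume_part_ne_top t (rep p)).lt_top⟩
  rw [source, integrable_indicator_iff (isOpen_part t _).measurableSet]
  exact (memLp_restrict hμ (Lp.memLp (f p))).integrable (by norm_num)

/-- Cauchy–Schwarz inequality, read off from the nonnegativity of the integral of `(m g - A) ^ 2`,
where `m` is the total mass and `A` the integral of `g`. -/
theorem sq_integral_le {X : Type*} [MeasurableSpace X] {ν : Measure X} [IsFiniteMeasure ν] {g : X → ℝ}
    (hg : MemLp g 2 ν) : (∫ s, g s ∂ν) ^ 2 ≤ ν.real univ * ∫ s, g s ^ 2 ∂ν := by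
  set A := ∫ s, g s ∂ν
  set m := ν.real univ
  have hm : 0 ≤ m := measureReal_nonneg
  have h1 : Integrable g ν := hg.integrable (by norm_num)
  have h2 : Integrable (fun s => g s ^ 2) ν := hg.integrable_sq
  have h3 : 0 ≤ ∫ s, (m * g s - A) ^ 2 ∂ν := integral_nonneg fun s => sq_nonneg _
  have h4 : ∫ s, (m * g s - A) ^ 2 ∂ν = m ^ 2 * (∫ s, g s ^ 2 ∂ν) - 2 * m * A * A + A ^ 2 * m := by
    have : ∀ s, (m * g s - A) ^ 2 = m ^ 2 * g s ^ 2 - 2 * m * A * g s + A ^ 2 := fun s => by ring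
    simp only [this]
    have h5 : Integrable (fun s => m ^ 2 * g s ^ 2 - 2 * m * A * g s) ν :=
      (h2.const_mul _).sub (h1.const_mul _)
    rw [integral_add h5 (integrable_const _),
      integral_sub (h2.const_mul _) (h1.const_mul _), integral_const_mul, integral_const_mul,
      integral_const, smul_eq_mul]
    ring
  rcases hm.eq_or_lt with h | h
  · have h5 : ν = 0 := by
      rw [← Measure.measure_univ_eq_zero]
      simpa [m, Measure.real, ENNReal.toReal_eq_zero_iff] using h.symm
    simp [A, h5]
  · have h6 : 0 ≤ m * (m * (∫ s, g s ^ 2 ∂ν) - A ^ 2) := by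
      rw [h4] at h3
      linarith
    linarith [nonneg_of_mul_nonneg_right h6 h]

/-- Cauchy–Schwarz inequality on an interval of length at most `edgeLen`, with a weight at least
`min 1 μ`. The constant is the same for all edges, which yields the `ℓ²` bounds on the solution. -/
theorem integral_norm_source_le (hμ : 0 < μ) (f : GraphL2 t μ) (p : Fin 3 × ℤ) :
    ∫ s, ‖source f p s‖ ≤ √(edgeLen / min 1 μ) * ‖f p‖ := by
  have hm : 0 < min 1 μ := lt_min one_pos hμ
  have hL := edgeLen_pos
  have : IsFiniteMeasure (volume.restrict (part t (rep p))) := ⟨by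
    simpa using (volume_part_ne_top t (rep p)).lt_top⟩
  refine le_of_sq_le_sq ?_ (by positivity)
  have h1 : ∫ s, ‖source f p s‖ = ∫ s in part t (rep p), ‖f p s‖ := by
    rw [← integral_indicator (isOpen_part t _).measurableSet]
    congr 1
    funext s
    by_cases h : s ∈ part t (rep p) <;> simp [source, h]
  have h2 := sq_integral_le (memLp_restrict hμ (Lp.memLp (f p))).norm
  have h3 : 0 ≤ ∫ s in part t (rep p), ‖f p s‖ ^ 2 := integral_nonneg fun s => by positivity
  rw [h1, mul_pow, Real.sq_sqrt (by positivity), norm_sq_component hμ]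
  refine h2.trans ?_
  rw [measureReal_restrict_apply_univ, ← mul_assoc]
  refine mul_le_mul_of_nonneg_right ?_ h3
  rw [div_mul_eq_mul_div, le_div_iff₀ hm]
  exact mul_le_mul (volume_real_part_le _ _) (min_le_weight _ _) hm.le hL.le

theorem cosMoment_congr {ω : ℝ} {h k : ℝ → ℂ} (hk : h =ᵐ[volume] k) (s : ℝ) :
    cosMoment ω h s = cosMoment ω k s :=
  intervalIntegral.integral_congr_ae (hk.mono fun r hr _ => by rw [hr])

theorem sinMoment_congr {ω : ℝ} {h k : ℝ → ℂ} (hk : h =ᵐ[volume] k) (s : ℝ) :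
    sinMoment ω h s = sinMoment ω k s :=
  intervalIntegral.integral_congr_ae (hk.mono fun r hr _ => by rw [hr])

/-- The cosine moment of a component, as a linear functional. -/
def cosFunctional (hμ : 0 < μ) (ω : ℝ) (p : Fin 3 × ℤ) (s : ℝ) : GraphL2 t μ →ₗ[ℂ] ℂ where
  toFun f := cosMoment ω (source f p) s
  map_add' f g := by
    rw [cosMoment_congr (source_add hμ f g p)]
    simp only [cosMoment, Pi.add_apply, mul_add]
    exact intervalIntegral.integral_add (integrable_cosC_mul (integrable_source hμ f p)).intervalIntegrable
      (integrable_cosC_mul (integrable_source hμ g p)).intervalIntegrable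
  map_smul' c f := by
    rw [cosMoment_congr (source_smul hμ c f p)]
    simp only [cosMoment, Pi.smul_apply, smul_eq_mul, mul_left_comm _ c, RingHom.id_apply]
    exact intervalIntegral.integral_const_mul _ _

/-- The sine moment of a component, as a linear functional. -/
def sinFunctional (hμ : 0 < μ) (ω : ℝ) (p : Fin 3 × ℤ) (s : ℝ) : GraphL2 t μ →ₗ[ℂ] ℂ where
  toFun f := sinMoment ω (source f p) s
  map_add' f g := by
    rw [sinMoment_congr (source_add hμ f g p)]
    simp only [sinMoment, Pi.add_apply, mul_add]
    exact intervalIntegral.integral_add (integrable_sinC_mul (integrable_source hμ f p)).intervalIntegrable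
      (integrable_sinC_mul (integrable_source hμ g p)).intervalIntegrable
  map_smul' c f := by
    rw [sinMoment_congr (source_smul hμ c f p)]
    simp only [sinMoment, Pi.smul_apply, smul_eq_mul, mul_left_comm _ c, RingHom.id_apply]
    exact intervalIntegral.integral_const_mul _ _

theorem norm_toLp_sq_le (hμ : 0 < μ) {p : Fin 3 × ℤ} {u : ℝ → ℂ}
    (hu : MemLp u 2 (edgeMeasure t μ p)) {B : ℝ} (hB : ∀ s, ‖u s‖ ≤ B) :
    ‖hu.toLp u‖ ^ 2 ≤ max 1 μ * edgeLen * B ^ 2 := by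
  rw [norm_sq_eq_integral]
  have h1 : ∫ s, ‖hu.toLp u s‖ ^ 2 ∂edgeMeasure t μ p ≤ ∫ s, B ^ 2 ∂edgeMeasure t μ p := by
    refine integral_mono_of_nonneg (ae_of_all _ fun s => by positivity) (integrable_const _) ?_
    filter_upwards [hu.coeFn_toLp] with s hs
    rw [hs]
    exact pow_le_pow_left₀ (norm_nonneg _) (hB s) 2
  refine h1.trans ?_
  rw [integral_const, smul_eq_mul, edgeMeasure_real_univ hμ]
  refine mul_le_mul_of_nonneg_right ?_ (sq_nonneg _)
  exact mul_le_mul (weight_le_max _ _) (volume_real_part_le _ _) measureReal_nonneg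
    (le_max_of_le_left zero_le_one)

end Source


/-! ### The parametrix -/

section Parametrix

variable {t μ : ℝ} (hμ : 0 < μ) (β ω : ℝ)

/-- The vertex `A` of an edge. -/
def srcVertex (p : Fin 3 × ℤ) : ℤ ⊕ ℤ := .inl p.2

/-- The vertex `B` of an edge. -/
def tgtVertex (p : Fin 3 × ℤ) : ℤ ⊕ ℤ := .inr (if p.1 = 0 then p.2 else p.2 + 1)

/-- The phase between the vertex `B` of an edge and its representative. -/
def tgtPhase (β : ℝ) (j : Fin 3) : ℂ := if j = 1 then (multiplier β)⁻¹ else 1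

theorem norm_tgtPhase (j : Fin 3) : ‖tgtPhase β j‖ = 1 := by
  unfold tgtPhase
  split_ifs <;> simp [norm_multiplier]

/-- Right-hand side of the discrete equations, for the right-hand side `f` on the edges. -/
def vertexSourceLin : GraphL2 t μ →ₗ[ℂ] (ℤ ⊕ ℤ → ℂ) :=
  LinearMap.pi fun v => match v with
    | .inl k => (ω : ℂ)⁻¹ • ∑ j, (sinC ω edgeLen • cosFunctional hμ ω (j, k) edgeLen
        - cosC ω edgeLen • sinFunctional hμ ω (j, k) edgeLen)
    | .inr k => (ω : ℂ)⁻¹ • (sinFunctional hμ ω (0, k) edgeLen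
        + multiplier β • sinFunctional hμ ω (1, k - 1) edgeLen
        + sinFunctional hμ ω (2, k - 1) edgeLen)

/-- The `j`-th edge at a vertex. -/
def vertexEdge (j : Fin 3) : ℤ ⊕ ℤ → Fin 3 × ℤ
  | .inl k => (j, k)
  | .inr k => (j, if j = 0 then k else k - 1)

theorem norm_cosMoment_source_le {t μ : ℝ} (hμ : 0 < μ) (ω : ℝ) (f : GraphL2 t μ) (p : Fin 3 × ℤ) (s : ℝ) :
    ‖cosMoment ω (source f p) s‖ ≤ √(edgeLen / min 1 μ) * ‖f p‖ :=
  (norm_cosMoment_le (integrable_source hμ f p) s).trans (integral_norm_source_le hμ f p)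

theorem norm_sinMoment_source_le {t μ : ℝ} (hμ : 0 < μ) (ω : ℝ) (f : GraphL2 t μ) (p : Fin 3 × ℤ) (s : ℝ) :
    ‖sinMoment ω (source f p) s‖ ≤ √(edgeLen / min 1 μ) * ‖f p‖ :=
  (norm_sinMoment_le (integrable_source hμ f p) s).trans (integral_norm_source_le hμ f p)

theorem norm_vertexSourceLin_le (f : GraphL2 t μ) (v : ℤ ⊕ ℤ) :
    ‖vertexSourceLin hμ β ω f v‖
      ≤ ‖(ω : ℂ)⁻¹‖ * (2 * √(edgeLen / min 1 μ)) * ∑ j, ‖f (vertexEdge j v)‖ := by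
  set K := √(edgeLen / min 1 μ)
  have hK : 0 ≤ K := Real.sqrt_nonneg _
  rw [mul_assoc]
  cases v with
  | inl k =>
    change ‖(ω : ℂ)⁻¹ • (∑ j : Fin 3, (sinC ω edgeLen • cosFunctional hμ ω (j, k) edgeLen
        - cosC ω edgeLen • sinFunctional hμ ω (j, k) edgeLen) : GraphL2 t μ →ₗ[ℂ] ℂ) f‖ ≤ _
    rw [norm_smul, LinearMap.sum_apply, Finset.mul_sum]
    refine mul_le_mul_of_nonneg_left ((norm_sum_le _ _).trans (Finset.sum_le_sum fun j _ => ?_))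
      (norm_nonneg _)
    change ‖sinC ω edgeLen * cosMoment ω (source f (j, k)) edgeLen
      - cosC ω edgeLen * sinMoment ω (source f (j, k)) edgeLen‖ ≤ 2 * K * ‖f (j, k)‖
    rw [mul_comm (sinC _ _), mul_comm (cosC _ _)]
    have h1 := (norm_mul_sinC_le (cosMoment ω (source f (j, k)) edgeLen) ω edgeLen).trans
      (norm_cosMoment_source_le hμ ω f (j, k) edgeLen)
    have h2 := (norm_mul_cosC_le (sinMoment ω (source f (j, k)) edgeLen) ω edgeLen).trans
      (norm_sinMoment_source_le hμ ω f (j, k) edgeLen)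
    linarith [norm_sub_le (cosMoment ω (source f (j, k)) edgeLen * sinC ω edgeLen)
      (sinMoment ω (source f (j, k)) edgeLen * cosC ω edgeLen)]
  | inr k =>
    change ‖(ω : ℂ)⁻¹ • (sinMoment ω (source f (0, k)) edgeLen
      + multiplier β * sinMoment ω (source f (1, k - 1)) edgeLen
      + sinMoment ω (source f (2, k - 1)) edgeLen)‖ ≤ _
    rw [norm_smul, Fin.sum_univ_three]
    refine mul_le_mul_of_nonneg_left ((norm_add₃_le).trans ?_) (norm_nonneg _)
    rw [norm_mul, norm_multiplier, one_mul]
    have h0 := norm_sinMoment_source_le hμ ω f (0, k) edgeLen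
    have h1 := norm_sinMoment_source_le hμ ω f (1, k - 1) edgeLen
    have h2 := norm_sinMoment_source_le hμ ω f (2, k - 1) edgeLen
    change _ ≤ 2 * K * (‖f (0, k)‖ + ‖f (1, k - 1)‖ + ‖f (2, k - 1)‖)
    have := norm_nonneg (f (0, k))
    have := norm_nonneg (f (1, k - 1))
    have := norm_nonneg (f (2, k - 1))
    nlinarith

/-- For each `j`, an edge is reached from at most two vertices, one of type `A` and one of type `B`;
the type is the colour in `sum_comp_le_card_mul_norm_sq`. -/
theorem vertexEdge_injective (j : Fin 3) :
    Function.Injective fun v => (v.isLeft, vertexEdge j v) := by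
  rintro (k | k) (l | l) h <;> simp_all [vertexEdge]
  split_ifs at h <;> omega

theorem sum_norm_vertexSourceLin_le (f : GraphL2 t μ) (s : Finset (ℤ ⊕ ℤ)) :
    ∑ v ∈ s, ‖vertexSourceLin hμ β ω f v‖ ^ 2
      ≤ (‖(ω : ℂ)⁻¹‖ * (2 * √(edgeLen / min 1 μ)) * 5 * ‖f‖) ^ 2 := by
  set K := ‖(ω : ℂ)⁻¹‖ * (2 * √(edgeLen / min 1 μ))
  have hK : 0 ≤ K := by positivity
  calc ∑ v ∈ s, ‖vertexSourceLin hμ β ω f v‖ ^ 2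
      ≤ ∑ v ∈ s, K ^ 2 * (3 * ∑ j, ‖f (vertexEdge j v)‖ ^ 2) := by
        refine Finset.sum_le_sum fun v _ => ?_
        refine (pow_le_pow_left₀ (norm_nonneg _) (norm_vertexSourceLin_le hμ β ω f v) 2).trans ?_
        rw [mul_pow]
        refine mul_le_mul_of_nonneg_left ?_ (by positivity)
        simpa using sq_sum_le_card_mul_sum_sq (s := Finset.univ)
          (f := fun j : Fin 3 => ‖f (vertexEdge j v)‖)
    _ = 3 * K ^ 2 * ∑ j, ∑ v ∈ s, ‖f (vertexEdge j v)‖ ^ 2 := by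
        rw [Finset.sum_comm, Finset.mul_sum]
        refine Finset.sum_congr rfl fun v _ => by ring
    _ ≤ 3 * K ^ 2 * ∑ j : Fin 3, 2 * ‖f‖ ^ 2 := by
        refine mul_le_mul_of_nonneg_left (Finset.sum_le_sum fun j _ => ?_) (by positivity)
        simpa using sum_comp_le_card_mul_norm_sq Sum.isLeft (vertexEdge_injective j) f s
    -- The factor is `3 * 3 * 2 = 18 ≤ 5 ^ 2`: Cauchy–Schwarz over three edges, three values of `j`,
    -- two endpoints.
    _ ≤ (K * 5 * ‖f‖) ^ 2 := by
        simp only [Finset.sum_const, Finset.card_univ, Fintype.card_fin, nsmul_eq_mul]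
        push_cast
        nlinarith [mul_nonneg (sq_nonneg K) (sq_nonneg ‖f‖)]

def vertexSource : GraphL2 t μ →L[ℂ] VertexL2 :=
  toLittleL2 (vertexSourceLin hμ β ω) _ (by positivity) (sum_norm_vertexSourceLin_le hμ β ω)

variable (R : VertexL2 →L[ℂ] VertexL2)

/-- Values at the vertices of the solution. -/
def vertexValue (v : ℤ ⊕ ℤ) : GraphL2 t μ →ₗ[ℂ] ℂ :=
  (lp.evalCLM ℂ (fun _ : ℤ ⊕ ℤ => ℂ) 2 v ∘L R ∘L vertexSource hμ β ω : GraphL2 t μ →L[ℂ] ℂ)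

/-- Coefficient of `sin (ω s)` of the solution. -/
def sinCoeff (p : Fin 3 × ℤ) : GraphL2 t μ →ₗ[ℂ] ℂ :=
  (sinC ω edgeLen)⁻¹ • (tgtPhase β p.1 • vertexValue hμ β ω R (tgtVertex p)
    + (ω : ℂ)⁻¹ • (sinC ω edgeLen • cosFunctional hμ ω p edgeLen
      - cosC ω edgeLen • sinFunctional hμ ω p edgeLen)
    - cosC ω edgeLen • vertexValue hμ β ω R (srcVertex p))

/-- Value at a point of the solution. -/
def solution (p : Fin 3 × ℤ) (s : ℝ) : GraphL2 t μ →ₗ[ℂ] ℂ :=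
  -(ω : ℂ)⁻¹ • (sinC ω s • cosFunctional hμ ω p s - cosC ω s • sinFunctional hμ ω p s)
    + (cosC ω s • vertexValue hμ β ω R (srcVertex p) + sinC ω s • sinCoeff hμ β ω R p)

/-- Derivative at a point of the solution. -/
def solutionDeriv (p : Fin 3 × ℤ) (s : ℝ) : GraphL2 t μ →ₗ[ℂ] ℂ :=
  -(cosC ω s • cosFunctional hμ ω p s + sinC ω s • sinFunctional hμ ω p s)
    + (-(ω * sinC ω s) • vertexValue hμ β ω R (srcVertex p)
      + (ω * cosC ω s) • sinCoeff hμ β ω R p)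

variable {β ω R}

theorem solution_apply (p : Fin 3 × ℤ) (s : ℝ) (f : GraphL2 t μ) :
    solution hμ β ω R p s f = edgeSol ω (source f p) (vertexValue hμ β ω R (srcVertex p) f)
      (sinCoeff hμ β ω R p f) s := by
  change -(ω : ℂ)⁻¹ * (sinC ω s * cosMoment ω (source f p) s - cosC ω s * sinMoment ω (source f p) s)
    + (cosC ω s * vertexValue hμ β ω R (srcVertex p) f + sinC ω s * sinCoeff hμ β ω R p f) = _
  unfold edgeSol
  ring

theorem solutionDeriv_apply (p : Fin 3 × ℤ) (s : ℝ) (f : GraphL2 t μ) :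
    solutionDeriv hμ β ω R p s f = edgeSolDeriv ω (source f p)
      (vertexValue hμ β ω R (srcVertex p) f) (sinCoeff hμ β ω R p f) s := by
  change -(cosC ω s * cosMoment ω (source f p) s + sinC ω s * sinMoment ω (source f p) s)
    + (-(ω * sinC ω s) * vertexValue hμ β ω R (srcVertex p) f
      + (ω * cosC ω s) * sinCoeff hμ β ω R p f) = _
  unfold edgeSolDeriv
  ring

theorem sinC_mul_sinCoeff (hs : sinC ω edgeLen ≠ 0) (p : Fin 3 × ℤ) (f : GraphL2 t μ) :
    sinC ω edgeLen * sinCoeff hμ β ω R p f = tgtPhase β p.1 * vertexValue hμ β ω R (tgtVertex p) f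
      + (ω : ℂ)⁻¹ * (sinC ω edgeLen * cosMoment ω (source f p) edgeLen
        - cosC ω edgeLen * sinMoment ω (source f p) edgeLen)
      - cosC ω edgeLen * vertexValue hμ β ω R (srcVertex p) f := by
  change sinC ω edgeLen * ((sinC ω edgeLen)⁻¹ * _) = _
  rw [mul_inv_cancel_left₀ hs]
  rfl

theorem solution_zero (p : Fin 3 × ℤ) (f : GraphL2 t μ) :
    solution hμ β ω R p 0 f = vertexValue hμ β ω R (.inl p.2) f := by
  rw [solution_apply, edgeSol_zero]
  rfl

/-- `sinCoeff` is the coefficient for which the solution takes the prescribed value at the end of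
the edge; dividing by `sin (ω L)` requires `ω ^ 2` not to be a Dirichlet eigenvalue of the edge. -/
theorem solution_edgeLen (hs : sinC ω edgeLen ≠ 0) (p : Fin 3 × ℤ) (f : GraphL2 t μ) :
    solution hμ β ω R p edgeLen f = tgtPhase β p.1 * vertexValue hμ β ω R (tgtVertex p) f := by
  rw [solution_apply, edgeSol]
  linear_combination sinC_mul_sinCoeff hμ (β := β) (R := R) hs p f

theorem solutionDeriv_zero (p : Fin 3 × ℤ) (f : GraphL2 t μ) :
    solutionDeriv hμ β ω R p 0 f = ω * sinCoeff hμ β ω R p f := by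
  rw [solutionDeriv_apply, edgeSolDeriv_zero]

/-- The derivative at the vertex `B` in terms of the two endpoint values. By `sin² + cos² = 1` the
cosine moment drops out, hence the asymmetry between vertices `A` and `B` in `vertexSourceLin`. -/
theorem sinC_mul_solutionDeriv_edgeLen (hω : ω ≠ 0) (hs : sinC ω edgeLen ≠ 0) (p : Fin 3 × ℤ)
    (f : GraphL2 t μ) :
    sinC ω edgeLen * solutionDeriv hμ β ω R p edgeLen f = -sinMoment ω (source f p) edgeLen
      + ω * (cosC ω edgeLen * (tgtPhase β p.1 * vertexValue hμ β ω R (tgtVertex p) f)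
        - vertexValue hμ β ω R (srcVertex p) f) := by
  have hω' : (ω : ℂ) ≠ 0 := by exact_mod_cast hω
  have h1 := sinC_mul_sinCoeff hμ (β := β) (R := R) hs p f
  have h2 := sinC_sq_add_cosC_sq ω edgeLen
  have h3 : (ω : ℂ) * (ω : ℂ)⁻¹ = 1 := mul_inv_cancel₀ hω'
  rw [solutionDeriv_apply, edgeSolDeriv]
  linear_combination ω * cosC ω edgeLen * h1
    - (sinMoment ω (source f p) edgeLen + ω * vertexValue hμ β ω R (srcVertex p) f) * h2
    + cosC ω edgeLen * (sinC ω edgeLen * cosMoment ω (source f p) edgeLen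
        - cosC ω edgeLen * sinMoment ω (source f p) edgeLen) * h3

end Parametrix


/-! ### Bounds on the parametrix, and the Fredholm property in the gap -/

section ParametrixBounds

variable {t μ : ℝ} (hμ : 0 < μ) {β ω : ℝ} {R : VertexL2 →L[ℂ] VertexL2}

/-- Size of the data that determine the solution on an edge. -/
def amplitude (β ω : ℝ) (R : VertexL2 →L[ℂ] VertexL2) (f : GraphL2 t μ) (p : Fin 3 × ℤ) : ℝ :=
  ‖vertexValue hμ β ω R (srcVertex p) f‖ + ‖vertexValue hμ β ω R (tgtVertex p) f‖ + ‖f p‖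

theorem amplitude_nonneg (f : GraphL2 t μ) (p : Fin 3 × ℤ) : 0 ≤ amplitude hμ β ω R f p := by
  unfold amplitude
  positivity

theorem norm_sinCoeff_le (hω : 0 < ω) (f : GraphL2 t μ) (p : Fin 3 × ℤ) :
    ‖sinCoeff hμ β ω R p f‖ ≤ ‖(sinC ω edgeLen)⁻¹‖ * (1 + ω⁻¹ * (2 * √(edgeLen / min 1 μ)))
      * amplitude hμ β ω R f p := by
  set K := √(edgeLen / min 1 μ)
  have hK : 0 ≤ K := Real.sqrt_nonneg _
  have hω' : 0 < ω⁻¹ := inv_pos.2 hω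
  change ‖(sinC ω edgeLen)⁻¹ * (tgtPhase β p.1 * vertexValue hμ β ω R (tgtVertex p) f
    + (ω : ℂ)⁻¹ * (sinC ω edgeLen * cosMoment ω (source f p) edgeLen
      - cosC ω edgeLen * sinMoment ω (source f p) edgeLen)
    - cosC ω edgeLen * vertexValue hμ β ω R (srcVertex p) f)‖ ≤ _
  rw [norm_mul, mul_assoc]
  refine mul_le_mul_of_nonneg_left ((norm_sub_le _ _).trans
    ((add_le_add_left (norm_add_le _ _) _).trans ?_)) (norm_nonneg _)
  rw [norm_mul (tgtPhase _ _), norm_tgtPhase, one_mul, norm_mul, norm_inv, Complex.norm_real,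
    Real.norm_of_nonneg hω.le, mul_comm (cosC ω edgeLen) (vertexValue _ _ _ _ _ _),
    mul_comm (sinC ω edgeLen), mul_comm (cosC ω edgeLen)]
  have h0 := norm_mul_cosC_le (vertexValue hμ β ω R (srcVertex p) f) ω edgeLen
  have h1 := (norm_mul_sinC_le (cosMoment ω (source f p) edgeLen) ω edgeLen).trans
    (norm_cosMoment_source_le hμ ω f p edgeLen)
  have h2 := (norm_mul_cosC_le (sinMoment ω (source f p) edgeLen) ω edgeLen).trans
    (norm_sinMoment_source_le hμ ω f p edgeLen)
  have h3a := norm_sub_le (cosMoment ω (source f p) edgeLen * sinC ω edgeLen)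
    (sinMoment ω (source f p) edgeLen * cosC ω edgeLen)
  have h3 : ω⁻¹ * ‖cosMoment ω (source f p) edgeLen * sinC ω edgeLen
      - sinMoment ω (source f p) edgeLen * cosC ω edgeLen‖ ≤ ω⁻¹ * (2 * K * ‖f p‖) :=
    mul_le_mul_of_nonneg_left (by linarith) hω'.le
  have h4 : ω⁻¹ * (2 * K * ‖f p‖) ≤ ω⁻¹ * (2 * K) * amplitude hμ β ω R f p := by
    rw [← mul_assoc]
    refine mul_le_mul_of_nonneg_left ?_ (by positivity)
    unfold amplitude
    linarith [norm_nonneg (vertexValue hμ β ω R (srcVertex p) f),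
      norm_nonneg (vertexValue hμ β ω R (tgtVertex p) f)]
  have h5 : ‖vertexValue hμ β ω R (srcVertex p) f‖ + ‖vertexValue hμ β ω R (tgtVertex p) f‖
      ≤ amplitude hμ β ω R f p := by
    unfold amplitude
    linarith [norm_nonneg (f p)]
  linarith

theorem exists_solution_bound (hω : 0 < ω) : ∃ K, 0 ≤ K ∧ ∀ (f : GraphL2 t μ) (p : Fin 3 × ℤ)
    (s : ℝ), ‖solution hμ β ω R p s f‖ ≤ K * amplitude hμ β ω R f p ∧
      ‖solutionDeriv hμ β ω R p s f‖ ≤ K * amplitude hμ β ω R f p := by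
  have hω' : 0 < ω⁻¹ := inv_pos.2 hω
  obtain ⟨K, hK⟩ : ∃ K, K = √(edgeLen / min 1 μ) := ⟨_, rfl⟩
  have hK0 : 0 ≤ K := hK ▸ Real.sqrt_nonneg _
  obtain ⟨K', hK'⟩ : ∃ K', K' = ‖(sinC ω edgeLen)⁻¹‖ * (1 + ω⁻¹ * (2 * K)) := ⟨_, rfl⟩
  have hK'0 : 0 ≤ K' := by
    rw [hK']
    positivity
  refine ⟨(2 * ω⁻¹ * K + 1 + K') + (2 * K + ω + ω * K'), by positivity, fun f p s => ?_⟩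
  have h0 := amplitude_nonneg hμ (β := β) (ω := ω) (R := R) f p
  have h1 := integral_norm_source_le hμ f p
  have h2 := norm_sinCoeff_le hμ (β := β) (R := R) hω f p
  rw [← hK] at h1 h2
  rw [← hK'] at h2
  have h3 : ‖vertexValue hμ β ω R (srcVertex p) f‖ ≤ amplitude hμ β ω R f p := by
    unfold amplitude
    linarith [norm_nonneg (f p), norm_nonneg (vertexValue hμ β ω R (tgtVertex p) f)]
  have h4 : ∫ s, ‖source f p s‖ ≤ K * amplitude hμ β ω R f p := h1.trans
    (mul_le_mul_of_nonneg_left (by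
      unfold amplitude
      linarith [norm_nonneg (vertexValue hμ β ω R (srcVertex p) f),
        norm_nonneg (vertexValue hμ β ω R (tgtVertex p) f)]) hK0)
  generalize amplitude hμ β ω R f p = A at *
  rw [solution_apply, solutionDeriv_apply]
  constructor
  · refine (norm_edgeSol_le hω (integrable_source hμ f p) _ _ _).trans ?_
    have h5 : 2 * ω⁻¹ * (∫ s, ‖source f p s‖) ≤ 2 * ω⁻¹ * (K * A) :=
      mul_le_mul_of_nonneg_left h4 (by positivity)
    have h6 : 0 ≤ (2 * K + ω + ω * K') * A := by positivity
    linarith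
  · refine (norm_edgeSolDeriv_le hω (integrable_source hμ f p) _ _ _).trans ?_
    have h5 : ω * ‖sinCoeff hμ β ω R p f‖ ≤ ω * (K' * A) := mul_le_mul_of_nonneg_left h2 hω.le
    have h6 : 0 ≤ (2 * ω⁻¹ * K + 1 + K') * A := by positivity
    have h7 : ω * ‖vertexValue hμ β ω R (srcVertex p) f‖ ≤ ω * A :=
      mul_le_mul_of_nonneg_left h3 hω.le
    linarith

theorem exists_amplitude_bound (β ω : ℝ) (R : VertexL2 →L[ℂ] VertexL2) :
    ∃ K, 0 ≤ K ∧ ∀ (f : GraphL2 t μ) (s : Finset (Fin 3 × ℤ)),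
      ∑ p ∈ s, amplitude hμ β ω R f p ^ 2 ≤ (K * ‖f‖) ^ 2 := by
  set N := ‖R ∘L vertexSource hμ β ω‖
  have hN : 0 ≤ N := norm_nonneg _
  refine ⟨5 * (N + 1), by positivity, fun f s => ?_⟩
  set x := R (vertexSource hμ β ω f)
  have hx : ‖x‖ ≤ N * ‖f‖ := (R ∘L vertexSource hμ β ω).le_opNorm f
  have h1 : ∑ p ∈ s, ‖x (srcVertex p)‖ ^ 2 ≤ 3 * ‖x‖ ^ 2 := by
    simpa using sum_comp_le_card_mul_norm_sq Prod.fst (fun p q h => by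
      simp only [srcVertex, Prod.mk.injEq, Sum.inl.injEq] at h
      exact Prod.ext h.1 h.2) x s
  have h2 : ∑ p ∈ s, ‖x (tgtVertex p)‖ ^ 2 ≤ 3 * ‖x‖ ^ 2 := by
    simpa using sum_comp_le_card_mul_norm_sq Prod.fst (fun p q h => by
      simp only [tgtVertex, Prod.mk.injEq, Sum.inr.injEq] at h
      obtain ⟨h3, h4⟩ := h
      rw [h3] at h4
      refine Prod.ext h3 ?_
      split_ifs at h4
      exacts [h4, by omega]) x s
  have h3 : ∑ p ∈ s, ‖f p‖ ^ 2 ≤ ‖f‖ ^ 2 := sum_comp_le_norm_sq Function.injective_id f s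
  calc ∑ p ∈ s, amplitude hμ β ω R f p ^ 2
      ≤ ∑ p ∈ s, 3 * (‖x (srcVertex p)‖ ^ 2 + ‖x (tgtVertex p)‖ ^ 2 + ‖f p‖ ^ 2) := by
        refine Finset.sum_le_sum fun p _ => ?_
        change (‖x (srcVertex p)‖ + ‖x (tgtVertex p)‖ + ‖f p‖) ^ 2 ≤ _
        nlinarith [sq_nonneg (‖x (srcVertex p)‖ - ‖x (tgtVertex p)‖),
          sq_nonneg (‖x (srcVertex p)‖ - ‖f p‖), sq_nonneg (‖x (tgtVertex p)‖ - ‖f p‖)]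
    _ ≤ 3 * (3 * ‖x‖ ^ 2 + 3 * ‖x‖ ^ 2 + ‖f‖ ^ 2) := by
        rw [← Finset.mul_sum, Finset.sum_add_distrib, Finset.sum_add_distrib]
        linarith
    -- Each vertex belongs to three edges, so the factor is `3 * (6 * N ^ 2 + 1)`, which is at most
    -- `25 * (N + 1) ^ 2`.
    _ ≤ (5 * (N + 1) * ‖f‖) ^ 2 := by
        have h4 : ‖x‖ ^ 2 ≤ (N * ‖f‖) ^ 2 := pow_le_pow_left₀ (norm_nonneg _) hx 2
        have h5 := mul_nonneg hN (sq_nonneg ‖f‖)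
        nlinarith [sq_nonneg ‖f‖, sq_nonneg (N * ‖f‖)]

theorem memLp_solution (hω : 0 < ω) (f : GraphL2 t μ) (p : Fin 3 × ℤ) :
    MemLp (fun s => solution hμ β ω R p s f) 2 (edgeMeasure t μ p) := by
  obtain ⟨K, -, hK⟩ := exists_solution_bound (t := t) hμ (β := β) (R := R) hω
  have hc : Continuous fun s => solution hμ β ω R p s f := by
    simp only [solution_apply]
    exact continuous_edgeSol (integrable_source hμ f p) _ _
  exact MemLp.of_bound hc.aestronglyMeasurable _ (ae_of_all _ fun s => (hK f p s).1)

def solutionLin (hω : 0 < ω) (β : ℝ) (R : VertexL2 →L[ℂ] VertexL2) :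
    GraphL2 t μ →ₗ[ℂ] (∀ p, Lp ℂ 2 (edgeMeasure t μ p)) where
  toFun f p := (memLp_solution hμ (β := β) (R := R) hω f p).toLp _
  map_add' f g := by
    funext p
    refine (MemLp.toLp_congr _ ((memLp_solution hμ hω f p).add (memLp_solution hμ hω g p))
      (ae_of_all _ fun s => ?_)).trans (MemLp.toLp_add _ _)
    simp
  map_smul' c f := by
    funext p
    refine (MemLp.toLp_congr _ ((memLp_solution hμ hω f p).const_smul c)
      (ae_of_all _ fun s => ?_)).trans (MemLp.toLp_const_smul c _)
    simp

theorem exists_solutionLin_bound (hω : 0 < ω) : ∃ K, 0 ≤ K ∧ ∀ (f : GraphL2 t μ)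
    (s : Finset (Fin 3 × ℤ)), ∑ p ∈ s, ‖solutionLin hμ hω β R f p‖ ^ 2 ≤ (K * ‖f‖) ^ 2 := by
  obtain ⟨K, hK0, hK⟩ := exists_solution_bound (t := t) hμ (β := β) (R := R) hω
  obtain ⟨K', hK'0, hK'⟩ := exists_amplitude_bound (t := t) hμ β ω R
  have hL := edgeLen_pos
  have hm : 0 < max 1 μ := lt_max_of_lt_left one_pos
  refine ⟨√(max 1 μ * edgeLen) * K * K', by positivity, fun f s => ?_⟩
  calc ∑ p ∈ s, ‖solutionLin hμ hω β R f p‖ ^ 2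
      ≤ ∑ p ∈ s, max 1 μ * edgeLen * K ^ 2 * amplitude hμ β ω R f p ^ 2 := by
        refine Finset.sum_le_sum fun p _ => ?_
        refine (norm_toLp_sq_le hμ (memLp_solution hμ hω f p) fun s => (hK f p s).1).trans_eq ?_
        ring
    _ ≤ max 1 μ * edgeLen * K ^ 2 * (K' * ‖f‖) ^ 2 := by
        rw [← Finset.mul_sum]
        exact mul_le_mul_of_nonneg_left (hK' f s) (by positivity)
    _ = _ := by
        rw [mul_assoc (√_), mul_assoc (√_), mul_pow (√_), Real.sq_sqrt (by positivity)]
        ring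

/-- One term of the `ℓ²` bound on the amplitudes. It makes the Cauchy data of the solution at a node
continuous functionals of `f`. -/
theorem exists_pointwise_bound (hω : 0 < ω) : ∃ K, ∀ (f : GraphL2 t μ) (p : Fin 3 × ℤ)
    (s : ℝ), ‖solution hμ β ω R p s f‖ ≤ K * ‖f‖ ∧ ‖solutionDeriv hμ β ω R p s f‖ ≤ K * ‖f‖ := by
  obtain ⟨K, hK0, hK⟩ := exists_solution_bound (t := t) hμ (β := β) (R := R) hω
  obtain ⟨K', hK'0, hK'⟩ := exists_amplitude_bound (t := t) hμ β ω R
  refine ⟨K * K', fun f p s => ?_⟩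
  have h1 : amplitude hμ β ω R f p ≤ K' * ‖f‖ :=
    le_of_sq_le_sq (by simpa using hK' f {p}) (by positivity)
  rw [mul_assoc]
  have h2 := mul_le_mul_of_nonneg_left h1 hK0
  exact ⟨(hK f p s).1.trans h2, (hK f p s).2.trans h2⟩

/-- Continuity is built in, since the endpoint values on every edge are the vertex values up to the
phase. The discrete equations `hR` are the Kirchhoff conditions multiplied by `sin (ω L) / ω`.
Summability follows from the `ℓ²` bound on the amplitudes. -/
theorem isProfile_solution (hω : 0 < ω) (hs : sinC ω edgeLen ≠ 0)
    (hR : ∀ F, ∀ k : ℤ,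
      3 * cosC ω edgeLen * R F (.inl k) - R F (.inr k)
        - (1 + (multiplier β)⁻¹) * R F (.inr (k + 1)) = F (.inl k) ∧
      3 * cosC ω edgeLen * R F (.inr k) - R F (.inl k)
        - (1 + multiplier β) * R F (.inl (k - 1)) = F (.inr k))
    (f : GraphL2 t μ)
    (hf : ∀ j i k, k = -1 ∨ k = 0 → solution hμ β ω R (j, k) (nodeParam t j i) f = 0 ∧
      solutionDeriv hμ β ω R (j, k) (nodeParam t j i) f = 0) :
    IsProfile t β (fun p s => solution hμ β ω R p s f) (fun p s => solutionDeriv hμ β ω R p s f)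
      (fun p s => -(ω : ℂ) ^ 2 * solution hμ β ω R p s f - source f p s) := by
  have hθ := multiplier_ne_zero β
  have hω' : (ω : ℂ) ≠ 0 := by exact_mod_cast hω.ne'
  have hc : ∀ p, Continuous fun s => solution hμ β ω R p s f := fun p => by
    simp only [solution_apply]
    exact continuous_edgeSol (integrable_source hμ f p) _ _
  have hc' : ∀ p, Continuous fun s => solutionDeriv hμ β ω R p s f := fun p => by
    simp only [solutionDeriv_apply]
    exact continuous_edgeSolDeriv (integrable_source hμ f p) _ _
  obtain ⟨K, hK0, hK⟩ := exists_solution_bound (t := t) hμ (β := β) (R := R) hω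
  have hmem : ∀ p, MemLp (fun s => -(ω : ℂ) ^ 2 * solution hμ β ω R p s f - source f p s) 2
      (volume.restrict (Ioo 0 edgeLen)) := fun p =>
    MemLp.sub (MemLp.of_bound (by fun_prop) (ω ^ 2 * (K * amplitude hμ β ω R f p))
      (ae_of_all _ fun s => by
        rw [norm_mul, norm_neg, norm_pow, Complex.norm_real, Real.norm_of_nonneg hω.le]
        exact mul_le_mul_of_nonneg_left (hK f p s).1 (by positivity)))
      ((memLp_source hμ f p).restrict _)
  have hval : ∀ v, R (vertexSource hμ β ω f) v = vertexValue hμ β ω R v f := fun v => rfl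
  refine ⟨hmem, fun p => (hc p).continuousOn, fun p => (hc' p).continuousOn, fun p a _ b _ => ?_,
    fun p a _ b _ => ?_, ?_, fun k _ => ?_, fun k _ => ?_, fun k _ => ?_, fun k _ => ?_, hf⟩
  · simp only [solution_apply, solutionDeriv_apply]
    exact integral_edgeSolDeriv hω.ne' (integrable_source hμ f p) _ _ _ _
  · simp only [solution_apply, solutionDeriv_apply]
    exact integral_edgeSolDeriv2 hω.ne' (integrable_source hμ f p) _ _ _ _
  · obtain ⟨K', hK'0, hK'⟩ := exists_amplitude_bound (t := t) hμ β ω R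
    have hL := edgeLen_pos
    have hm : 0 < min 1 μ := lt_min one_pos hμ
    have hsum : Summable fun p => amplitude hμ β ω R f p ^ 2 :=
      summable_of_sum_le (fun p => by positivity) (hK' f)
    -- With `A` the amplitude on the edge, `u` and `u'` contribute `2 K² A²`, and `‖u''‖² ≤ 2 ω⁴ K²
    -- A² + 2 ‖source‖²`; the last term is integrated with the lower bound `min 1 μ` of the weights.
    refine Summable.of_nonneg_of_le (fun p => integral_nonneg fun s => by positivity) (fun p => ?_)
      (hsum.mul_left ((2 + 2 * ω ^ 4) * K ^ 2 * edgeLen + 2 * (min 1 μ)⁻¹))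
    set A := amplitude hμ β ω R f p with hA
    have hsrc : Integrable fun s => ‖source f p s‖ ^ 2 :=
      (memLp_source hμ f p).integrable_norm_pow (by norm_num)
    have h1 : ∫ s, ‖source f p s‖ ^ 2 ≤ (min 1 μ)⁻¹ * A ^ 2 := by
      rw [integral_norm_source_sq]
      have h2 := norm_sq_component hμ f p
      have h3 : 0 ≤ ∫ s in part t (rep p), ‖f p s‖ ^ 2 := integral_nonneg fun s => by positivity
      have h4 : ‖f p‖ ^ 2 ≤ A ^ 2 := by
        refine pow_le_pow_left₀ (norm_nonneg _) ?_ 2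
        rw [hA, amplitude]
        linarith [norm_nonneg (vertexValue hμ β ω R (srcVertex p) f),
          norm_nonneg (vertexValue hμ β ω R (tgtVertex p) f)]
      rw [← div_eq_inv_mul, le_div_iff₀ hm, mul_comm]
      exact (mul_le_mul_of_nonneg_right (min_le_weight μ (rep p)) h3).trans (h2.symm.le.trans h4)
    calc _ ≤ ∫ s in Ioo 0 edgeLen, ((2 + 2 * ω ^ 4) * K ^ 2 * A ^ 2 + 2 * ‖source f p s‖ ^ 2) := by
          refine integral_mono_of_nonneg (ae_of_all _ fun s => by positivity)
            ((integrable_const _).add (hsrc.restrict.const_mul _)) (ae_of_all _ fun s => ?_)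
          have h2 := pow_le_pow_left₀ (norm_nonneg _) (hK f p s).1 2
          have h3 := pow_le_pow_left₀ (norm_nonneg _) (hK f p s).2 2
          have h4 := sq_norm_add_le (-(ω : ℂ) ^ 2 * solution hμ β ω R p s f) (-source f p s)
          rw [← sub_eq_add_neg, norm_neg, norm_mul, norm_neg, norm_pow, Complex.norm_real,
            Real.norm_of_nonneg hω.le, mul_pow] at h4
          have h5 : (ω ^ 2) ^ 2 * ‖solution hμ β ω R p s f‖ ^ 2 ≤ (ω ^ 2) ^ 2 * (K * A) ^ 2 :=
            mul_le_mul_of_nonneg_left h2 (by positivity)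
          simp only
          nlinarith
      _ = (2 + 2 * ω ^ 4) * K ^ 2 * edgeLen * A ^ 2
          + 2 * ∫ s in Ioo 0 edgeLen, ‖source f p s‖ ^ 2 := by
          rw [integral_add (integrable_const _) (hsrc.restrict.const_mul _),
            integral_const_mul 2 fun s => ‖source f p s‖ ^ 2, integral_const]
          simp [hL.le]
          ring
      _ ≤ _ := by
          have h2 := setIntegral_le_integral (s := Ioo 0 edgeLen) hsrc
            (ae_of_all _ fun s => by positivity)
          linarith
  · simp only [solution_zero]
    exact ⟨trivial, trivial⟩
  · simp only [solution_edgeLen hμ hs]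
    simp [tgtPhase, tgtVertex, hθ]
  · obtain ⟨h1, -⟩ := hR (vertexSource hμ β ω f) k
    have h2 : vertexSource hμ β ω f (.inl k) = (ω : ℂ)⁻¹ * ∑ j : Fin 3,
        (sinC ω edgeLen * cosMoment ω (source f (j, k)) edgeLen
          - cosC ω edgeLen * sinMoment ω (source f (j, k)) edgeLen) := by
      change (ω : ℂ)⁻¹ * (∑ j : Fin 3, (sinC ω edgeLen • cosFunctional hμ ω (j, k) edgeLen
        - cosC ω edgeLen • sinFunctional hμ ω (j, k) edgeLen) : GraphL2 t μ →ₗ[ℂ] ℂ) f = _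
      rw [LinearMap.sum_apply]
      rfl
    rw [h2, Fin.sum_univ_three] at h1
    simp only [hval] at h1
    simp only [solutionDeriv_zero]
    have e0 := sinC_mul_sinCoeff hμ (β := β) (R := R) hs (0, k) f
    have e1 := sinC_mul_sinCoeff hμ (β := β) (R := R) hs (1, k) f
    have e2 := sinC_mul_sinCoeff hμ (β := β) (R := R) hs (2, k) f
    simp only [tgtPhase, tgtVertex, srcVertex, if_true, if_false, Fin.reduceEq] at e0 e1 e2
    -- Multiplication by `sin (ω L)` turns the derivatives at `A` into the vertex values and the
    -- moments that enter the discrete equation.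
    refine mul_left_cancel₀ hs ?_
    rw [mul_zero]
    linear_combination (ω : ℂ) * (e0 + e1 + e2) - ω * h1
  · obtain ⟨-, h1⟩ := hR (vertexSource hμ β ω f) k
    have h2 : vertexSource hμ β ω f (.inr k) = (ω : ℂ)⁻¹ *
        (sinMoment ω (source f (0, k)) edgeLen
          + multiplier β * sinMoment ω (source f (1, k - 1)) edgeLen
          + sinMoment ω (source f (2, k - 1)) edgeLen) := rfl
    rw [h2] at h1
    simp only [hval] at h1
    have e0 := sinC_mul_solutionDeriv_edgeLen hμ (β := β) (R := R) hω.ne' hs (0, k) f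
    have e1 := sinC_mul_solutionDeriv_edgeLen hμ (β := β) (R := R) hω.ne' hs (1, k - 1) f
    have e2 := sinC_mul_solutionDeriv_edgeLen hμ (β := β) (R := R) hω.ne' hs (2, k - 1) f
    simp only [tgtPhase, tgtVertex, srcVertex, if_true, if_false, Fin.reduceEq, sub_add_cancel]
      at e0 e1 e2
    refine mul_left_cancel₀ hs ?_
    rw [mul_zero]
    have h3 : (ω : ℂ) * (ω : ℂ)⁻¹ = 1 := mul_inv_cancel₀ hω'
    have h4 : multiplier β * (multiplier β)⁻¹ = 1 := mul_inv_cancel₀ hθ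
    linear_combination e0 + multiplier β * e1 + e2 + ω * h1
      + (sinMoment ω (source f (0, k)) edgeLen
          + multiplier β * sinMoment ω (source f (1, k - 1)) edgeLen
          + sinMoment ω (source f (2, k - 1)) edgeLen) * h3
      + ω * cosC ω edgeLen * vertexValue hμ β ω R (.inr k) f * h4

/-- In the gap, an operator with a finite dimensional kernel is Fredholm. -/
theorem isFredholm_of_abs_cos_lt {t μ : ℝ} (hμ : 0 < μ) {β ω : ℝ} (ht : t ∈ Icc 0 (2 * edgeLen))
    (bc : BoundaryType) (hω : 0 < ω)
    (hs : sinC ω edgeLen ≠ 0)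
    (hgap : |3 * Real.cos (ω * edgeLen)| < |1 - ‖1 + (multiplier β)⁻¹‖|)
    [FiniteDimensional ℂ (shifted (limitOperator bc t μ β) ((ω ^ 2 : ℝ) : ℂ)).ker] :
    (shifted (limitOperator bc t μ β) ((ω ^ 2 : ℝ) : ℂ)).IsFredholm := by
  obtain ⟨R, hR⟩ := exists_vertex_resolvent hgap
  have hconj : starRingEnd ℂ (1 + (multiplier β)⁻¹) = 1 + multiplier β := by
    rw [map_add, map_one, Complex.inv_eq_conj (norm_multiplier β), Complex.conj_conj]
  have hcos : ((3 * Real.cos (ω * edgeLen) : ℝ) : ℂ) = 3 * cosC ω edgeLen := by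
    simp [cosC]
  rw [hconj, hcos] at hR
  obtain ⟨K, hK0, hK⟩ := exists_solutionLin_bound (t := t) hμ (β := β) (R := R) hω
  obtain ⟨K', hK'⟩ := exists_pointwise_bound (t := t) hμ (β := β) (R := R) hω
  let S : GraphL2 t μ →L[ℂ] GraphL2 t μ := toLittleL2 (solutionLin hμ hω β R) K hK0 hK
  -- The Cauchy data at the nodes of the layers `0` and `-1`. A cut parameter may fall outside `[0,
  -- L]`, and some edges are listed although they are never cut: this only adds finitely many
  -- conditions, which is harmless since the solution is defined for all real `s`.
  let Φ : GraphL2 t μ →L[ℂ] (Fin 3 × Fin 3 × Fin 2 → ℂ × ℂ) := ContinuousLinearMap.pi fun q =>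
    ((solution hμ β ω R (q.1, -(q.2.2 : ℤ)) (nodeParam t q.1 q.2.1)).mkContinuous K'
      fun f => (hK' f _ _).1).prod
    ((solutionDeriv hμ β ω R (q.1, -(q.2.2 : ℤ)) (nodeParam t q.1 q.2.1)).mkContinuous K'
      fun f => (hK' f _ _).2)
  refine isFredholm_of_parametrix _ _ S Φ fun f hf => ?_
  have hf' : ∀ j i k, k = -1 ∨ k = 0 → solution hμ β ω R (j, k) (nodeParam t j i) f = 0 ∧
      solutionDeriv hμ β ω R (j, k) (nodeParam t j i) f = 0 := by
    rintro j i k (rfl | rfl)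
    · exact Prod.ext_iff.1 (congrFun hf (j, i, 1))
    · exact Prod.ext_iff.1 (congrFun hf (j, i, 0))
  have hS : ∀ p, S f p =ᵐ[edgeMeasure t μ p] fun s => solution hμ β ω R p s f := fun p =>
    (memLp_solution hμ hω f p).coeFn_toLp
  refine (isProfile_solution hμ hω hs hR f hf').mem_limitGraph ht bc hS fun p => ?_
  -- On the truncated edge the extension by zero is `f` itself, so the restricted solution satisfies
  -- the original equation there.
  have hae : f p =ᵐ[edgeMeasure t μ p] source f p := by
    refine Measure.ae_smul_measure ?_ _
    exact (indicator_ae_eq_restrict (isOpen_part t (rep p)).measurableSet).symm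
  rw [lp.coeFn_add, lp.coeFn_smul]
  filter_upwards [hS p, hae, Lp.coeFn_add (f p) (((ω ^ 2 : ℝ) : ℂ) • S f p),
    Lp.coeFn_smul ((ω ^ 2 : ℝ) : ℂ) (S f p)] with s h1 h2 h3 h4
  simp only [Pi.add_apply, Pi.smul_apply] at h3 h4 ⊢
  rw [h3, h4, h1, h2]
  simp only [smul_eq_mul]
  push_cast
  ring

end ParametrixBounds


/-! ### The kernel -/

section Kernel

variable {t μ β ω : ℝ} {u u' u'' : Edge → ℝ → ℂ}

theorem hasDerivAt_of_primitive {e : Edge} {f g : ℝ → ℂ}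
    (hg : ContinuousOn g (closure (part t e)))
    (h : ∀ a ∈ closure (part t e), ∀ b ∈ closure (part t e), f b - f a = ∫ s in a..b, g s)
    {s : ℝ} (hs : s ∈ part t e) : HasDerivAt f (g s) s := by
  have hs' : s ∈ closure (part t e) := subset_closure hs
  have hg' : ContinuousOn g (part t e) := hg.mono subset_closure
  have h1 : HasDerivAt (fun x => f s + ∫ r in s..x, g r) (g s) s :=
    (intervalIntegral.integral_hasDerivAt_right (by simp)
      (hg'.stronglyMeasurableAtFilter (isOpen_part t e) s hs)
      (hg'.continuousAt ((isOpen_part t e).mem_nhds hs))).const_add _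
  refine h1.congr_of_eventuallyEq ?_
  filter_upwards [(isOpen_part t e).mem_nhds hs] with x hx
  rw [← h s hs' x (subset_closure hx)]
  ring

theorem IsH2.deriv_eq_zero (h : IsH2 t β u u' u'') {e : Edge} (h0 : EqOn (u e) 0 (part t e)) :
    EqOn (u' e) 0 (closure (part t e)) := by
  refine EqOn.of_subset_closure (s := part t e) (fun s hs => ?_) (h.continuousOn1 e)
    continuousOn_const subset_closure subset_rfl
  refine (hasDerivAt_of_primitive (h.continuousOn1 e) (h.integral_deriv e) hs).unique
    ((hasDerivAt_const s (0 : ℂ)).congr_of_eventuallyEq ?_)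
  filter_upwards [(isOpen_part t e).mem_nhds hs] with x hx using h0 hx

/-- Solutions of the homogeneous equation on an edge. -/
theorem IsH2.exists_eq_cos_sin (h : IsH2 t β u u' u'') (hω : ω ≠ 0) {e : Edge}
    (he : u'' e =ᵐ[volume.restrict (part t e)] fun s => -(ω : ℂ) ^ 2 * u e s) :
    ∃ C D : ℂ, ∀ s ∈ closure (part t e), u e s = C * cosC ω s + D * sinC ω s ∧
      u' e s = ω * (D * cosC ω s - C * sinC ω s) := by
  have hω' : (ω : ℂ) ≠ 0 := by exact_mod_cast hω
  rcases (part t e).eq_empty_or_nonempty with hE | ⟨a, ha⟩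
  · exact ⟨0, 0, fun s hs => by simp [hE] at hs⟩
  have hc : ContinuousOn (fun s => -(ω : ℂ) ^ 2 * u e s) (closure (part t e)) :=
    continuousOn_const.mul (h.continuousOn0 e)
  have d1 := fun s (hs : s ∈ part t e) =>
    hasDerivAt_of_primitive (h.continuousOn1 e) (h.integral_deriv e) hs
  have d2 : ∀ s ∈ part t e, HasDerivAt (u' e) (-(ω : ℂ) ^ 2 * u e s) s := fun s hs => by
    refine hasDerivAt_of_primitive hc (fun a ha b hb => ?_) hs
    rw [h.integral_deriv2 e a ha b hb]
    refine intervalIntegral.integral_congr_ae ?_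
    rw [Filter.EventuallyEq, ae_restrict_iff' (isOpen_part t e).measurableSet] at he
    filter_upwards [uIoc_subset_part ha hb, he] with r hr hr' hr'' using hr' (hr hr'')
  -- The vector `(u, u' / ω)` rotates with angle `ω s`. `P` and `Q` are its components rotated back,
  -- hence constants of motion, and they are the two coefficients.
  have hP : ∀ s ∈ part t e, HasDerivAt (u e * cosC ω - fun s => (ω : ℂ)⁻¹ * (u' e * sinC ω) s) 0 s :=
    fun s hs => (((d1 s hs).mul (hasDerivAt_cosC ω s)).sub
      (((d2 s hs).mul (hasDerivAt_sinC ω s)).const_mul _)).congr_deriv (by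
        field_simp
        ring)
  have hQ : ∀ s ∈ part t e, HasDerivAt (u e * sinC ω + fun s => (ω : ℂ)⁻¹ * (u' e * cosC ω) s) 0 s :=
    fun s hs => (((d1 s hs).mul (hasDerivAt_sinC ω s)).add
      (((d2 s hs).mul (hasDerivAt_cosC ω s)).const_mul _)).congr_deriv (by
        field_simp
        ring)
  set P := u e * cosC ω - fun s => (ω : ℂ)⁻¹ * (u' e * sinC ω) s with hPdef
  set Q := u e * sinC ω + fun s => (ω : ℂ)⁻¹ * (u' e * cosC ω) s with hQdef
  have c0 := h.continuousOn0 e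
  have c1 := h.continuousOn1 e
  have c2 := (continuous_cosC ω).continuousOn (s := closure (part t e))
  have c3 := (continuous_sinC ω).continuousOn (s := closure (part t e))
  have hPc : EqOn P (fun _ => P a) (closure (part t e)) := by
    refine EqOn.of_subset_closure (s := part t e) (fun s hs => ?_)
      ((c0.mul c2).sub (continuousOn_const.mul (c1.mul c3))) continuousOn_const subset_closure
      subset_rfl
    exact (isOpen_part t e).is_const_of_deriv_eq_zero (convex_part t e).isPreconnected
      (fun s hs => (hP s hs).differentiableAt.differentiableWithinAt)
      (fun s hs => (hP s hs).deriv) hs ha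
  have hQc : EqOn Q (fun _ => Q a) (closure (part t e)) := by
    refine EqOn.of_subset_closure (s := part t e) (fun s hs => ?_)
      ((c0.mul c3).add (continuousOn_const.mul (c1.mul c2))) continuousOn_const subset_closure
      subset_rfl
    exact (isOpen_part t e).is_const_of_deriv_eq_zero (convex_part t e).isPreconnected
      (fun s hs => (hQ s hs).differentiableAt.differentiableWithinAt)
      (fun s hs => (hQ s hs).deriv) hs ha
  refine ⟨P a, Q a, fun s hs => ?_⟩
  have h1 := hPc hs
  have h2 := hQc hs
  have h3 := sinC_sq_add_cosC_sq ω s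
  have h4 : (ω : ℂ) * (ω : ℂ)⁻¹ = 1 := mul_inv_cancel₀ hω'
  generalize P a = p at *
  generalize Q a = q at *
  simp only [hPdef, hQdef, Pi.sub_apply, Pi.add_apply, Pi.mul_apply] at h1 h2
  constructor
  · linear_combination cosC ω s * h1 + sinC ω s * h2 - u e s * h3
  · linear_combination ω * cosC ω s * h2 - ω * sinC ω s * h1 - u' e s * h3
      - u' e s * (sinC ω s ^ 2 + cosC ω s ^ 2) * h4

theorem cut_lt_pos_fst (ht : t ≤ 2 * edgeLen) {M : Vertex} (hM : 1 ≤ M.index) :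
    cut t < M.pos.1 := by
  have hL := edgeLen_pos
  have hc := cut_le ht
  have h1 : (1 : ℝ) ≤ M.index := by exact_mod_cast hM
  cases M <;>
  · simp only [Vertex.index] at h1
    push_cast at h1
    simp only [Vertex.pos, vec₁, vec₂, Prod.fst_add, Prod.smul_fst, smul_eq_mul, sqrt_three_eq]
    nlinarith

theorem kirchhoff_sum_edges (ht : t ≤ 2 * edgeLen) {M : Vertex} (hM : 1 ≤ M.index)
    (h : Kirchhoff t μ u' M) : ∑ e ∈ M.edges, u' e M.param = 0 := by
  rw [← h, adjacent_eq_edges ht hM]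
  refine Finset.sum_congr rfl fun e he => ?_
  rw [weight_eq_one μ (index_nonneg_of_mem_edges hM he)]
  simp

theorem closure_part_of_index_pos (ht : t ≤ 2 * edgeLen) {e : Edge} (he : 1 ≤ e.index) :
    closure (part t e) = Icc 0 edgeLen := by
  rw [part_eq_Ioo ht (by omega) fun _ => he, closure_Ioo edgeLen_pos.ne]

/-- A solution of the homogeneous equation that vanishes on a layer vanishes on the next one. -/
theorem IsH2.eq_zero_succ (ht : t ≤ 2 * edgeLen) (h : IsH2 t β u u' u'')
    (hK : ∀ M : Vertex, cut t < M.pos.1 → Kirchhoff t μ u' M)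
    (hω : ω ≠ 0) (hs : sinC ω edgeLen ≠ 0) (hθ : 1 + multiplier β ≠ 0)
    (he : ∀ p : Fin 3 × ℤ, u'' (rep p) =ᵐ[volume.restrict (part t (rep p))]
      fun s => -(ω : ℂ) ^ 2 * u (rep p) s)
    {k : ℤ} (hk : 1 ≤ k) (h0 : ∀ j, EqOn (u (rep (j, k))) 0 (Icc 0 edgeLen)) :
    ∀ j, EqOn (u (rep (j, k + 1))) 0 (Icc 0 edgeLen) := by
  have hω' : (ω : ℂ) ≠ 0 := by exact_mod_cast hω
  have hL := edgeLen_pos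
  have m0 : (0 : ℝ) ∈ Icc 0 edgeLen := ⟨le_rfl, hL.le⟩
  have m1 : edgeLen ∈ Icc 0 edgeLen := ⟨hL.le, le_rfl⟩
  have cl : ∀ {e : Edge}, 1 ≤ e.index → closure (part t e) = Icc 0 edgeLen := fun h =>
    closure_part_of_index_pos ht h
  have hir : ∀ j l, (rep (j, l)).index = l := fun j l => by simp [rep, Edge.index]
  have hcont : ∀ M : Vertex, 1 ≤ M.index → ∀ e ∈ M.edges, ∀ e' ∈ M.edges,
      u e M.param = u e' M.param := fun M hM => by
    have := h.continuous_vertex M (cut_lt_pos_fst ht hM).le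
    rwa [adjacent_eq_edges ht hM] at this
  have hkir : ∀ M : Vertex, 1 ≤ M.index → ∑ e ∈ M.edges, u' e M.param = 0 := fun M hM =>
    kirchhoff_sum_edges ht hM (hK M (cut_lt_pos_fst ht hM))
  have hd : ∀ e : Edge, 1 ≤ e.index → EqOn (u e) 0 (Icc 0 edgeLen) →
      EqOn (u' e) 0 (Icc 0 edgeLen) := fun e he h1 => by
    rw [← cl he]
    refine h.deriv_eq_zero (h1.mono ?_)
    rw [← cl he]
    exact subset_closure
  have hup : ∀ l, (rep (1, l)).up = ((1, -1, l + 1) : Edge) := fun l => by simp [rep, Edge.up]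
  have hq : ∀ l, 1 ≤ l → ∀ s ∈ Icc 0 edgeLen,
      u (1, -1, l + 1) s = multiplier β * u (rep (1, l)) s := fun l hl s hs => by
    have := h.quasiperiodic (rep (1, l)) s (by rwa [cl (by rwa [hir])])
    rwa [hup] at this
  have iB : 1 ≤ (Vertex.B 0 (k + 1)).index := by
    simp only [Vertex.index]
    omega
  have iA : 1 ≤ (Vertex.A 0 (k + 1)).index := by
    simp only [Vertex.index]
    omega
  have iB' : 1 ≤ (Vertex.B 0 (k + 2)).index := by
    simp only [Vertex.index]
    omega
  obtain ⟨C₀, D₀, e0⟩ := h.exists_eq_cos_sin hω (he (0, k + 1))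
  obtain ⟨C₁, D₁, e1⟩ := h.exists_eq_cos_sin hω (he (1, k + 1))
  obtain ⟨C₂, D₂, e2⟩ := h.exists_eq_cos_sin hω (he (2, k + 1))
  rw [cl (by rw [hir]; omega)] at e0 e1 e2
  -- the vertex between the layers
  have v1 := hcont _ iB (0, 0, k + 1) (by simp [Vertex.edges]) (2, 0, k) (by simp [Vertex.edges])
  have v2 := hkir _ iB
  simp only [Vertex.edges, Vertex.param] at v1 v2
  rw [Finset.sum_insert (by simp), Finset.sum_insert (by simp), Finset.sum_singleton] at v2
  rw [show (2, (0 : ℤ), k) = rep (2, k) from rfl, h0 2 m1] at v1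
  rw [show (2, (0 : ℤ), k + 1 - 1) = rep (2, k) by simp [rep],
    hd _ (by rwa [hir]) (h0 2) m1, show (0 : ℤ) - 1 = -1 by ring,
    -- This edge is not a representative: it is the translate by `e_y` of `rep (1, k)`, where the
    -- solution vanishes by assumption.
    hd (1, -1, k + 1) (by simp [Edge.index, hk]) (fun s hs => by
      rw [hq k hk s hs, h0 1 hs]
      simp) m1] at v2
  have v3 := (e0 _ m1).1
  have v4 := (e0 _ m1).2
  rw [show u (rep (0, k + 1)) edgeLen = 0 from v1] at v3
  have v2' : u' (0, 0, k + 1) edgeLen = 0 := by simpa using v2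
  rw [show u' (rep (0, k + 1)) edgeLen = 0 from v2'] at v4
  have v4' : D₀ * cosC ω edgeLen - C₀ * sinC ω edgeLen = 0 := by
    simpa [hω'] using v4.symm
  have h3 := sinC_sq_add_cosC_sq ω edgeLen
  have hC₀ : C₀ = 0 := by
    linear_combination -cosC ω edgeLen * v3 - sinC ω edgeLen * v4' - C₀ * h3
  have hD₀ : D₀ = 0 := by
    linear_combination -sinC ω edgeLen * v3 + cosC ω edgeLen * v4' - D₀ * h3
  have z0 : EqOn (u (rep (0, k + 1))) 0 (Icc 0 edgeLen) := fun s hs => by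
    simp [(e0 s hs).1, hC₀, hD₀]
  -- the vertex inside the layer
  have w1 := hcont _ iA (1, 0, k + 1) (by simp [Vertex.edges]) (0, 0, k + 1) (by simp [Vertex.edges])
  have w2 := hcont _ iA (2, 0, k + 1) (by simp [Vertex.edges]) (0, 0, k + 1) (by simp [Vertex.edges])
  have w3 := hkir _ iA
  simp only [Vertex.edges, Vertex.param] at w1 w2 w3
  rw [Finset.sum_insert (by simp), Finset.sum_insert (by simp), Finset.sum_singleton] at w3
  change u (rep (1, k + 1)) 0 = u (rep (0, k + 1)) 0 at w1
  change u (rep (2, k + 1)) 0 = u (rep (0, k + 1)) 0 at w2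
  change u' (rep (0, k + 1)) 0 + (u' (rep (1, k + 1)) 0 + u' (rep (2, k + 1)) 0) = 0 at w3
  rw [hd _ (by rw [hir]; omega) z0 m0, (e1 _ m0).2, (e2 _ m0).2] at w3
  rw [z0 m0, (e1 _ m0).1] at w1
  rw [z0 m0, (e2 _ m0).1] at w2
  simp only [sinC_zero, cosC_zero, mul_one, mul_zero, add_zero, sub_zero, Pi.zero_apply, zero_add]
    at w1 w2 w3
  -- As the horizontal edge carries zero Cauchy data, only an antisymmetric pair of sines is left on
  -- the zigzag edges. Continuity at their far vertex, with the Floquet phase, then gives `(1 + θ)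
  -- sin (ω L) D₁ = 0`.
  have w4 : D₁ + D₂ = 0 := by
    rw [← mul_add] at w3
    simpa [hω'] using w3
  -- the vertex on the other side of the layer
  have x1 := hcont _ iB' (1, -1, k + 1 + 1) (by simp [Vertex.edges]; ring) (2, 0, k + 1)
    (by simp [Vertex.edges]; ring)
  simp only [Vertex.param] at x1
  rw [hq (k + 1) (by omega) _ m1] at x1
  change multiplier β * u (rep (1, k + 1)) edgeLen = u (rep (2, k + 1)) edgeLen at x1
  rw [(e1 _ m1).1, (e2 _ m1).1, w1, w2] at x1
  have x2 : (1 + multiplier β) * sinC ω edgeLen * D₁ = 0 := by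
    linear_combination x1 + sinC ω edgeLen * w4
  have hD₁ : D₁ = 0 := by simpa [hθ, hs] using x2
  have hD₂ : D₂ = 0 := by simpa [hD₁] using w4
  intro j
  fin_cases j
  · exact z0
  · intro s hs
    simp [(e1 s hs).1, w1, hD₁]
  · intro s hs
    simp [(e2 s hs).1, w2, hD₂]

theorem IsPair.deriv2_ae_eq (hμ : 0 < μ) {bc : BoundaryType} {z : ℂ} {f g : GraphL2 t μ}
    (h : IsPair bc t μ β f g u u' u'') (hfg : g = z • f) (p : Fin 3 × ℤ) :
    u'' (rep p) =ᵐ[volume.restrict (part t (rep p))] fun s => -z * u (rep p) s := by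
  have h1 := h.snd p
  rw [hfg, lp.coeFn_smul, Pi.smul_apply] at h1
  have h2 : u'' (rep p) =ᵐ[edgeMeasure t μ p] fun s => -z * u (rep p) s := by
    filter_upwards [h1, h.fst p, Lp.coeFn_smul z (f p)] with s a b c
    rw [a, Pi.smul_apply, b, smul_eq_mul] at c
    linear_combination -c
  exact (restrict_part_absolutelyContinuous hμ p).ae_le h2

theorem memLp_of_continuous_of_norm_le {f : ℝ → ℂ} (hf : Continuous f) (C : ℝ)
    (h : ∀ s, ‖f s‖ ≤ C) (p : Fin 3 × ℤ) : MemLp f 2 (edgeMeasure t μ p) :=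
  .of_bound hf.aestronglyMeasurable C (ae_of_all _ h)

theorem memLp_cosC (ω : ℝ) (p : Fin 3 × ℤ) : MemLp (cosC ω) 2 (edgeMeasure t μ p) :=
  memLp_of_continuous_of_norm_le (continuous_cosC ω) 1 (norm_cosC_le ω) p

theorem memLp_sinC (ω : ℝ) (p : Fin 3 × ℤ) : MemLp (sinC ω) 2 (edgeMeasure t μ p) :=
  memLp_of_continuous_of_norm_le (continuous_sinC ω) 1 (norm_sinC_le ω) p

/-- Solutions of the homogeneous equation on an edge, as elements of `L²`. -/
def edgeKernel (t μ ω : ℝ) (p : Fin 3 × ℤ) : Submodule ℂ (Lp ℂ 2 (edgeMeasure t μ p)) :=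
  Submodule.span ℂ {(memLp_cosC ω p).toLp (cosC ω), (memLp_sinC ω p).toLp (sinC ω)}

instance (t μ ω : ℝ) (p : Fin 3 × ℤ) : FiniteDimensional ℂ (edgeKernel t μ ω p) :=
  FiniteDimensional.span_of_finite ℂ (by simp)

theorem ae_edgeMeasure {p : Fin 3 × ℤ} {P : ℝ → Prop} (h : ∀ s ∈ part t (rep p), P s) :
    ∀ᵐ s ∂edgeMeasure t μ p, P s :=
  Measure.ae_smul_measure
    ((ae_restrict_iff' (isOpen_part t (rep p)).measurableSet).2 (ae_of_all _ h)) _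

theorem IsPair.mem_edgeKernel (hμ : 0 < μ) (hω : ω ≠ 0) {bc : BoundaryType} {f g : GraphL2 t μ}
    (h : IsPair bc t μ β f g u u' u'') (hfg : g = (ω : ℂ) ^ 2 • f) (p : Fin 3 × ℤ) :
    f p ∈ edgeKernel t μ ω p := by
  obtain ⟨C, D, hCD⟩ := h.isH2.exists_eq_cos_sin hω (h.deriv2_ae_eq hμ hfg p)
  refine Submodule.mem_span_pair.2 ⟨C, D, Lp.ext ?_⟩
  filter_upwards [h.fst p, Lp.coeFn_add (C • (memLp_cosC ω p).toLp) (D • (memLp_sinC ω p).toLp),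
    Lp.coeFn_smul C ((memLp_cosC (t := t) (μ := μ) ω p).toLp),
    Lp.coeFn_smul D ((memLp_sinC (t := t) (μ := μ) ω p).toLp),
    (memLp_cosC (t := t) (μ := μ) ω p).coeFn_toLp, (memLp_sinC (t := t) (μ := μ) ω p).coeFn_toLp,
    ae_edgeMeasure fun s hs => (hCD s (subset_closure hs)).1] with s h1 h2 h3 h4 h5 h6 h7
  rw [h1, h2, Pi.add_apply, h3, h4, Pi.smul_apply, Pi.smul_apply, h5, h6, h7]
  simp

/-- The layers below `-1` are cut off, and those beyond `1` follow by unique continuation. Layer `1`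
is the starting point since it is the first one in which no edge can be truncated. -/
theorem IsPair.eq_zero (hμ : 0 < μ) (ht : t ∈ Icc 0 (2 * edgeLen)) (hω : ω ≠ 0)
    (hs : sinC ω edgeLen ≠ 0) (hθ : 1 + multiplier β ≠ 0) {bc : BoundaryType}
    {f g : GraphL2 t μ} (h : IsPair bc t μ β f g u u' u'') (hfg : g = (ω : ℂ) ^ 2 • f)
    (h0 : ∀ j k, -1 ≤ k → k ≤ 1 → f (j, k) = 0) : f = 0 := by
  have key : ∀ k : ℤ, 1 ≤ k → ∀ j, EqOn (u (rep (j, k))) 0 (Icc 0 edgeLen) := by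
    intro k hk
    induction k, hk using Int.leInduction with
    | base =>
      intro j
      have hcl : closure (part t (rep (j, 1))) = Icc 0 edgeLen :=
        closure_part_of_index_pos ht.2 (by simp [rep, Edge.index])
      have h1 : u (rep (j, 1)) =ᵐ[edgeMeasure t μ (j, 1)] 0 := by
        have h2 := h.fst (j, 1)
        rw [h0 j 1 (by norm_num) le_rfl] at h2
        exact h2.symm.trans (Lp.coeFn_zero ℂ 2 _)
      have h3 := Measure.eqOn_open_of_ae_eq
        ((restrict_part_absolutelyContinuous hμ (j, 1)).ae_le h1) (isOpen_part t _)
        ((h.isH2.continuousOn0 _).mono subset_closure) continuousOn_const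
      rw [← hcl]
      exact h3.of_subset_closure (h.isH2.continuousOn0 _) continuousOn_const subset_closure
        subset_rfl
    | succ k hk ih =>
      exact h.isH2.eq_zero_succ ht.2 h.kirchhoff hω hs hθ (h.deriv2_ae_eq hμ hfg) hk ih
  refine lp.ext (funext fun p => ?_)
  obtain ⟨j, k⟩ := p
  rcases lt_or_ge k (-1) with hk | hk
  · refine Lp.ext (ae_edgeMeasure fun s hs => ?_)
    rw [part_eq_empty ht.1 (by simp [rep, Edge.index]; omega)
      (fun _ => by simp [rep, Edge.index]; omega)] at hs
    exact hs.elim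
  rcases le_or_gt k 1 with hk' | hk'
  · exact h0 j k hk hk'
  · refine Lp.ext ((h.fst (j, k)).trans (.trans ?_ (Lp.coeFn_zero ℂ 2 _).symm))
    exact ae_edgeMeasure fun s hs => key k hk'.le j (Ioo_subset_Icc_self hs.1)

/-- A kernel element is determined by its components on the nine edges of the layers `-1`, `0`, `1`,
and each of them lies in the span of a cosine and a sine. -/
theorem finiteDimensional_ker_shifted (hμ : 0 < μ) (ht : t ∈ Icc 0 (2 * edgeLen))
    (bc : BoundaryType) (hω : ω ≠ 0) (hs : sinC ω edgeLen ≠ 0) (hθ : 1 + multiplier β ≠ 0) :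
    FiniteDimensional ℂ (shifted (limitOperator bc t μ β) ((ω ^ 2 : ℝ) : ℂ)).ker := by
  set K := (shifted (limitOperator bc t μ β) ((ω ^ 2 : ℝ) : ℂ)).ker with hK
  have hx : ∀ x : K, x.1.1.2 = (ω : ℂ) ^ 2 • x.1.1.1 := fun x => by
    have h1 : shifted (limitOperator bc t μ β) ((ω ^ 2 : ℝ) : ℂ) x.1 = 0 := x.2
    rw [shifted_apply, sub_eq_zero] at h1
    rw [h1]
    norm_cast
  have hpair : ∀ x : K, ∃ u u' u'', IsPair bc t μ β x.1.1.1 x.1.1.2 u u' u'' := fun x =>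
    (limitOperator_graph bc t μ β).le x.1.2
  -- The shift by `-1` enumerates the layers `-1`, `0`, `1`.
  let q : Fin 3 × Fin 3 → Fin 3 × ℤ := fun i => (i.1, (i.2 : ℤ) - 1)
  let ψ : ∀ i, K →ₗ[ℂ] Lp ℂ 2 (edgeMeasure t μ (q i)) := fun i =>
    { toFun := fun x => x.1.1.1 (q i)
      map_add' := fun _ _ => rfl
      map_smul' := fun _ _ => rfl }
  have hψ : ∀ i x, ψ i x ∈ edgeKernel t μ ω (q i) := fun i x => by
    obtain ⟨u, u', u'', h⟩ := hpair x
    exact h.mem_edgeKernel hμ hω (hx x) (q i)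
  refine FiniteDimensional.of_injective
    (LinearMap.pi fun i => (ψ i).codRestrict (edgeKernel t μ ω (q i)) (hψ i)) ?_
  refine (injective_iff_map_eq_zero _).2 fun x hx0 => ?_
  have h0 : ∀ i, x.1.1.1 (q i) = 0 := fun i => congrArg Subtype.val (congrFun hx0 i)
  obtain ⟨u, u', u'', h⟩ := hpair x
  have h1 : x.1.1.1 = 0 := h.eq_zero hμ ht hω hs hθ (hx x) fun j k hk hk' => by
    interval_cases k
    · exact h0 (j, 0)
    · exact h0 (j, 1)
    · exact h0 (j, 2)
  refine Subtype.ext (Subtype.ext (Prod.ext h1 ?_))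
  rw [hx x, h1, smul_zero]
  rfl

end Kernel


/-! ### Approximate solutions -/

/-- After normalisation the squared defect is at most `C / (m (n + 1))`, which tends to `0`; the
normalised sequence is therefore singular. -/
theorem not_isFredholm_of_approximate_solutions {H : Type*} [NormedAddCommGroup H]
    [NormedSpace ℂ H] [CompleteSpace H] {ι : Type*} {G : ι → Type*}
    [∀ i, NormedAddCommGroup (G i)] [∀ i, NormedSpace ℂ (G i)] (ev : ∀ i, H →L[ℂ] G i)
    (hev : ∀ x, (∀ i, ev i x = 0) → x = 0) (T : H →ₗ.[ℂ] H) (z : ℂ) {f g : ℕ → H}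
    (hfg : ∀ n, (f n, g n) ∈ T.graph) {m C : ℝ} (hm : 0 < m)
    (hf : ∀ n : ℕ, (n + 1) * m ≤ ‖f n‖ ^ 2) (hg : ∀ n, ‖g n - z • f n‖ ^ 2 ≤ C)
    (h0 : ∀ i, ∀ᶠ n in Filter.atTop, ev i (f n) = 0) : ¬ (shifted T z).IsFredholm := by
  have hpos : ∀ n, 0 < ‖f n‖ := fun n => by
    refine (norm_nonneg _).lt_of_ne fun h1 => ?_
    have h2 := hf n
    rw [← h1] at h2
    have h3 : 0 < ((n : ℝ) + 1) * m := by positivity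
    linarith
  let x : ℕ → T.graph := fun n => ((‖f n‖⁻¹ : ℝ) : ℂ) • ⟨(f n, g n), hfg n⟩
  have hx1 : ∀ n, (x n).1.1 = ((‖f n‖⁻¹ : ℝ) : ℂ) • f n := fun n => rfl
  have hx2 : ∀ n, shifted T z (x n) = ((‖f n‖⁻¹ : ℝ) : ℂ) • (g n - z • f n) := fun n => by
    rw [map_smul, shifted_apply]
  refine not_isFredholm_of_singular_sequence ev hev _ _ x (fun n => ?_) ?_ fun i => ?_
  · rw [hx1, norm_smul, Complex.norm_real, norm_inv, norm_norm, inv_mul_cancel₀ (hpos n).ne']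
  · refine squeeze_zero_norm (a := fun n : ℕ => √(C / m * (1 / (n + 1 : ℝ)))) (fun n => ?_) ?_
    · rw [hx2, norm_smul, Complex.norm_real, norm_inv, norm_norm]
      refine Real.le_sqrt_of_sq_le ?_
      rw [mul_pow, inv_pow, inv_mul_eq_div, div_mul_div_comm, mul_one, mul_comm m]
      exact div_le_div₀ ((sq_nonneg _).trans (hg n)) (hg n) (by positivity) (hf n)
    · have h1 := (tendsto_one_div_add_atTop_nhds_zero_nat (𝕜 := ℝ)).const_mul (C / m)
      rw [mul_zero] at h1
      simpa using h1.sqrt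
  · filter_upwards [h0 i] with n hn
    rw [hx1, map_smul, hn, smul_zero]

/-! ### Finitely supported elements of `L²` -/

section FiniteSupport

variable {t μ : ℝ}

theorem memLp_of_continuous {f : ℝ → ℂ} (hf : Continuous f) (p : Fin 3 × ℤ) :
    MemLp f 2 (edgeMeasure t μ p) := by
  obtain ⟨C, hC⟩ := isCompact_Icc.exists_bound_of_continuousOn
    (hf.continuousOn (s := Icc 0 edgeLen))
  exact .of_bound hf.aestronglyMeasurable C
    (ae_edgeMeasure fun s hs => hC s (Ioo_subset_Icc_self hs.1))

/-- The element of `L²` given by continuous functions on finitely many edges. -/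
def ofFinset (t μ : ℝ) (F : Finset (Fin 3 × ℤ)) (U : Fin 3 × ℤ → C(ℝ, ℂ)) : GraphL2 t μ :=
  ∑ p ∈ F, lp.single 2 p ((memLp_of_continuous (U p).continuous p).toLp (U p))

theorem ofFinset_apply_of_notMem {F : Finset (Fin 3 × ℤ)} {p : Fin 3 × ℤ} (hp : p ∉ F)
    (U : Fin 3 × ℤ → C(ℝ, ℂ)) : ofFinset t μ F U p = 0 := by
  rw [ofFinset, lp.coeFn_sum, Finset.sum_apply]
  exact Finset.sum_eq_zero fun q hq =>
    lp.single_apply_ne _ _ _ (fun h => hp (h ▸ hq))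

theorem ofFinset_ae_eq {F : Finset (Fin 3 × ℤ)} {U : Fin 3 × ℤ → C(ℝ, ℂ)}
    (hU : ∀ p ∉ F, U p = 0) (p : Fin 3 × ℤ) : ofFinset t μ F U p =ᵐ[edgeMeasure t μ p] U p := by
  by_cases hp : p ∈ F
  · have h1 : ofFinset t μ F U p = (memLp_of_continuous (U p).continuous p).toLp (U p) := by
      rw [ofFinset, lp.coeFn_sum, Finset.sum_apply, Finset.sum_eq_single_of_mem p hp,
        lp.single_apply_self]
      exact fun q _ hq => lp.single_apply_ne _ _ _ hq.symm
    rw [h1]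
    exact MemLp.coeFn_toLp _
  · rw [ofFinset_apply_of_notMem hp, hU p hp]
    exact Lp.coeFn_zero ℂ 2 _

theorem norm_ofFinset_sq (F : Finset (Fin 3 × ℤ)) (U : Fin 3 × ℤ → C(ℝ, ℂ)) :
    ‖ofFinset t μ F U‖ ^ 2 = ∑ p ∈ F, ∫ s, ‖U p s‖ ^ 2 ∂edgeMeasure t μ p := by
  have h1 := lp.norm_sum_single (p := 2) (by norm_num)
    (fun p => (memLp_of_continuous (t := t) (μ := μ) (U p).continuous p).toLp (U p)) F
  simp only [ENNReal.toReal_ofNat, Real.rpow_ofNat] at h1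
  rw [ofFinset, h1]
  refine Finset.sum_congr rfl fun p _ => ?_
  rw [norm_sq_eq_integral]
  refine integral_congr_ae ?_
  filter_upwards [(memLp_of_continuous (t := t) (μ := μ) (U p).continuous p).coeFn_toLp] with s hs
  rw [hs]

/-- From layer `1` on, neither the cut nor the weight is felt, so wave packets placed there have the
same norms for all `t` and `μ`. -/
theorem edgeMeasure_eq (ht : t ≤ 2 * edgeLen) {p : Fin 3 × ℤ} (hp : 1 ≤ p.2) :
    edgeMeasure t μ p = volume.restrict (Ioo 0 edgeLen) := by
  have h1 : (rep p).index = p.2 := by simp [rep, Edge.index]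
  rw [edgeMeasure, weight_eq_one μ (by omega), part_eq_Ioo ht (by omega) fun _ => by omega]
  simp

end FiniteSupport

/-! ### Truncated Bloch waves -/

/-- The coefficients of a function `ζ ^ k (cos (ω s) + b j sin (ω s))` on the edges `(j, k)` that
satisfies the conditions at all the vertices of the graph. -/
structure IsBlochWave (β ω : ℝ) (ζ : ℂ) (b : Fin 3 → ℂ) : Prop where
  norm_eq_one : ‖ζ‖ = 1
  continuous_one : multiplier β * (cosC ω edgeLen + b 1 * sinC ω edgeLen)
    = ζ * (cosC ω edgeLen + b 0 * sinC ω edgeLen)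
  continuous_two : cosC ω edgeLen + b 2 * sinC ω edgeLen
    = ζ * (cosC ω edgeLen + b 0 * sinC ω edgeLen)
  kirchhoff_A : b 0 + b 1 + b 2 = 0
  kirchhoff_B : ζ * (b 0 * cosC ω edgeLen - sinC ω edgeLen)
    + multiplier β * (b 1 * cosC ω edgeLen - sinC ω edgeLen)
    + (b 2 * cosC ω edgeLen - sinC ω edgeLen) = 0

/-- A smooth function with Cauchy data `(1, 0)` at `0` and `(0, 0)` at `edgeLen`. -/
def ramp : C(ℝ, ℂ) := ⟨fun s => 1 - 3 * (s / edgeLen) ^ 2 + 2 * (s / edgeLen) ^ 3, by fun_prop⟩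

def ramp' : C(ℝ, ℂ) := ⟨fun s => (6 * (s / edgeLen) ^ 2 - 6 * (s / edgeLen)) / edgeLen, by fun_prop⟩

def ramp'' : C(ℝ, ℂ) := ⟨fun s => (12 * (s / edgeLen) - 6) / edgeLen ^ 2, by fun_prop⟩

theorem hasDerivAt_div_edgeLen (s : ℝ) :
    HasDerivAt (fun s : ℝ => (s / edgeLen : ℂ)) (1 / edgeLen) s :=
  (hasDerivAt_id (s : ℂ)).comp_ofReal.div_const _

theorem hasDerivAt_ramp (s : ℝ) : HasDerivAt ramp (ramp' s) s := by
  have h := hasDerivAt_div_edgeLen s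
  refine ((((h.pow 2).const_mul 3).const_sub 1).add ((h.pow 3).const_mul 2)).congr_deriv ?_
  simp only [ramp', ContinuousMap.coe_mk]
  push_cast
  ring

theorem hasDerivAt_ramp' (s : ℝ) : HasDerivAt ramp' (ramp'' s) s := by
  have h := hasDerivAt_div_edgeLen s
  refine ((((h.pow 2).const_mul 6).sub (h.const_mul 6)).div_const _).congr_deriv ?_
  simp only [ramp'', ContinuousMap.coe_mk]
  push_cast
  ring

theorem edgeLen_ne_zero : (edgeLen : ℂ) ≠ 0 := by exact_mod_cast edgeLen_pos.ne'

theorem ramp_zero : ramp 0 = 1 := by simp [ramp]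

theorem ramp_edgeLen : ramp edgeLen = 0 := by
  rw [ramp, ContinuousMap.coe_mk, div_self edgeLen_ne_zero]
  norm_num

theorem ramp'_zero : ramp' 0 = 0 := by simp [ramp']

theorem ramp'_edgeLen : ramp' edgeLen = 0 := by
  rw [ramp', ContinuousMap.coe_mk, div_self edgeLen_ne_zero]
  norm_num

/-- The function on the period that is `f` on the edge `(0, N)`, `g` on the edge `(0, 2 N)`, `h`
between these edges and `0` elsewhere. -/
def plateau (N : ℤ) (f g h : C(ℝ, ℂ)) (p : Fin 3 × ℤ) : C(ℝ, ℂ) :=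
  if p = (0, N) then f else if p = (0, 2 * N) then g else if N ≤ p.2 ∧ p.2 < 2 * N then h else 0

theorem plateau_eq_zero {N : ℤ} (hN : 0 ≤ N) {p : Fin 3 × ℤ} (hp : p.2 < N ∨ 2 * N < p.2)
    (f g h : C(ℝ, ℂ)) : plateau N f g h p = 0 := by
  rw [plateau, if_neg, if_neg, if_neg]
  · omega
  all_goals
    rintro rfl
    simp only at hp
    omega

theorem hasDerivAt_plateau {f g h f' g' h' : C(ℝ, ℂ)} {s : ℝ} (hf : HasDerivAt f (f' s) s)
    (hg : HasDerivAt g (g' s) s) (hh : HasDerivAt h (h' s) s) (N : ℤ) (p : Fin 3 × ℤ) :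
    HasDerivAt (plateau N f g h p) (plateau N f' g' h' p s) s := by
  unfold plateau
  split_ifs
  exacts [hf, hg, hh, hasDerivAt_const s 0]

/-- Horizontal edges are oriented to the left, so this function rises from `0` to `1` from left to
right along the edge `(0, N)` and falls back to `0` along `(0, 2 * N)`. Both transitions are flat at
their ends and avoid the zigzag edges. -/
def cutoff (N : ℤ) : Fin 3 × ℤ → C(ℝ, ℂ) := plateau N ramp (1 - ramp) 1

def cutoff' (N : ℤ) : Fin 3 × ℤ → C(ℝ, ℂ) := plateau N ramp' (-ramp') 0

def cutoff'' (N : ℤ) : Fin 3 × ℤ → C(ℝ, ℂ) := plateau N ramp'' (-ramp'') 0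

theorem hasDerivAt_cutoff (N : ℤ) (p : Fin 3 × ℤ) (s : ℝ) :
    HasDerivAt (cutoff N p) (cutoff' N p s) s :=
  hasDerivAt_plateau (hasDerivAt_ramp s) ((hasDerivAt_ramp s).const_sub 1)
    (hasDerivAt_const s 1) N p

theorem hasDerivAt_cutoff' (N : ℤ) (p : Fin 3 × ℤ) (s : ℝ) :
    HasDerivAt (cutoff' N p) (cutoff'' N p s) s :=
  hasDerivAt_plateau (hasDerivAt_ramp' s) (hasDerivAt_ramp' s).neg (hasDerivAt_const s 0) N p

theorem cutoff'_zero (N : ℤ) (p : Fin 3 × ℤ) : cutoff' N p 0 = 0 := by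
  unfold cutoff' plateau
  split_ifs <;> simp [ramp'_zero]

theorem cutoff'_edgeLen (N : ℤ) (p : Fin 3 × ℤ) : cutoff' N p edgeLen = 0 := by
  unfold cutoff' plateau
  split_ifs <;> simp [ramp'_edgeLen]

theorem cutoff_zero {N : ℤ} (hN : 1 ≤ N) (p : Fin 3 × ℤ) :
    cutoff N p 0 = if N ≤ p.2 ∧ p.2 < 2 * N then 1 else 0 := by
  unfold cutoff plateau
  split_ifs <;> simp_all [ramp_zero]
  omega

theorem cutoff_edgeLen {N : ℤ} (hN : 1 ≤ N) {j : Fin 3} (hj : j ≠ 0) (k : ℤ) :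
    cutoff N (j, k - 1) edgeLen = cutoff N (0, k) edgeLen := by
  unfold cutoff plateau
  simp only [Prod.mk.injEq, true_and, hj, false_and, if_false]
  split_ifs <;> first | omega | simp [ramp_edgeLen]

section BlochWave

variable {t μ β ω : ℝ} {ζ : ℂ} {b : Fin 3 → ℂ}

/-- A Bloch wave on one edge. -/
def blochEdge (ω : ℝ) (ζ : ℂ) (b : Fin 3 → ℂ) (p : Fin 3 × ℤ) : C(ℝ, ℂ) :=
  ⟨fun s => ζ ^ p.2 * (cosC ω s + b p.1 * sinC ω s), by
    have := continuous_cosC ω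
    have := continuous_sinC ω
    fun_prop⟩

def blochEdge' (ω : ℝ) (ζ : ℂ) (b : Fin 3 → ℂ) (p : Fin 3 × ℤ) : C(ℝ, ℂ) :=
  ⟨fun s => ζ ^ p.2 * (ω * (b p.1 * cosC ω s - sinC ω s)), by
    have := continuous_cosC ω
    have := continuous_sinC ω
    fun_prop⟩

theorem hasDerivAt_blochEdge (p : Fin 3 × ℤ) (s : ℝ) :
    HasDerivAt (blochEdge ω ζ b p) (blochEdge' ω ζ b p s) s :=
  (((hasDerivAt_cosC ω s).add ((hasDerivAt_sinC ω s).const_mul _)).const_mul _).congr_deriv (by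
    simp only [blochEdge', ContinuousMap.coe_mk]
    ring)

theorem hasDerivAt_blochEdge' (p : Fin 3 × ℤ) (s : ℝ) :
    HasDerivAt (blochEdge' ω ζ b p) (-(ω : ℂ) ^ 2 * blochEdge ω ζ b p s) s :=
  (((((hasDerivAt_cosC ω s).const_mul _).sub (hasDerivAt_sinC ω s)).const_mul _).const_mul
    _).congr_deriv (by
    simp only [blochEdge, ContinuousMap.coe_mk]
    ring)

/-- A truncated Bloch wave. -/
def packet (ω : ℝ) (ζ : ℂ) (b : Fin 3 → ℂ) (N : ℤ) (p : Fin 3 × ℤ) : C(ℝ, ℂ) :=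
  cutoff N p * blochEdge ω ζ b p

def packet' (ω : ℝ) (ζ : ℂ) (b : Fin 3 → ℂ) (N : ℤ) (p : Fin 3 × ℤ) : C(ℝ, ℂ) :=
  cutoff' N p * blochEdge ω ζ b p + cutoff N p * blochEdge' ω ζ b p

/-- The opposite of the defect of the equation for a truncated Bloch wave. -/
def defect (ω : ℝ) (ζ : ℂ) (b : Fin 3 → ℂ) (N : ℤ) (p : Fin 3 × ℤ) : C(ℝ, ℂ) :=
  cutoff'' N p * blochEdge ω ζ b p + (2 : ℂ) • (cutoff' N p * blochEdge' ω ζ b p)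

def packet'' (ω : ℝ) (ζ : ℂ) (b : Fin 3 → ℂ) (N : ℤ) (p : Fin 3 × ℤ) : C(ℝ, ℂ) :=
  defect ω ζ b N p - (ω : ℂ) ^ 2 • packet ω ζ b N p

theorem hasDerivAt_packet (N : ℤ) (p : Fin 3 × ℤ) (s : ℝ) :
    HasDerivAt (packet ω ζ b N p) (packet' ω ζ b N p s) s :=
  (hasDerivAt_cutoff N p s).mul (hasDerivAt_blochEdge p s)

theorem hasDerivAt_packet' (N : ℤ) (p : Fin 3 × ℤ) (s : ℝ) :
    HasDerivAt (packet' ω ζ b N p) (packet'' ω ζ b N p s) s :=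
  (((hasDerivAt_cutoff' N p s).mul (hasDerivAt_blochEdge p s)).add
    ((hasDerivAt_cutoff N p s).mul (hasDerivAt_blochEdge' p s))).congr_deriv (by
    simp only [packet'', packet, defect, ContinuousMap.sub_apply, ContinuousMap.add_apply,
      ContinuousMap.smul_apply, ContinuousMap.mul_apply, smul_eq_mul]
    ring)

theorem packet_eq_zero {N : ℤ} (hN : 0 ≤ N) {p : Fin 3 × ℤ} (hp : p.2 < N ∨ 2 * N < p.2) :
    packet ω ζ b N p = 0 := by
  simp [packet, cutoff, plateau_eq_zero hN hp]

theorem packet'_eq_zero {N : ℤ} (hN : 0 ≤ N) {p : Fin 3 × ℤ} (hp : p.2 < N ∨ 2 * N < p.2) :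
    packet' ω ζ b N p = 0 := by
  simp [packet', cutoff, cutoff', plateau_eq_zero hN hp]

theorem packet''_eq_zero {N : ℤ} (hN : 0 ≤ N) {p : Fin 3 × ℤ} (hp : p.2 < N ∨ 2 * N < p.2) :
    packet'' ω ζ b N p = 0 := by
  ext s
  simp [packet'', packet, defect, cutoff, cutoff', cutoff'', plateau_eq_zero hN hp]

theorem integral_of_hasDerivAt {f f' : C(ℝ, ℂ)} (h : ∀ s, HasDerivAt f (f' s) s) (x y : ℝ) :
    f y - f x = ∫ s in x..y, f' s :=
  (intervalIntegral.integral_eq_sub_of_hasDerivAt (fun s _ => h s)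
    (f'.continuous.intervalIntegrable x y)).symm

/-- The edges of the layers between `N` and `2 N`. -/
def packetSupport (N : ℤ) : Finset (Fin 3 × ℤ) := Finset.univ ×ˢ Finset.Icc N (2 * N)

theorem of_notMem_packetSupport {N : ℤ} {p : Fin 3 × ℤ} (hp : p ∉ packetSupport N) :
    p.2 < N ∨ 2 * N < p.2 := by
  simp only [packetSupport, Finset.mem_product, Finset.mem_univ, Finset.mem_Icc, true_and] at hp
  omega

/-- At each vertex the cutoff takes a single value on the three edges and has zero derivative, so
the vertex conditions of the wave are merely multiplied by a scalar. The support avoids the layers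
`-1` and `0`. -/
theorem IsBlochWave.isProfile (h : IsBlochWave β ω ζ b) (t : ℝ) {N : ℤ} (hN : 2 ≤ N) :
    IsProfile t β (fun p => packet ω ζ b N p) (fun p => packet' ω ζ b N p)
      (fun p => packet'' ω ζ b N p) := by
  have hN0 : 0 ≤ N := by omega
  have hN1 : 1 ≤ N := by omega
  have hζ : ζ ≠ 0 := fun h0 => by simpa [h0] using h.norm_eq_one
  refine ⟨fun p => ?_, fun p => (packet ω ζ b N p).continuous.continuousOn,
    fun p => (packet' ω ζ b N p).continuous.continuousOn,
    fun p x _ y _ => integral_of_hasDerivAt (hasDerivAt_packet N p) x y,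
    fun p x _ y _ => integral_of_hasDerivAt (hasDerivAt_packet' N p) x y, ?_, fun k hk => ?_,
    fun k hk => ?_, fun k hk => ?_, fun k hk => ?_, fun j i k hk => ?_⟩
  · obtain ⟨C, hC⟩ := isCompact_Icc.exists_bound_of_continuousOn
      ((packet'' ω ζ b N p).continuous.continuousOn (s := Icc 0 edgeLen))
    have : IsFiniteMeasure (volume.restrict (Ioo 0 edgeLen)) := ⟨by simp⟩
    exact .of_bound (packet'' ω ζ b N p).continuous.aestronglyMeasurable C
      ((ae_restrict_iff' measurableSet_Ioo).2
        (ae_of_all _ fun s hs => hC s (Ioo_subset_Icc_self hs)))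
  · refine summable_of_ne_finset_zero (s := packetSupport N) fun p hp => ?_
    have hp' := of_notMem_packetSupport hp
    simp [packet_eq_zero hN0 hp', packet'_eq_zero hN0 hp', packet''_eq_zero hN0 hp']
  · simp [packet, blochEdge, cutoff_zero hN1, cosC_zero, sinC_zero]
  · have h1 : ζ ^ k = ζ ^ (k - 1) * ζ := by rw [← zpow_add_one₀ hζ, sub_add_cancel]
    simp only [packet, blochEdge, ContinuousMap.mul_apply, ContinuousMap.coe_mk]
    rw [cutoff_edgeLen hN1 (by decide), cutoff_edgeLen hN1 (by decide), h1]
    exact ⟨by linear_combination cutoff N (0, k) edgeLen * ζ ^ (k - 1) * h.continuous_one,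
      by linear_combination cutoff N (0, k) edgeLen * ζ ^ (k - 1) * h.continuous_two⟩
  · simp only [packet', blochEdge', cutoff_zero hN1, cutoff'_zero, cosC_zero, sinC_zero,
      ContinuousMap.mul_apply, ContinuousMap.add_apply, ContinuousMap.coe_mk]
    generalize (if N ≤ k ∧ k < 2 * N then (1 : ℂ) else 0) = x
    linear_combination x * ζ ^ k * ω * h.kirchhoff_A
  · have h1 : ζ ^ k = ζ ^ (k - 1) * ζ := by rw [← zpow_add_one₀ hζ, sub_add_cancel]
    simp only [packet', blochEdge', cutoff'_edgeLen, ContinuousMap.mul_apply,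
      ContinuousMap.add_apply, ContinuousMap.coe_mk]
    rw [cutoff_edgeLen hN1 (by decide), cutoff_edgeLen hN1 (by decide), h1]
    linear_combination cutoff N (0, k) edgeLen * ζ ^ (k - 1) * ω * h.kirchhoff_B
  · have hk' : k < N ∨ 2 * N < k := by omega
    simp [packet_eq_zero hN0 (p := (j, k)) hk', packet'_eq_zero hN0 (p := (j, k)) hk']

/-- The integral of the square of the defect on one of the two edges where it does not vanish. -/
theorem sum_integral_defect (h : IsBlochWave β ω ζ b) (ht : t ≤ 2 * edgeLen) {N : ℤ} (hN : 1 ≤ N) :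
    ∑ p ∈ packetSupport N, ∫ s, ‖defect ω ζ b N p s‖ ^ 2 ∂edgeMeasure t μ p =
      2 * ∫ s in Ioo 0 edgeLen,
        ‖(ramp'' * blochEdge ω ζ b 0 + (2 : ℂ) • (ramp' * blochEdge' ω ζ b 0)) s‖ ^ 2 := by
  have hn : ∀ k : ℤ, ‖ζ ^ k‖ = 1 := fun k => by rw [norm_zpow, h.norm_eq_one, one_zpow]
  have h0 : ∀ (k : ℤ) s, blochEdge ω ζ b (0, k) s = ζ ^ k * blochEdge ω ζ b 0 s :=
    fun k s => by simp [blochEdge]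
  have h1 : ∀ (k : ℤ) s, blochEdge' ω ζ b (0, k) s = ζ ^ k * blochEdge' ω ζ b 0 s :=
    fun k s => by simp [blochEdge']
  have hsub : ({(0, N), (0, 2 * N)} : Finset (Fin 3 × ℤ)) ⊆ packetSupport N := by
    intro p hp
    simp only [Finset.mem_insert, Finset.mem_singleton] at hp
    rcases hp with rfl | rfl <;> simp [packetSupport] <;> omega
  rw [← Finset.sum_subset hsub, Finset.sum_pair (by simp; omega), two_mul (integral _ _),
    edgeMeasure_eq ht (by simpa using hN), edgeMeasure_eq ht (by simp; omega)]
  · have key : ∀ (k : ℤ) (x : ℂ), ‖x‖ = ‖ζ ^ k * x‖ := fun k x => by rw [norm_mul, hn, one_mul]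
    refine congrArg₂ (· + ·) ?_ ?_
    · refine integral_congr_ae (ae_of_all _ fun s => ?_)
      simp only [defect, cutoff', cutoff'', plateau, if_true, ContinuousMap.add_apply,
        ContinuousMap.smul_apply, ContinuousMap.mul_apply, h0, h1, smul_eq_mul]
      conv_rhs => rw [key N]
      ring_nf
    · refine integral_congr_ae (ae_of_all _ fun s => ?_)
      have h2 : ((0, 2 * N) : Fin 3 × ℤ) ≠ (0, N) := by simp; omega
      simp only [defect, cutoff', cutoff'', plateau, if_true, if_neg h2, ContinuousMap.add_apply,
        ContinuousMap.smul_apply, ContinuousMap.mul_apply, ContinuousMap.neg_apply, h0, h1,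
        smul_eq_mul]
      conv_rhs => rw [key (2 * N), ← norm_neg]
      ring_nf
  · intro p _ hp
    simp only [Finset.mem_insert, Finset.mem_singleton, not_or] at hp
    simp [defect, cutoff', cutoff'', plateau, hp.1, hp.2]

theorem le_sum_integral_packet (h : IsBlochWave β ω ζ b) (ht : t ≤ 2 * edgeLen) (n : ℕ) :
    n * ∫ s in Ioo 0 edgeLen, ‖blochEdge ω ζ b 0 s‖ ^ 2 ≤
      ∑ p ∈ packetSupport (n + 2), ∫ s, ‖packet ω ζ b (n + 2) p s‖ ^ 2 ∂edgeMeasure t μ p := by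
  have hn : ∀ k : ℤ, ‖ζ ^ k‖ = 1 := fun k => by rw [norm_zpow, h.norm_eq_one, one_zpow]
  -- For `N = n + 2` these horizontal edges have indices from `N + 1` to `2 N - 2`, hence lie
  -- strictly between the two transition edges, where the cutoff is `1`. As `‖ζ‖ = 1`, they all
  -- contribute equally.
  let g : ℕ ↪ Fin 3 × ℤ := ⟨fun i => (0, n + 3 + i), fun i j hij => by simpa using hij⟩
  have hg : ∀ i, g i = (0, (n : ℤ) + 3 + i) := fun _ => rfl
  have hsub : (Finset.range n).map g ⊆ packetSupport (n + 2) := by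
    intro p hp
    simp only [Finset.mem_map, Finset.mem_range] at hp
    obtain ⟨i, hi, rfl⟩ := hp
    simp only [packetSupport, Finset.mem_product, Finset.mem_univ, Finset.mem_Icc, true_and, hg]
    omega
  refine le_trans (le_of_eq ?_) (Finset.sum_le_sum_of_subset_of_nonneg hsub fun p _ _ =>
    integral_nonneg fun s => by positivity)
  rw [Finset.sum_map, ← nsmul_eq_mul, ← Finset.card_range n, ← Finset.sum_const, Finset.card_range]
  refine Finset.sum_congr rfl fun i hi => ?_
  have hi' := Finset.mem_range.1 hi
  rw [edgeMeasure_eq ht (by rw [hg]; simp only; omega)]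
  refine integral_congr_ae (ae_of_all _ fun s => ?_)
  simp only [packet, cutoff, plateau, hg, Prod.mk.injEq, true_and,
    ContinuousMap.mul_apply]
  rw [if_neg (by omega), if_neg (by omega), if_pos (by omega)]
  simp [blochEdge, hn]

theorem integral_blochEdge_pos : 0 < ∫ s in Ioo 0 edgeLen, ‖blochEdge ω ζ b 0 s‖ ^ 2 := by
  rw [← integral_Ioc_eq_integral_Ioo, ← intervalIntegral.integral_of_le edgeLen_pos.le]
  refine intervalIntegral.integral_pos edgeLen_pos
    ((blochEdge ω ζ b 0).continuous.norm.pow 2).continuousOn (fun s _ => by positivity)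
    ⟨0, ⟨le_rfl, edgeLen_pos.le⟩, ?_⟩
  simp [blochEdge, cosC_zero, sinC_zero]

/-- A Bloch wave yields a point of the essential spectrum. -/
theorem IsBlochWave.not_isFredholm (h : IsBlochWave β ω ζ b) (ht : t ∈ Icc 0 (2 * edgeLen))
    (bc : BoundaryType) :
    ¬ (shifted (limitOperator bc t μ β) ((ω ^ 2 : ℝ) : ℂ)).IsFredholm := by
  set m := ∫ s in Ioo 0 edgeLen, ‖blochEdge ω ζ b 0 s‖ ^ 2 with hm
  have hm0 : 0 < m := integral_blochEdge_pos
  set ρ := ∫ s in Ioo 0 edgeLen,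
    ‖(ramp'' * blochEdge ω ζ b 0 + (2 : ℂ) • (ramp' * blochEdge' ω ζ b 0)) s‖ ^ 2 with hρ
  -- Index `n + 1` in `le_sum_integral_packet` gives the lower bound `(n + 1) * m`, which is
  -- positive for `n = 0` too.
  let N : ℕ → ℤ := fun n => ((n + 1 : ℕ) : ℤ) + 2
  let f : ℕ → GraphL2 t μ := fun n => ofFinset t μ (packetSupport (N n)) (packet ω ζ b (N n))
  let r : ℕ → GraphL2 t μ := fun n => ofFinset t μ (packetSupport (N n)) (defect ω ζ b (N n))
  let g : ℕ → GraphL2 t μ := fun n => (ω : ℂ) ^ 2 • f n - r n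
  have hN : ∀ n, 2 ≤ N n := fun n => by simp only [N]; omega
  have hf0 : ∀ n, ∀ p ∉ packetSupport (N n), packet ω ζ b (N n) p = 0 := fun n p hp =>
    packet_eq_zero (by have := hN n; omega) (of_notMem_packetSupport hp)
  have hr0 : ∀ n, ∀ p ∉ packetSupport (N n), defect ω ζ b (N n) p = 0 := fun n p hp => by
    have h1 := plateau_eq_zero (by have := hN n; omega) (of_notMem_packetSupport hp)
    ext s
    simp [defect, cutoff', cutoff'', h1]
  have hfg : ∀ n, (f n, g n) ∈ (limitOperator bc t μ β).graph := fun n => by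
    refine (h.isProfile t (hN n)).mem_limitGraph ht bc (ofFinset_ae_eq (hf0 n)) fun p => ?_
    have e0 : g n p = (ω : ℂ) ^ 2 • f n p - r n p := rfl
    rw [e0]
    filter_upwards [Lp.coeFn_sub ((ω : ℂ) ^ 2 • f n p) (r n p),
      Lp.coeFn_smul ((ω : ℂ) ^ 2) (f n p), ofFinset_ae_eq (t := t) (μ := μ) (hf0 n) p,
      ofFinset_ae_eq (t := t) (μ := μ) (hr0 n) p] with s e1 e2 e3 e4
    rw [e1, Pi.sub_apply, e2, Pi.smul_apply, e3, e4]
    simp [packet'']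
  have hfn : ∀ n : ℕ, (n + 1 : ℕ) * m ≤ ‖f n‖ ^ 2 := fun n => by
    rw [norm_ofFinset_sq]
    exact le_sum_integral_packet h ht.2 (n + 1)
  have hrn : ∀ n, ‖r n‖ ^ 2 = 2 * ρ := fun n => by
    rw [norm_ofFinset_sq]
    exact sum_integral_defect h ht.2 (by have := hN n; omega)
  refine not_isFredholm_of_approximate_solutions
    (fun p => lp.evalCLM ℂ (fun p : Fin 3 × ℤ => Lp ℂ 2 (edgeMeasure t μ p)) 2 p)
    (fun y hy => lp.ext (funext hy)) _ _ hfg hm0 (C := 2 * ρ) (fun n => ?_) (fun n => ?_)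
    fun p => ?_
  · exact_mod_cast hfn n
  · rw [← hrn n, ← norm_neg (r n)]
    refine le_of_eq (congrArg (fun y => ‖y‖ ^ 2) ?_)
    simp only [g]
    push_cast
    abel
  · filter_upwards [Filter.eventually_ge_atTop p.2.toNat] with n hn
    refine ofFinset_apply_of_notMem ?_ _
    simp only [packetSupport, Finset.mem_product, Finset.mem_univ, Finset.mem_Icc, true_and, N]
    omega

end BlochWave


/-! ### The gaps -/

section Gaps

variable {t μ β ω : ℝ}

theorem conj_one_add_inv_multiplier (β : ℝ) :
    starRingEnd ℂ (1 + (multiplier β)⁻¹) = 1 + multiplier β := by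
  rw [map_add, map_one, Complex.inv_eq_conj (norm_multiplier β), Complex.conj_conj]

/-- With `φ = π β`, one has `1 + exp (2 i φ) = 2 cos φ exp (i φ)`, and the cosine is positive for `β
< 1 / 2`. The inverse only conjugates this number. -/
theorem norm_one_add_inv_multiplier (hβ₀ : 0 ≤ β) (hβ₁ : β < 1 / 2) :
    ‖1 + (multiplier β)⁻¹‖ = 2 * Real.cos (Real.pi * β) := by
  have hpi := Real.pi_pos
  have h1 : multiplier β = Complex.exp ((Real.pi * β : ℝ) * Complex.I) ^ 2 := by
    rw [multiplier, ← Complex.exp_nat_mul]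
    congr 1
    push_cast
    ring
  have h2 : (1 : ℂ) + multiplier β
      = Complex.exp ((Real.pi * β : ℝ) * Complex.I) * ((2 * Real.cos (Real.pi * β) : ℝ) : ℂ) := by
    rw [h1, Complex.ofReal_mul 2, Complex.ofReal_cos, Complex.ofReal_ofNat, Complex.two_cos,
      neg_mul, Complex.exp_neg, mul_add, mul_inv_cancel₀ (Complex.exp_ne_zero _)]
    ring
  have h3 : 0 < Real.cos (Real.pi * β) :=
    Real.cos_pos_of_mem_Ioo ⟨by nlinarith, by nlinarith⟩
  rw [← Complex.norm_conj, conj_one_add_inv_multiplier, h2, norm_mul,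
    Complex.norm_exp_ofReal_mul_I, Complex.norm_real, Real.norm_of_nonneg (by positivity), one_mul]

/-- At the edges of the bands there is a Bloch wave. -/
theorem exists_isBlochWave (hs : sinC ω edgeLen ≠ 0) (hz : 1 + (multiplier β)⁻¹ ≠ 0)
    (hz1 : ‖1 + (multiplier β)⁻¹‖ ≠ 1)
    (h : |3 * Real.cos (ω * edgeLen)| = |1 - ‖1 + (multiplier β)⁻¹‖|) :
    ∃ ζ b, IsBlochWave β ω ζ b := by
  set θ := multiplier β with hθ
  have hθ0 : θ * θ⁻¹ = 1 := mul_inv_cancel₀ (multiplier_ne_zero β)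
  set z := 1 + θ⁻¹ with hzdef
  set r : ℝ := ‖z‖ with hr
  have hr0 : (r : ℂ) ≠ 0 := by exact_mod_cast norm_ne_zero_iff.2 hz
  have hr1 : (1 - r : ℂ) ≠ 0 := by
    refine sub_ne_zero.2 fun h => hz1 ?_
    exact_mod_cast h.symm
  have hc : (3 * cosC ω edgeLen) ^ 2 = (1 - r : ℂ) ^ 2 := by
    have := (sq_eq_sq_iff_abs_eq_abs _ _).2 h
    rw [cosC]
    exact_mod_cast this
  have hzw : z * (1 + θ) = (r : ℂ) ^ 2 := by
    rw [← conj_one_add_inv_multiplier, Complex.mul_conj, Complex.normSq_eq_norm_sq]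
    push_cast
    rfl
  set c := cosC ω edgeLen with hcdef
  set n := sinC ω edgeLen with hndef
  -- For a plane wave equal to `ζ ^ k` at `A 0 k` and `σ ζ ^ k` at `B 0 k`, the equation at `A`
  -- reads `3 c = σ (1 + ζ z)`. At the band edge `‖1 + ζ z‖` is smallest, that is `ζ z = -r`, and
  -- then `σ = ±1`.
  obtain ⟨σ, hσ⟩ : ∃ σ, σ = 3 * c / (1 - r) := ⟨_, rfl⟩
  have hσc : σ * (1 - r) = 3 * c := by
    rw [hσ]
    field_simp
  have hσ2 : σ ^ 2 = 1 := by
    rw [hσ, div_pow, hc, div_self (pow_ne_zero 2 hr1)]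
  obtain ⟨ζ, hζ⟩ : ∃ ζ, ζ = -(r : ℂ) / z := ⟨_, rfl⟩
  have hζz : ζ * z = -r := by
    rw [hζ]
    field_simp
  have hζr : ζ * r = -(1 + θ) := by
    refine mul_left_cancel₀ hz ?_
    linear_combination r * hζz + hzw
  have hsc : n ^ 2 + c ^ 2 = 1 := sinC_sq_add_cosC_sq ω edgeLen
  -- Values of the wave at the ends of the three edges that start at `A 0 0`.
  let x : Fin 3 → ℂ := ![σ, θ⁻¹ * (σ * ζ), σ * ζ]
  have hb : ∀ j, c + (x j - c) / n * n = x j := fun j => by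
    rw [div_mul_cancel₀ _ hs]
    ring
  have hb' : ∀ j, (x j - c) / n * c - n = (x j * c - 1) / n := fun j => by
    rw [div_mul_eq_mul_div, div_sub' hs, div_left_inj' hs]
    linear_combination -hsc
  refine ⟨ζ, fun j => (x j - c) / n, ?_, ?_, ?_, ?_, ?_⟩
  · rw [hζ, norm_div, norm_neg, Complex.norm_real, hr, norm_norm, div_self (norm_ne_zero_iff.2 hz)]
  · rw [hb, hb]
    simp only [x, Matrix.cons_val]
    linear_combination σ * ζ * hθ0
  · rw [hb, hb]
    simp only [x, Matrix.cons_val]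
    ring
  · simp only [x, Matrix.cons_val]
    rw [← add_div, ← add_div, div_eq_zero_iff]
    left
    linear_combination σ * hζz + hσc
  · rw [hb', hb', hb', mul_div_assoc', mul_div_assoc', ← add_div, ← add_div, div_eq_zero_iff]
    left
    simp only [x, Matrix.cons_val]
    linear_combination σ * ζ * c * hθ0 - ζ * σ * hσc + ζ * (1 - r) * hσ2 - hζr

theorem mem_essSpectrum_of_abs_cos_eq (ht : t ∈ Icc 0 (2 * edgeLen)) (bc : BoundaryType)
    (hs : sinC ω edgeLen ≠ 0) (hz : 1 + (multiplier β)⁻¹ ≠ 0)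
    (hz1 : ‖1 + (multiplier β)⁻¹‖ ≠ 1)
    (h : |3 * Real.cos (ω * edgeLen)| = |1 - ‖1 + (multiplier β)⁻¹‖|) :
    ω ^ 2 ∈ essSpectrum (limitOperator bc t μ β) := by
  obtain ⟨ζ, b, hb⟩ := exists_isBlochWave hs hz hz1 h
  exact hb.not_isFredholm ht bc

theorem notMem_essSpectrum_of_abs_cos_lt (hμ : 0 < μ) (ht : t ∈ Icc 0 (2 * edgeLen))
    (bc : BoundaryType) (hω : 0 < ω) (hs : sinC ω edgeLen ≠ 0) (hz : 1 + (multiplier β)⁻¹ ≠ 0)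
    (h : |3 * Real.cos (ω * edgeLen)| < |1 - ‖1 + (multiplier β)⁻¹‖|) :
    ω ^ 2 ∉ essSpectrum (limitOperator bc t μ β) := by
  have hw : 1 + multiplier β ≠ 0 := by
    rw [← conj_one_add_inv_multiplier]
    exact (map_ne_zero _).2 hz
  have := finiteDimensional_ker_shifted hμ ht bc hω.ne' hs hw
  exact not_not.2 (isFredholm_of_abs_cos_lt hμ ht bc hω hs h)

/-- The square root of `lambdaStar n`. -/
def midFrequency (n : ℕ) : ℝ := Real.pi / (2 * edgeLen) + n * Real.pi / edgeLen

/-- At the frequency `midFrequency n` the phase is `π / 2 + n π`, a zero of the cosine; near it the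
cosine is, up to sign, the sine of the deviation. -/
theorem abs_cos_eq_abs_sin (n : ℕ) (ω : ℝ) :
    |Real.cos (ω * edgeLen)| = |Real.sin ((ω - midFrequency n) * edgeLen)| := by
  have hL := edgeLen_pos.ne'
  have h1 : ω * edgeLen = (ω - midFrequency n) * edgeLen + Real.pi / 2 + n * Real.pi := by
    rw [midFrequency]
    field_simp
    ring
  rw [h1, Real.cos_add_nat_mul_pi, Real.cos_add_pi_div_two, abs_mul, abs_neg, abs_neg_one_pow,
    one_mul]

theorem sinC_ne_zero_of_abs_cos_lt_one (h : |Real.cos (ω * edgeLen)| < 1) :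
    sinC ω edgeLen ≠ 0 := by
  intro h0
  rw [sinC, Complex.ofReal_eq_zero] at h0
  have h1 := Real.sin_sq_add_cos_sq (ω * edgeLen)
  rw [h0] at h1
  have h2 := (sq_lt_one_iff_abs_lt_one _).2 h
  linarith

/-- The interval consists of the `ω ^ 2` with `|ω - κ| < δ`, where `δ` solves `3 sin (δ L) = d`.
Both `d` and `δ` depend on `β` only, hence the same interval for all `t`, `μ` and boundary
conditions. -/
theorem exists_gap (hz : 1 + (multiplier β)⁻¹ ≠ 0) (hz1 : ‖1 + (multiplier β)⁻¹‖ ≠ 1) (n : ℕ) :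
    ∃ I : Set ℝ, lambdaStar n ∈ I ∧ ∀ t ∈ Icc (0 : ℝ) (2 * edgeLen), ∀ μ : ℝ, 0 < μ →
      ∀ bc : BoundaryType, IsGap (essSpectrum (limitOperator bc t μ β)) I := by
  have hL := edgeLen_pos
  have hpi := Real.pi_pos
  set d := |1 - ‖1 + (multiplier β)⁻¹‖| with hd
  have hd0 : 0 < d := abs_pos.2 (sub_ne_zero.2 hz1.symm)
  -- This yields `|cos (ω L)| ≤ 1 / 3` on the closed interval of frequencies, which keeps `sin (ω
  -- L)` away from zero.
  have hd1 : d ≤ 1 := by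
    have h1 : ‖1 + (multiplier β)⁻¹‖ ≤ 2 := by
      refine (norm_add_le _ _).trans ?_
      rw [norm_inv, norm_multiplier, norm_one]
      norm_num
    rw [hd, abs_le]
    constructor <;> linarith [norm_nonneg (1 + (multiplier β)⁻¹)]
  set κ := midFrequency n with hκ
  set δ := Real.arcsin (d / 3) / edgeLen with hδ
  have hδL : δ * edgeLen = Real.arcsin (d / 3) := by
    rw [hδ]
    field_simp
  have ha0 : 0 < Real.arcsin (d / 3) := Real.arcsin_pos.2 (by positivity)
  have ha1 : Real.arcsin (d / 3) < Real.pi / 2 := Real.arcsin_lt_pi_div_two.2 (by linarith)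
  have hsin : Real.sin (δ * edgeLen) = d / 3 := by
    rw [hδL, Real.sin_arcsin (by linarith) (by linarith)]
  have hδ0 : 0 < δ := by positivity
  -- `κ L ≥ π / 2 > δ L`, so all frequencies are positive and squaring preserves their order.
  have hκδ : 0 < κ - δ := by
    have h1 : κ * edgeLen = Real.pi / 2 + n * Real.pi := by
      rw [hκ, midFrequency]
      field_simp
    have h2 : 0 < (κ - δ) * edgeLen := by
      rw [sub_mul, h1, hδL]
      have : 0 ≤ n * Real.pi := by positivity
      linarith
    exact pos_of_mul_pos_left h2 hL.le
  have hend : ∀ ω, |ω - κ| = δ → |Real.cos (ω * edgeLen)| = d / 3 := fun ω hω => by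
    rw [abs_cos_eq_abs_sin n]
    rcases abs_eq_abs.1 (hω.trans (abs_of_pos hδ0).symm) with h1 | h1
    · rw [h1, hsin, abs_of_pos (by positivity)]
    · rw [h1, neg_mul, Real.sin_neg, hsin, abs_neg, abs_of_pos (by positivity)]
  have hin : ∀ ω, |ω - κ| < δ → |Real.cos (ω * edgeLen)| < d / 3 := fun ω hω => by
    have h1 : |(ω - κ) * edgeLen| < δ * edgeLen := by
      rw [abs_mul, abs_of_pos hL]
      exact mul_lt_mul_of_pos_right hω hL
    have h2 := abs_lt.1 h1
    rw [hδL] at h2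
    rw [abs_cos_eq_abs_sin n, ← hsin, abs_lt, ← Real.sin_neg, hδL]
    constructor <;> refine Real.strictMonoOn_sin ⟨?_, ?_⟩ ⟨?_, ?_⟩ ?_ <;> linarith
  have hthree : ∀ ω, |3 * Real.cos (ω * edgeLen)| = 3 * |Real.cos (ω * edgeLen)| := fun ω => by
    rw [abs_mul, abs_of_pos (by norm_num : (0 : ℝ) < 3)]
  refine ⟨Ioo ((κ - δ) ^ 2) ((κ + δ) ^ 2), ?_, fun t ht μ hμ bc =>
    ⟨_, _, ?_, rfl, ?_, ?_, ?_⟩⟩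
  · change κ ^ 2 ∈ _
    constructor <;> nlinarith
  · nlinarith
  · rw [Set.disjoint_left]
    intro y hy
    have hy0 : 0 < y := (sq_nonneg _).trans_lt hy.1
    have h1 : κ - δ < √y := Real.lt_sqrt_of_sq_lt hy.1
    have h2 : √y < κ + δ := (Real.sqrt_lt' (by linarith)).2 hy.2
    have h3 := hin (√y) (abs_lt.2 ⟨by linarith, by linarith⟩)
    rw [← Real.sq_sqrt hy0.le]
    exact notMem_essSpectrum_of_abs_cos_lt hμ ht bc (Real.sqrt_pos.2 hy0)
      (sinC_ne_zero_of_abs_cos_lt_one (by linarith)) hz (by rw [hthree]; linarith)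
  · have h1 := hend (κ - δ) (by rw [sub_sub_cancel_left, abs_neg, abs_of_pos hδ0])
    exact mem_essSpectrum_of_abs_cos_eq ht bc (sinC_ne_zero_of_abs_cos_lt_one (by linarith)) hz hz1
      (by rw [hthree]; linarith)
  · have h1 := hend (κ + δ) (by rw [add_sub_cancel_left, abs_of_pos hδ0])
    exact mem_essSpectrum_of_abs_cos_eq ht bc (sinC_ne_zero_of_abs_cos_lt_one (by linarith)) hz hz1
      (by rw [hthree]; linarith)

end Gaps

end Honeycomb

end

/-- The number `2 cos (π β)` is positive for `β < 1 / 2`, and by injectivity of the cosine on `[0,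
π]` it equals `1` only for `β = 1 / 3`, the one value at which the gap closes up. -/
theorem mainTheorem9 (β : ℝ) (hβ₀ : 0 ≤ β) (hβ₁ : β < 1 / 2) (hβ₂ : β ≠ 1 / 3) (n : ℕ) :
    ∃ I : Set ℝ, Honeycomb.lambdaStar n ∈ I ∧
      ∀ t ∈ Icc (0 : ℝ) (2 * Honeycomb.edgeLen), ∀ μ : ℝ, 0 < μ →
        ∀ bc : Honeycomb.BoundaryType,
          Honeycomb.IsGap (Honeycomb.essSpectrum (Honeycomb.limitOperator bc t μ β)) I := by
  have hpi := Real.pi_pos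
  have hn := Honeycomb.norm_one_add_inv_multiplier hβ₀ hβ₁
  have h0 : 0 < Real.cos (Real.pi * β) := Real.cos_pos_of_mem_Ioo ⟨by nlinarith, by nlinarith⟩
  refine Honeycomb.exists_gap (norm_pos_iff.1 (by rw [hn]; positivity)) (fun h => hβ₂ ?_) n
  have h1 : Real.cos (Real.pi * β) = Real.cos (Real.pi / 3) := by
    rw [Real.cos_pi_div_three]
    linarith
  have h2 := Real.injOn_cos ⟨by positivity, by nlinarith⟩ ⟨by positivity, by linarith⟩ h1
  refine mul_left_cancel₀ hpi.ne' ?_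
  linarith
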